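/- **Problem.** Let $n\ge 1$ and $m\ge 2$, and consider $$\min_{x\in\mathbb R^n} F(x):=f(x)+h(x)\quad\text{s.t. } g(x)=(g_1(x),\dots,g_m(x))\le 0 ,$$ where: $f:\mathbb R^n\to\mathbb R$ is differentiable and $\mu$-strongly convex ($\mu>0$) with $L_f$-Lipschitz gradient; $g$ is differentiable, its Jacobian $J_g$ is $L_g$-Lipschitz in the spectral norm, and each $g_i$ is convex; $h:\mathbb R^n\to(-\infty,+\infty]$ is closed and convex with bounded domain. Let $D_h$ be the diameter of $\operatorname{dom}h$, $G=\sup_{\operatorname{dom} h}\|g\|$, $B_g=\sup_{\operatorname{dom} h}\|J_g\|$. Let $(x^*,z^*)$ be any KKT pair: $0\in\partial F(x^*)+J_g(x^*)^\top z^*$, $z^*\ge0$, $g(x^*)\le0$, $g(x^*)^\top z^*=0$ (one is assumed to exist). A point $\bar x\in\operatorname{dom}h$ is an *$\varepsilon$-KKT point* with multiplier $\bar z\ge0$ if $\operatorname{dist}(0,\partial F(\bar x)+J_g(\bar x)^\top\bar z)\le\varepsilon$, $\|[g(\bar x)]_+\|\le\varepsilon$ and $\sum_i|\bar z_ig_i(\bar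 x)|\le\varepsilon$. **Algorithm.** The inputs are $\beta_0>0$, $\sigma>1$, $\varepsilon>0$, $L_{\min}>0$, $\gamma_1>1$, $\gamma_2\ge1$. *APG* (for $\psi+h$ with tolerance $\tau$). Write $\operatorname{prox}_L(y)=\arg\min_x\langle\nabla\psi(y),x\rangle+\frac L2\|x-y\|^2+h(x)$. A *line search* from $L_0$ with query points $y(L)$ tries $L=L_0,\gamma_1L_0,\gamma_1^2L_0,\dots$ until $x=\operatorname{prox}_L(y(L))$ satisfies $\psi(x)\le\psi(y(L))+\langle\nabla\psi(y(L)),x-y(L)\rangle+\frac L2\|x-y(L)\|^2$. First do a line search from $L_{\min}$ at an arbitrary fixed $y^0\in\operatorname{dom}h$, with result $(L,x)$; set $x^{-1}=x^0=x$, $L_0=\max\{L_{\min},L/\gamma_2\}$, $\alpha_{-1}=1$. For $k=0,1,\dots$: do a line search from $L_k$ with $\alpha_k=\sqrt{\mu/L}$ and query point $x^k+\frac{\alpha_k(1-\alpha_{k-1})}{\alpha_{k-1}(1+\alpha_k)}(x^k-x^{k-1})$, with result $(\tilde L,\tilde x)$; do a line search from $\tilde L$ at the fixed point $\tilde x$,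 with result $\hat x$; set $x^{k+1}=\tilde x$, $L_{k+1}=\max\{L_{\min},\tilde L/\gamma_2\}$; stop with $\hat x$ if $\operatorname{dist}(0,\partial(\psi+h)(\hat x))\le\tau$. *Ellipsoid* (for $\beta,z,\delta,b$). Let $\theta(x)=g(x)+z/\beta$, $\Phi(x,y)=F(x)+\beta(y^\top\theta(x)-\frac12\|y\|^2)$, $d(y)=\min_x\Phi(x,y)$, $B_d=\max\{\|\nabla d(y)\|:y\ge0,\|y\|\le b\}$, let $\eta_+$ be the positive root of $\frac{\mu+\beta B_g^2}{\mu}\big(\eta+\sqrt{2\eta B_d/\beta}\big)=\frac\delta4$, and $\eta=\min\{b,\eta_+\}$. Start with $\mathcal E=\{y:(y-\hat y)^\top B^{-1}(y-\hat y)\le1\}$, $B=b^2I$, $\hat y=0$. While $\operatorname{vol}\mathcal E>4^{-m}\operatorname{vol}(\text{ball of radius }\eta)$: if $\hat y\not\ge0$, take $a=-e_i$ with $\hat y_i$ smallest; else if $\|\hat y\|>b$, take $a=\hat y$; else apply APG to $\Phi(\cdot,\hat y)$ with tolerance $\min\{\frac{\mu\delta}{4B_g},\frac{\mu^2\delta}{8B_g(\mu+\beta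 B_g^2)}\}$ to get $\hat x$, stop successfully with $(\hat x,\hat y)$ if $\|[\theta(\hat x)]_+-\hat y\|\le\frac{3\delta}4$, and otherwise take $a=\hat y-\theta(\hat x)$. Then replace $B$ by $\frac{m^2}{m^2-1}\big(B-\frac{2}{(m+1)a^\top Ba}Ba(Ba)^\top\big)$ and $\hat y$ by $\hat y-\frac1{m+1}\frac{Ba}{\sqrt{a^\top Ba}}$ (both with the old $B$). *StEM* (for $\beta,z,\delta$). Run Ellipsoid with $b=\frac1\beta,\frac2\beta,\frac4\beta,\dots$ until it is successful. *Cutting-plane iALM.* Let $\bar\varepsilon=\min\big\{\varepsilon,\sqrt{\varepsilon\mu(\sigma-1)/(8\sigma+1)}\big\}$, $z^0=0$, $\beta_k=\beta_0\sigma^k$. For $k=0,1,\dots$: let $(x^{k+1},y^{k+1})$ be the output of StEM for $\beta_k$, $z^k$, $\delta_k=\frac{\bar\varepsilon}{3\beta_kB_g}$; if $\min\big\{\frac{\mu}{4\beta_kB_g^2},\frac{\mu^2}{8\beta_kB_g^2(\mu+\beta_kB_g^2)}\big\}>1$, replace $x^{k+1}$ by the output of APG for $f+\beta_k\langle y^{k+1},g\rangle+h$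 with tolerance $\bar\varepsilon/3$; set $z^{k+1}=[z^k+\beta_kg(x^{k+1})]_+$; stop with $(x^{k+1},z^{k+1})$ if $x^{k+1}$ is an $\varepsilon$-KKT point with multiplier $z^{k+1}$. **Theorem.** For all $\sigma>1$ and $\gamma_1>1$ there is a constant $C>0$ depending only on $\sigma,\gamma_1$ such that the following holds for every problem, KKT pair and inputs as above for which $$\bar\varepsilon\le\min\Big\{\varepsilon,\frac{24B_g(\mu+\beta_kB_g^2)}{\mu}\Big\}\quad\text{for all }k\ge0 ,$$ and for all choices of the starting points of APG in $\operatorname{dom}h$ and of the smallest components. The cutting-plane iALM terminates, its output $(\bar x,\bar z)$ is an $\varepsilon$-KKT point with its multiplier, and the total number $T$ of evaluations of $f$, $\nabla f$, $g$ and $J_g$ satisfies $$T\le C\,H\; m^2\sqrt{\frac{L_f+L_g(1+\|z^*\|)}{\mu}}\;\max\{|\log\varepsilon|,\Lambda\}^3 .$$ Here, with $L=L_f+L_g(1+\|z^*\|)$ and $\log^+=\max\{0,\log\}$, $$H=\sqrt{\max\{1,L_{\min}/L\}}\,\big(1+\log^+(L/L_{\min})\big)\big(1+\log^+\|z^*\|\big),$$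 $$\Lambda=1+|\log\mu|+|\log B_g|+|\log\beta_0|+|\log L_{\min}|+\log(1+L_f)+\log(1+L_g)+\log(1+\|z^*\|)+\log(1+G)+\log(1+D_h),$$ which depend neither on $\varepsilon$ nor explicitly on $m$. In particular $T=O\Big(m^2\sqrt{\frac{L_f+L_g(1+\|z^*\|)}{\mu}}\,|\log\varepsilon|^3\Big)$, with hidden constant $CH$ as soon as $|\log\varepsilon|\ge\Lambda$. -/

import Mathlib

open MeasureTheory

noncomputable section

namespace CutPlaneALM

/-! ### Programs that may diverge and that count oracle evaluations -/

/-- A deterministic program returning a value of type `α` together with the number of oracle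
evaluations it has made; it is undefined when the program runs forever. -/
structure Prog (α : Type) where
  run : Part (α × ℕ)

instance : Monad Prog where
  pure a := ⟨Part.some (a, 0)⟩
  bind p q := ⟨p.run.bind fun r => (q r.1).run.map fun s => (s.1, r.2 + s.2)⟩

/-- Record `k` oracle evaluations. -/
def tick (k : ℕ) : Prog Unit := ⟨Part.some ((), k)⟩

/-- The program `p` terminates, returns `a`, and makes exactly `k` oracle evaluations. -/
def Prog.Returns {α : Type} (p : Prog α) (a : α) (k : ℕ) : Prop := (a, k) ∈ p.run

/-- Repeat `body` (from the state `s`) until it answers `Sum.inl r`, then return `r`;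
`Sum.inr s'` means that the loop goes on from the state `s'`. -/
def loop {S R : Type} (body : S → Prog (R ⊕ S)) (s : S) : Prog R :=
  ⟨PFun.fix
    (fun t : S × ℕ => (body t.1).run.map fun u =>
      Sum.map (fun r => (r, t.2 + u.2)) (fun s' => (s', t.2 + u.2)) u.1)
    (s, 0)⟩

/-! ### The constrained composite problem -/

/-- Euclidean `n`-space. -/
abbrev Vec (n : ℕ) : Type := EuclideanSpace ℝ (Fin n)

/-- The data of `min f(x) + h(x)` subject to `g(x) ≤ 0`, with `h` extended-valued. -/
structure Problem (n m : ℕ) where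
  f : Vec n → ℝ
  h : Vec n → EReal
  g : Vec n → Vec m

/-- Effective domain of an extended-valued function. -/
def dom {n : ℕ} (h : Vec n → EReal) : Set (Vec n) := {x | h x < ⊤}

/-- Componentwise positive part of a vector. -/
def pos {m : ℕ} (v : Vec m) : Vec m := WithLp.toLp 2 fun i => max (v i) 0

/-- Convex subdifferential at `x` of the function `ψ + h`. -/
def subdiff {n : ℕ} (ψ : Vec n → ℝ) (h : Vec n → EReal) (x : Vec n) : Set (Vec n) :=
  {v | x ∈ dom h ∧
    ∀ u ∈ dom h, ψ x + (h x).toReal + inner ℝ v (u - x) ≤ ψ u + (h u).toReal}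

/-- `dist(0, ∂(ψ + h)(x)) ≤ ε`, the distance being a minimum over a closed set
(and infinite if the subdifferential is empty). -/
def NearStationary {n : ℕ} (ψ : Vec n → ℝ) (h : Vec n → EReal) (x : Vec n) (ε : ℝ) : Prop :=
  ∃ v ∈ subdiff ψ h x, ‖v‖ ≤ ε

/-- Smoothness, bounded domain and convexity, strong convexity. The Jacobian of `g` is its
Fréchet derivative, measured in the operator (spectral) norm. -/
structure Regular {n m : ℕ} (P : Problem n m) (Lf Lg μ : ℝ) : Prop where
  f_diff : Differentiable ℝ P.f
  f_smooth : ∀ x y, ‖gradient P.f x - gradient P.f y‖ ≤ Lf * ‖x - y‖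
  g_diff : Differentiable ℝ P.g
  g_smooth : ∀ x y, ‖fderiv ℝ P.g x - fderiv ℝ P.g y‖ ≤ Lg * ‖x - y‖
  h_ne_bot : ∀ x, P.h x ≠ ⊥
  h_closed : LowerSemicontinuous P.h
  h_convex : ConvexOn ℝ (dom P.h) fun x => (P.h x).toReal
  dom_bounded : Bornology.IsBounded (dom P.h)
  g_convex : ∀ i, ConvexOn ℝ Set.univ fun x => P.g x i
  μ_pos : 0 < μ
  f_strong : StrongConvexOn Set.univ μ P.f

/-- `(x, z)` satisfies the KKT conditions. -/
def IsKKT {n m : ℕ} (P : Problem n m) (x : Vec n) (z : Vec m) : Prop :=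
  (∃ v ∈ subdiff P.f P.h x, v + (fderiv ℝ P.g x).adjoint z = 0) ∧
  (∀ i, 0 ≤ z i) ∧ (∀ i, P.g x i ≤ 0) ∧ inner ℝ (P.g x) z = 0

/-- The three inequalities of an `ε`-KKT point, with the multiplier `z`. -/
def IsEpsKKTPair {n m : ℕ} (P : Problem n m) (ε : ℝ) (x : Vec n) (z : Vec m) : Prop :=
  x ∈ dom P.h ∧ (∀ i, 0 ≤ z i) ∧
  NearStationary (fun u => P.f u + inner ℝ z (P.g u)) P.h x ε ∧
  ‖pos (P.g x)‖ ≤ ε ∧ ∑ i, |z i * P.g x i| ≤ ε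

/-- `x` is an `ε`-KKT point. -/
def IsEpsKKT {n m : ℕ} (P : Problem n m) (ε : ℝ) (x : Vec n) : Prop :=
  ∃ z, IsEpsKKTPair P ε x z

/-- Diameter of the domain of `h`. -/
def diamDom {n m : ℕ} (P : Problem n m) : ℝ := Metric.diam (dom P.h)

/-- Bound of `‖g‖` on the domain of `h`. -/
def boundG {n m : ℕ} (P : Problem n m) : ℝ := sSup ((fun x => ‖P.g x‖) '' dom P.h)

/-- Bound of `‖J_g‖` on the domain of `h`. -/
def boundJ {n m : ℕ} (P : Problem n m) : ℝ := sSup ((fun x => ‖fderiv ℝ P.g x‖) '' dom P.h)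

/-! ### The adaptive accelerated proximal gradient method (APG)

It is applied to `ψ + h` where `ψ` is a combination of `f` and the components of `g`: a value of
`ψ` costs two evaluations (`f` and `g`), a gradient of `ψ` costs two (`∇f` and `J_g`). Nothing is
cached, so the counts are upper bounds for any implementation. -/

/-- `x` minimizes `⟨∇ψ(y), ·⟩ + (L/2)‖· - y‖² + h`. -/
def IsProxStep {n : ℕ} (ψ : Vec n → ℝ) (h : Vec n → EReal) (L : ℝ) (y x : Vec n) : Prop :=
  x ∈ dom h ∧ ∀ u ∈ dom h,
    inner ℝ (gradient ψ y) x + L / 2 * ‖x - y‖ ^ 2 + (h x).toReal ≤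
      inner ℝ (gradient ψ y) u + L / 2 * ‖u - y‖ ^ 2 + (h u).toReal

/-- The (unique) minimizer of the proximal gradient model. -/
def proxStep {n : ℕ} (ψ : Vec n → ℝ) (h : Vec n → EReal) (L : ℝ) (y : Vec n) : Vec n :=
  Classical.epsilon (IsProxStep ψ h L y)

open Classical in
/-- Line search: for `L = L₀, γ₁ L₀, γ₁² L₀, …` let `y = query L` and let `x` be the proximal
gradient step from `y`, until `ψ(x) ≤ ψ(y) + ⟨∇ψ(y), x - y⟩ + (L/2)‖x - y‖²`; return `(L, x)`.
Each trial evaluates `ψ` twice and `∇ψ` once. -/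
def lineSearch {n : ℕ} (ψ : Vec n → ℝ) (h : Vec n → EReal) (γ₁ : ℝ) (query : ℝ → Vec n)
    (L₀ : ℝ) : Prog (ℝ × Vec n) :=
  loop (fun L => do
    let y := query L
    let x := proxStep ψ h L y
    tick 6
    if ψ x ≤ ψ y + inner ℝ (gradient ψ y) (x - y) + L / 2 * ‖x - y‖ ^ 2 then
      return Sum.inl (L, x)
    else
      return Sum.inr (γ₁ * L)) L₀

/-- State of APG: the iterates `x^k`, `x^{k-1}`, the estimate `L_k`, and `α_{k-1}`. -/
structure APGState (n : ℕ) where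
  x : Vec n
  xprev : Vec n
  L : ℝ
  α : ℝ

open Classical in
/-- APG for `ψ + h` with strong convexity constant `μ`, tolerance `tol`, and starting point `y₀`. -/
def apg {n : ℕ} (ψ : Vec n → ℝ) (h : Vec n → EReal) (μ Lmin tol γ₁ γ₂ : ℝ) (y₀ : Vec n) :
    Prog (Vec n) := do
  let r ← lineSearch ψ h γ₁ (fun _ => y₀) Lmin
  loop (fun s : APGState n => do
      let query := fun L : ℝ =>
        s.x + (√(μ / L) * (1 - s.α) / (s.α * (1 + √(μ / L)))) • (s.x - s.xprev)
      let t ← lineSearch ψ h γ₁ query s.L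
      let t' ← lineSearch ψ h γ₁ (fun _ => t.2) t.1
      tick 2
      if NearStationary ψ h t'.2 tol then
        return Sum.inl t'.2
      else
        return Sum.inr { x := t.2, xprev := s.x, L := max Lmin (t.1 / γ₂), α := √(μ / t.1) })
    { x := r.2, xprev := r.2, L := max Lmin (r.1 / γ₂), α := 1 }

/-! ### The saddle-point form of the augmented Lagrangian subproblem -/

/-- `θ(x) = g(x) + z/β`. -/
def theta {n m : ℕ} (P : Problem n m) (β : ℝ) (z : Vec m) (x : Vec n) : Vec m :=
  P.g x + β⁻¹ • z

/-- `Φ(x, y) - h(x) = f(x) + β (yᵀθ(x) - ‖y‖²/2)`. -/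
def smoothPhi {n m : ℕ} (P : Problem n m) (β : ℝ) (z y : Vec m) (x : Vec n) : ℝ :=
  P.f x + β * (inner ℝ y (theta P β z x) - ‖y‖ ^ 2 / 2)

/-- The dual function `d(y) = min_x Φ(x, y)`. -/
def dualFun {n m : ℕ} (P : Problem n m) (β : ℝ) (z y : Vec m) : ℝ :=
  sInf ((fun x => smoothPhi P β z y x + (P.h x).toReal) '' dom P.h)

/-- `B_d`: the maximum of `‖∇d(y)‖` over `y ≥ 0` with `‖y‖ ≤ b`. -/
def boundDualGrad {n m : ℕ} (P : Problem n m) (β : ℝ) (z : Vec m) (b : ℝ) : ℝ :=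
  sSup ((fun y => ‖gradient (dualFun P β z) y‖) '' {y : Vec m | (∀ i, 0 ≤ y i) ∧ ‖y‖ ≤ b})

/-- The (unique) positive root `η₊` of
`((μ + β B_g²)/μ) (η + √(2 η B_d/β)) = δ/4`. -/
def etaPlus {n m : ℕ} (P : Problem n m) (μ β : ℝ) (z : Vec m) (δ b : ℝ) : ℝ :=
  sInf {η : ℝ | 0 < η ∧
    (μ + β * boundJ P ^ 2) / μ * (η + √(2 * η * boundDualGrad P β z b / β)) = δ / 4}

/-! ### The ellipsoid method for the dual problem -/

/-- The ellipsoid `{y : (y - c)ᵀ B⁻¹ (y - c) ≤ 1}`. -/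
def ellSet {m : ℕ} (B : Matrix (Fin m) (Fin m) ℝ) (c : Vec m) : Set (Vec m) :=
  {y | (y - c).ofLp ⬝ᵥ (B⁻¹.mulVec (y - c).ofLp) ≤ 1}

/-- State of the ellipsoid method: matrix, center, iteration counter. -/
structure EllState (m : ℕ) where
  B : Matrix (Fin m) (Fin m) ℝ
  y : Vec m
  k : ℕ

/-- Central cut `⟨a, y - ŷ⟩ ≤ 0`: the next ellipsoid. -/
def EllState.cut {m : ℕ} (s : EllState m) (a : Vec m) : EllState m where
  B := ((m : ℝ) ^ 2 / ((m : ℝ) ^ 2 - 1)) •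
    (s.B - (2 / (((m : ℝ) + 1) * (a.ofLp ⬝ᵥ s.B.mulVec a.ofLp))) •
      Matrix.vecMulVec (s.B.mulVec a.ofLp) (s.B.mulVec a.ofLp))
  y := s.y - (1 / ((m : ℝ) + 1)) • (1 / √(a.ofLp ⬝ᵥ s.B.mulVec a.ofLp)) •
    (WithLp.toLp 2 (s.B.mulVec a.ofLp) : Vec m)
  k := s.k + 1

/-- Parameters shared by all subroutines. -/
structure Params where
  μ : ℝ
  Lmin : ℝ
  γ₁ : ℝ
  γ₂ : ℝ

open Classical in
/-- The ellipsoid method with search radius `b`. It returns `some (x̂, ŷ)` where the pseudocode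
returns `FLAG = 1`, and `none` for `FLAG = 0`. In iteration `k`, `start k` is the starting point
of the call to APG and `idx k ŷ` is the chosen index of a smallest component of `ŷ`. One
evaluation of `g` is charged for `θ(x̂)`. -/
def ellipsoid {n m : ℕ} (P : Problem n m) (p : Params) (β : ℝ) (z : Vec m) (δ b : ℝ)
    (start : ℕ → Vec n) (idx : ℕ → Vec m → Fin m) : Prog (Option (Vec n × Vec m)) :=
  let Bg := boundJ P
  let tol := min (p.μ * δ / (4 * Bg)) (p.μ ^ 2 * δ / (8 * Bg * (p.μ + β * Bg ^ 2)))
  let η := min b (etaPlus P p.μ β z δ b)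
  loop (fun s : EllState m => do
    if volume (ellSet s.B s.y) ≤ (4 : ENNReal)⁻¹ ^ m * volume (Metric.closedBall (0 : Vec m) η) then
      return Sum.inl none
    else if ¬ ∀ i, 0 ≤ s.y i then
      return Sum.inr (s.cut (-EuclideanSpace.single (idx s.k s.y) (1 : ℝ)))
    else if b < ‖s.y‖ then
      return Sum.inr (s.cut s.y)
    else do
      let x ← apg (smoothPhi P β z s.y) P.h p.μ p.Lmin tol p.γ₁ p.γ₂ (start s.k)
      tick 1
      if ‖pos (theta P β z x) - s.y‖ ≤ 3 * δ / 4 then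
        return Sum.inl (some (x, s.y))
      else
        return Sum.inr (s.cut (s.y - theta P β z x)))
    { B := (b ^ 2) • (1 : Matrix (Fin m) (Fin m) ℝ), y := 0, k := 0 }

/-- StEM: search by the ellipsoid method with radii `b = 1/β, 2/β, 4/β, …` until success. The
state is the round number and the current radius. -/
def stem {n m : ℕ} (P : Problem n m) (p : Params) (β : ℝ) (z : Vec m) (δ : ℝ)
    (start : ℕ → ℕ → Vec n) (idx : ℕ → ℕ → Vec m → Fin m) : Prog (Vec n × Vec m) :=
  loop (fun s : ℕ × ℝ => do
    let r ← ellipsoid P p β z δ s.2 (start s.1) (idx s.1)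
    match r with
    | some xy => return Sum.inl xy
    | none => return Sum.inr (s.1 + 1, 2 * s.2)) (0, 1 / β)

/-! ### The cutting-plane inexact augmented Lagrangian method -/

/-- Everything that the pseudocode leaves open: the starting points of the calls to APG (in the
ellipsoid method: outer iteration, StEM round, ellipsoid iteration; in the final correction: outer
iteration) and the choice among several smallest components of a vector. -/
structure Choices (n m : ℕ) where
  start : ℕ → ℕ → ℕ → Vec n
  startFinal : ℕ → Vec n
  idx : ℕ → ℕ → ℕ → Vec m → Fin m

/-- Starting points lie in the domain of `h`, and the chosen component is a smallest one. -/
structure Choices.Valid {n m : ℕ} (c : Choices n m) (P : Problem n m) : Prop where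
  start_mem : ∀ k j i, c.start k j i ∈ dom P.h
  startFinal_mem : ∀ k, c.startFinal k ∈ dom P.h
  idx_min : ∀ (k j i : ℕ) (y : Vec m) (l : Fin m), y (c.idx k j i y) ≤ y l

/-- State of the outer loop: `k`, `z^k`, `β_k`. -/
structure ALMState (m : ℕ) where
  k : ℕ
  z : Vec m
  β : ℝ

open Classical in
/-- The cutting-plane first-order iALM (for more than one constraint), with subproblem tolerances
`εs k`; it starts from `z⁰ = 0` and returns the pair `(x̄, z̄)`. One evaluation of `g` is charged for
the multiplier update, and one each of `∇f`, `g`, `J_g` for the `ε`-KKT test. -/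
def ialm {n m : ℕ} (P : Problem n m) (p : Params) (β₀ σ ε : ℝ) (εs : ℕ → ℝ)
    (c : Choices n m) : Prog (Vec n × Vec m) :=
  let Bg := boundJ P
  loop (fun s : ALMState m => do
    let xy ← stem P p s.β s.z (εs s.k / (3 * s.β * Bg)) (c.start s.k) (c.idx s.k)
    let x ← (if 1 < min (p.μ / (4 * s.β * Bg ^ 2))
        (p.μ ^ 2 / (8 * s.β * Bg ^ 2 * (p.μ + s.β * Bg ^ 2))) then
      apg (fun u => P.f u + s.β * inner ℝ xy.2 (P.g u)) P.h p.μ p.Lmin (εs s.k / 3) p.γ₁ p.γ₂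
        (c.startFinal s.k)
    else
      pure xy.1)
    let z' := pos (s.z + s.β • P.g x)
    tick 4
    if IsEpsKKTPair P ε x z' then
      return Sum.inl (x, z')
    else
      return Sum.inr { k := s.k + 1, z := z', β := σ * s.β })
    { k := 0, z := 0, β := β₀ }

/-! ### Quantities of the complexity bound -/

/-- The tolerance `min{ε, √(ε μ (σ - 1)/(8 σ + 1))}` of the subproblems. -/
def subTol (μ σ ε : ℝ) : ℝ := min ε √(ε * μ * (σ - 1) / (8 * σ + 1))

/-- `1` plus the sum of the logarithmic magnitudes of the problem constants. -/
def logSize {n m : ℕ} (P : Problem n m) (Lf Lg μ β₀ Lmin : ℝ) (zs : Vec m) : ℝ :=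
  1 + |Real.log μ| + |Real.log (boundJ P)| + |Real.log β₀| + |Real.log Lmin| +
    Real.log (1 + Lf) + Real.log (1 + Lg) + Real.log (1 + ‖zs‖) +
    Real.log (1 + boundG P) + Real.log (1 + diamDom P)

/-- The factor, free of `m` and `ε`, that the overall bound hides: with
`L = L_f + L_g (1 + ‖z*‖)` it is
`√(max{1, L_min/L}) (1 + log⁺(L/L_min)) (1 + log⁺ ‖z*‖)`. -/
def hiddenFactor {m : ℕ} (Lf Lg Lmin : ℝ) (zs : Vec m) : ℝ :=
  √(max 1 (Lmin / (Lf + Lg * (1 + ‖zs‖)))) *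
    (1 + Real.posLog ((Lf + Lg * (1 + ‖zs‖)) / Lmin)) * (1 + Real.posLog ‖zs‖)

end CutPlaneALM

end

/-!
The theorem combines four estimates, all of which hold with explicit constants.

*Accelerated proximal gradients.* A line search accepts every `L` above the true smoothness
constant `Lψ`, so it ends with `L` at most `Lmax = max (Lmin, γ₁ Lψ)`, and its number of trials is
logarithmic in `Lψ / Lmin`. For the accelerated iteration a Lyapunov function (the gap
`ψ + h - min` plus a multiple of the squared distance of an auxiliary point to the minimizer)
contracts by `1 - √(μ / Lmax)` per step (`apg_contraction`), even if `L` goes down between steps;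
a line search that accepts some `L < μ` has found the minimizer (`isArgmin_of_accepted_of_lt`).
The gap controls the residual of one further proximal step, so that `apg_spec` bounds the cost by
`√(Lmax / μ)` times a logarithm.

*Ellipsoids.* Each central cut multiplies the determinant of the ellipsoid by at most
`exp (-1 / (m + 1))` and keeps a half-ellipsoid (`det_cut_le`, `mem_ellSet_cut`). The subproblem
of the augmented Lagrangian method has a saddle point `(x, y)` with `y = [θ(x)]₊`
(`exists_saddle`). At a center where the stopping test fails, the residual bounds the distance to
`y` from below, and the dual function is strongly concave; hence no point of the orthant within
distance `η₊` of `y` and in the ball of radius `b` is ever cut off (`cut_keeps`). If `‖y‖ ≤ b`,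
such points fill a volume exceeding the threshold at which the method gives up
(`lt_volume_orthantBall_inter`). So the method succeeds as soon as `b ≥ ‖y‖`, and the doubling
search for `b` costs a factor logarithmic in `‖z*‖` (`Regular.stem_spec`).

*Multipliers.* An output of the search, after the final correction if there is one, is nearly
stationary for the Lagrangian with the updated multiplier (`nearStationary_of_ellOutput`,
`nearStationary_of_correction`). The update is an inexact proximal point step for the dual
problem, so its distance to the multiplier `z*` hardly grows (`multiplier_progress`), and the
tolerance of the subproblems makes the accumulated error small (`subTol_sq_le`). The multipliers
thus stay bounded by `1 + 3 ‖z*‖`, and once `β ε` exceeds `16 (1 + ‖z*‖)²` the point is feasible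
and complementary up to `ε` (`isEpsKKTPair_of_large`). As `β` grows geometrically, this takes
logarithmically many rounds (`Regular.ialm_spec`).

*Sizes.* With `E = exp (max |log ε| Λ)`, all data and all quantities derived from them are bounded
by powers of `E` with exponents depending only on `σ` and `γ₁` (`PowLe`, `Scale`). A logarithm of
each of them is therefore `O(log E)`. Three such logarithms multiply, one each for the accelerated
method, the ellipsoid method and the outer loop; those of `L / Lmin` and of `‖z*‖` are part of the
factor `H`.
-/

namespace CutPlaneALM

/-! ### Bounding the cost of programs -/

/-- Total correctness with a cost bound: `p` terminates after at most `c` oracle evaluations and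
its value satisfies `Q`. -/
def Spec {α : Type} (p : Prog α) (c : ℝ) (Q : α → Prop) : Prop :=
  ∃ a t, p.Returns a t ∧ (t : ℝ) ≤ c ∧ Q a

theorem Spec.nonneg {α : Type} {p : Prog α} {c : ℝ} {Q : α → Prop} (h : Spec p c Q) : 0 ≤ c := by
  obtain ⟨_, t, _, ht, _⟩ := h
  exact (Nat.cast_nonneg t).trans ht

theorem Spec.mono {α : Type} {p : Prog α} {c c' : ℝ} {Q Q' : α → Prop} (h : Spec p c Q)
    (hc : c ≤ c') (hQ : ∀ a, Q a → Q' a) : Spec p c' Q' := by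
  obtain ⟨a, t, h1, h2, h3⟩ := h
  exact ⟨a, t, h1, h2.trans hc, hQ a h3⟩

theorem spec_pure {α : Type} {a : α} {Q : α → Prop} (h : Q a) : Spec (pure a : Prog α) 0 Q :=
  ⟨a, 0, Part.mem_some _, by simp, h⟩

theorem spec_tick {k : ℕ} : Spec (tick k) k (fun _ => True) :=
  ⟨(), k, Part.mem_some _, le_rfl, trivial⟩

theorem Spec.bind {α β : Type} {p : Prog α} {q : α → Prog β} {c c' : ℝ} {Q : α → Prop}
    {R : β → Prop} (hp : Spec p c Q) (hq : ∀ a, Q a → Spec (q a) c' R) :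
    Spec (p >>= q) (c + c') R := by
  obtain ⟨a, t, h1, h2, h3⟩ := hp
  obtain ⟨b, u, g1, g2, g3⟩ := hq a h3
  refine ⟨b, t + u, ?_, by push_cast; linarith, g3⟩
  exact Part.mem_bind_iff.2 ⟨_, h1, (Part.mem_map_iff _).2 ⟨_, g1, rfl⟩⟩

/-- The rule for loops: `I j` is an invariant that holds after `j` rounds and that fails when `j`
exceeds `A`, so that the loop ends after at most `A + 1` rounds. -/
theorem spec_loop {S R : Type} {body : S → Prog (R ⊕ S)} {I : ℕ → S → Prop} {Q : R → Prop}
    {A c : ℝ} (hA : ∀ j s, I j s → (j : ℝ) ≤ A)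
    (hbody : ∀ j s, I j s → Spec (body s) c (Sum.elim Q (I (j + 1)))) {s : S} (hs : I 0 s) :
    Spec (loop body s) ((A + 1) * c) Q := by
  set F := (fun t : S × ℕ => (body t.1).run.map fun u =>
      Sum.map (fun r => (r, t.2 + u.2)) (fun s' => (s', t.2 + u.2)) u.1) with hF
  have hc : 0 ≤ c := (hbody 0 s hs).nonneg
  have key : ∀ d j : ℕ, ∀ s : S, ∀ w : ℕ, I j s → ⌊A⌋₊ + 1 ≤ j + d →
      ∃ r t, (r, w + t) ∈ PFun.fix F (s, w) ∧ (t : ℝ) ≤ (A + 1 - j) * c ∧ Q r := by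
    intro d
    induction d with
    | zero =>
      intro j s w hI hd
      have h1 := Nat.le_floor (hA j s hI)
      omega
    | succ d ih =>
      intro j s w hI hd
      obtain ⟨u, t, h1, h2, h3⟩ := hbody j s hI
      have hmem : Sum.map (fun r => (r, w + t)) (fun s' => (s', w + t)) u ∈ F (s, w) :=
        (Part.mem_map_iff _).2 ⟨_, h1, rfl⟩
      have hj := hA j s hI
      cases u with
      | inl r =>
        refine ⟨r, t, PFun.fix_stop hmem, ?_, h3⟩
        nlinarith
      | inr s' =>
        obtain ⟨r, t', g1, g2, g3⟩ := ih (j + 1) s' (w + t) h3 (by omega)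
        refine ⟨r, t + t', ?_, ?_, g3⟩
        · rw [PFun.fix_fwd_eq hmem, ← add_assoc]
          exact g1
        · push_cast at g2 ⊢
          linarith
  obtain ⟨r, t, h1, h2, h3⟩ := key (⌊A⌋₊ + 1) 0 s 0 hs (by omega)
  refine ⟨r, t, ?_, by simpa using h2, h3⟩
  simpa [Prog.Returns, loop] using h1

/-! ### Smooth strongly convex functions -/

/-- If `t a + t² b ≥ 0` for all small `t > 0`, then `a ≥ 0`. -/
theorem nonneg_of_first_order {a b : ℝ} (h : ∀ t : ℝ, 0 < t → t ≤ 1 → 0 ≤ t * a + t ^ 2 * b) :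
    0 ≤ a := by
  by_contra! ha
  set t := min 1 (-a / (2 * (|b| + 1))) with ht
  have hb : 0 < |b| + 1 := by positivity
  have h0 : 0 < t := lt_min one_pos (div_pos (neg_pos.2 ha) (by positivity))
  have h1 := h t h0 (min_le_left _ _)
  have h2 : t * (2 * (|b| + 1)) ≤ -a := by
    rw [← le_div_iff₀ (by positivity)]; exact min_le_right _ _
  have h3 : t * b ≤ t * |b| := mul_le_mul_of_nonneg_left (le_abs_self b) h0.le
  have h4 : 0 ≤ t * (a + t * b) := by
    linarith [h1, show t * (a + t * b) = t * a + t ^ 2 * b by ring]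
  have h5 := nonneg_of_mul_nonneg_right h4 h0
  nlinarith

/-- `ψ` is differentiable and `μ`-strongly convex with `L`-Lipschitz gradient; strong convexity and
smoothness are expressed by the quadratic minorant and majorant at each point. -/
structure SmoothStrong {n : ℕ} (ψ : Vec n → ℝ) (L μ : ℝ) : Prop where
  diff : Differentiable ℝ ψ
  lip : ∀ x y, ‖gradient ψ x - gradient ψ y‖ ≤ L * ‖x - y‖
  upper : ∀ x u, ψ u ≤ ψ x + inner ℝ (gradient ψ x) (u - x) + L / 2 * ‖u - x‖ ^ 2
  lower : ∀ x u, ψ x + inner ℝ (gradient ψ x) (u - x) + μ / 2 * ‖u - x‖ ^ 2 ≤ ψ u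
  μ_pos : 0 < μ

/-- The descent lemma. -/
theorem le_quadratic_of_lipschitz_gradient {n : ℕ} {ψ : Vec n → ℝ} {L : ℝ}
    (hd : Differentiable ℝ ψ) (hL : ∀ x y, ‖gradient ψ x - gradient ψ y‖ ≤ L * ‖x - y‖)
    (x u : Vec n) :
    ψ u ≤ ψ x + inner ℝ (gradient ψ x) (u - x) + L / 2 * ‖u - x‖ ^ 2 := by
  set v := u - x with hv
  set φ : ℝ → ℝ := fun t => ψ (x + t • v) - t * inner ℝ (gradient ψ x) v -
    t ^ 2 * (L / 2 * ‖v‖ ^ 2) with hφ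
  have hline : ∀ t : ℝ, HasDerivAt (fun t : ℝ => x + t • v) v t := fun t => by
    simpa using ((hasDerivAt_id t).smul_const v).const_add x
  have hder : ∀ t : ℝ, HasDerivAt φ (inner ℝ (gradient ψ (x + t • v)) v -
      inner ℝ (gradient ψ x) v - 2 * t * (L / 2 * ‖v‖ ^ 2)) t := by
    intro t
    have h1 : HasDerivAt (fun t : ℝ => ψ (x + t • v)) (inner ℝ (gradient ψ (x + t • v)) v) t := by
      have := (hd (x + t • v)).hasFDerivAt.comp_hasDerivAt t (hline t)
      rwa [← inner_gradient_left] at this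
    have h2 : HasDerivAt (fun t : ℝ => t * inner ℝ (gradient ψ x) v)
        (inner ℝ (gradient ψ x) v) t := by
      simpa using (hasDerivAt_id t).mul_const (inner ℝ (gradient ψ x) v)
    have h3 : HasDerivAt (fun t : ℝ => t ^ 2 * (L / 2 * ‖v‖ ^ 2))
        (2 * t * (L / 2 * ‖v‖ ^ 2)) t := by
      simpa using (hasDerivAt_pow 2 t).mul_const (L / 2 * ‖v‖ ^ 2)
    exact (h1.sub h2).sub h3
  have hanti : AntitoneOn φ (Set.Icc 0 1) := by
    refine antitoneOn_of_deriv_nonpos (convex_Icc 0 1)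
      (fun t _ => (hder t).continuousAt.continuousWithinAt)
      (fun t _ => (hder t).differentiableAt.differentiableWithinAt) fun t ht => ?_
    rw [interior_Icc] at ht
    rw [(hder t).deriv, ← inner_sub_left]
    have h1 := real_inner_le_norm (gradient ψ (x + t • v) - gradient ψ x) v
    have h2 := hL (x + t • v) x
    rw [add_sub_cancel_left, norm_smul, Real.norm_of_nonneg ht.1.le] at h2
    have h3 := mul_le_mul_of_nonneg_right h2 (norm_nonneg v)
    nlinarith
  have h := hanti (Set.left_mem_Icc.2 zero_le_one) (Set.right_mem_Icc.2 zero_le_one) zero_le_one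
  simp only [hφ, one_smul, zero_smul, add_zero, hv, add_sub_cancel] at h
  linarith

theorem quadratic_le_of_lipschitz_gradient {n : ℕ} {ψ : Vec n → ℝ} {L : ℝ}
    (hd : Differentiable ℝ ψ) (hL : ∀ x y, ‖gradient ψ x - gradient ψ y‖ ≤ L * ‖x - y‖)
    (x u : Vec n) :
    ψ x + inner ℝ (gradient ψ x) (u - x) - L / 2 * ‖u - x‖ ^ 2 ≤ ψ u := by
  have hg : ∀ y, gradient (-ψ) y = -gradient ψ y := fun y => by
    simp [gradient, fderiv_neg]
  have h := le_quadratic_of_lipschitz_gradient (L := L) hd.neg (fun x y => by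
    rw [hg, hg, neg_sub_neg, norm_sub_rev]; exact hL x y) x u
  rw [hg, inner_neg_left] at h
  simp only [Pi.neg_apply] at h
  linarith

theorem SmoothStrong.of_strongConvexOn {n : ℕ} {ψ : Vec n → ℝ} {L μ : ℝ}
    (hd : Differentiable ℝ ψ) (hL : ∀ x y, ‖gradient ψ x - gradient ψ y‖ ≤ L * ‖x - y‖)
    (hμ : 0 < μ) (hs : StrongConvexOn Set.univ μ ψ) : SmoothStrong ψ L μ where
  diff := hd
  lip := hL
  upper := le_quadratic_of_lipschitz_gradient hd hL
  lower x u := by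
    have key : 0 ≤ ψ u - ψ x - inner ℝ (gradient ψ x) (u - x) - μ / 2 * ‖u - x‖ ^ 2 := by
      refine nonneg_of_first_order (b := (μ + L) / 2 * ‖u - x‖ ^ 2) fun t ht ht1 => ?_
      have h1 := hs.2 (Set.mem_univ x) (Set.mem_univ u) (sub_nonneg.2 ht1) ht.le (by ring)
      have h2 := quadratic_le_of_lipschitz_gradient hd hL x (x + t • (u - x))
      have h3 : (1 - t) • x + t • u = x + t • (u - x) := by module
      rw [h3] at h1
      rw [add_sub_cancel_left, inner_smul_right, norm_smul, Real.norm_of_nonneg ht.le,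
        mul_pow] at h2
      simp only [smul_eq_mul] at h1
      rw [norm_sub_rev] at h1
      linear_combination h1 + h2
    linarith
  μ_pos := hμ

theorem SmoothStrong.le {n : ℕ} {ψ : Vec n → ℝ} {L μ : ℝ} (hψ : SmoothStrong ψ L μ)
    (hn : 0 < n) : μ ≤ L := by
  have : Nontrivial (Vec n) := by
    have : Nonempty (Fin n) := ⟨⟨0, hn⟩⟩
    infer_instance
  obtain ⟨x, hx⟩ := exists_ne (0 : Vec n)
  have h1 := hψ.upper 0 x
  have h2 := hψ.lower 0 x
  have h3 : 0 < ‖x - 0‖ ^ 2 := by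
    rw [sub_zero]
    exact pow_pos (norm_pos_iff.2 hx) 2
  nlinarith

/-! ### The nonsmooth part and the proximal gradient step -/

/-- `h` is a proper closed convex function with bounded domain. -/
structure ClosedConvex {n : ℕ} (h : Vec n → EReal) : Prop where
  ne_bot : ∀ x, h x ≠ ⊥
  closed : LowerSemicontinuous h
  convex : ConvexOn ℝ (dom h) fun x => (h x).toReal
  bounded : Bornology.IsBounded (dom h)
  nonempty : (dom h).Nonempty

theorem ClosedConvex.line {n : ℕ} {h : Vec n → EReal} (hh : ClosedConvex h) {x u : Vec n}
    (hx : x ∈ dom h) (hu : u ∈ dom h) {t : ℝ} (ht : 0 ≤ t) (ht1 : t ≤ 1) :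
    x + t • (u - x) ∈ dom h ∧
      (h (x + t • (u - x))).toReal ≤ (1 - t) * (h x).toReal + t * (h u).toReal := by
  have h3 : (1 - t) • x + t • u = x + t • (u - x) := by module
  rw [← h3]
  exact ⟨hh.convex.1 hx hu (sub_nonneg.2 ht1) ht (by ring),
    hh.convex.2 hx hu (sub_nonneg.2 ht1) ht (by ring)⟩

theorem ClosedConvex.exists_min {n : ℕ} {h : Vec n → EReal} (hh : ClosedConvex h)
    {φ : Vec n → ℝ} (hφ : Continuous φ) :
    ∃ x ∈ dom h, ∀ u ∈ dom h, φ x + (h x).toReal ≤ φ u + (h u).toReal := by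
  have hlsc : LowerSemicontinuous fun x => (φ x : EReal) + h x := by
    refine LowerSemicontinuous.add' (continuous_coe_real_ereal.comp hφ).lowerSemicontinuous
      hh.closed fun x => ?_
    exact EReal.continuousAt_add (Or.inl (EReal.coe_ne_top _)) (Or.inl (EReal.coe_ne_bot _))
  obtain ⟨x, _, hx⟩ := LowerSemicontinuousOn.exists_isMinOn (hh.nonempty.closure)
    hh.bounded.isCompact_closure (hlsc.lowerSemicontinuousOn _)
  have hcoe : ∀ u ∈ dom h, (φ u : EReal) + h u = ((φ u + (h u).toReal : ℝ) : EReal) := by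
    intro u hu
    rw [EReal.coe_add, EReal.coe_toReal (ne_of_lt hu) (hh.ne_bot u)]
  have hle : ∀ u ∈ dom h, (φ x : EReal) + h x ≤ ((φ u + (h u).toReal : ℝ) : EReal) := by
    intro u hu
    rw [← hcoe u hu]
    exact hx (subset_closure hu)
  have hxd : x ∈ dom h := by
    obtain ⟨u, hu⟩ := hh.nonempty
    have := (hle u hu).trans_lt (EReal.coe_lt_top _)
    by_contra hn
    have htop : h x = ⊤ := by simpa [dom] using hn
    rw [htop, EReal.coe_add_top] at this
    exact lt_irrefl _ this
  refine ⟨x, hxd, fun u hu => ?_⟩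
  have := hle u hu
  rw [hcoe x hxd] at this
  exact_mod_cast this

/-- First order condition for a minimizer of `φ + h`, where `φ` has the expansion
`φ(x + t(u - x)) ≤ φ(x) + t a + t² b`. -/
theorem ClosedConvex.first_order {n : ℕ} {h : Vec n → EReal} (hh : ClosedConvex h)
    {φ : Vec n → ℝ} {x u : Vec n} {a b : ℝ} (hx : x ∈ dom h) (hu : u ∈ dom h)
    (hmin : ∀ u ∈ dom h, φ x + (h x).toReal ≤ φ u + (h u).toReal)
    (hφ : ∀ t : ℝ, 0 < t → t ≤ 1 → φ (x + t • (u - x)) ≤ φ x + t * a + t ^ 2 * b) :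
    (h x).toReal ≤ (h u).toReal + a := by
  have : 0 ≤ (h u).toReal + a - (h x).toReal := by
    refine nonneg_of_first_order (b := b) fun t ht ht1 => ?_
    obtain ⟨h1, h2⟩ := hh.line hx hu ht.le ht1
    have h3 := hmin _ h1
    have h4 := hφ t ht ht1
    linarith
  linarith

theorem mem_subdiff_iff {n : ℕ} {h : Vec n → EReal} (hh : ClosedConvex h) {ψ : Vec n → ℝ}
    {L μ : ℝ} (hψ : SmoothStrong ψ L μ) {x v : Vec n} :
    v ∈ subdiff ψ h x ↔ x ∈ dom h ∧
      ∀ u ∈ dom h, (h x).toReal + inner ℝ (v - gradient ψ x) (u - x) ≤ (h u).toReal := by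
  constructor
  · rintro ⟨hx, hv⟩
    refine ⟨hx, fun u hu => ?_⟩
    have := hh.first_order (φ := fun u => ψ u - inner ℝ v (u - x)) (x := x) (u := u)
      (a := -inner ℝ (v - gradient ψ x) (u - x)) (b := L / 2 * ‖u - x‖ ^ 2) hx hu
      (fun w hw => by
        have := hv w hw
        simp only [sub_self, inner_zero_right]
        linarith)
      (fun t ht _ => by
        have h2 := hψ.upper x (x + t • (u - x))
        rw [add_sub_cancel_left, inner_smul_right, norm_smul, Real.norm_of_nonneg ht.le,
          mul_pow] at h2
        simp only [add_sub_cancel_left, inner_smul_right, sub_self, inner_zero_right,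
          inner_sub_left]
        linarith)
    linarith
  · rintro ⟨hx, hv⟩
    refine ⟨hx, fun u hu => ?_⟩
    have h1 := hv u hu
    have h2 := hψ.lower x u
    have h3 := mul_nonneg (half_pos hψ.μ_pos).le (sq_nonneg ‖u - x‖)
    rw [inner_sub_left] at h1
    linarith

/-- Subgradients of the strongly convex function `ψ + h` give quadratic minorants. -/
theorem SmoothStrong.subdiff_lower {n : ℕ} {h : Vec n → EReal} (hh : ClosedConvex h)
    {ψ : Vec n → ℝ} {L μ : ℝ} (hψ : SmoothStrong ψ L μ) {x v u : Vec n}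
    (hv : v ∈ subdiff ψ h x) (hu : u ∈ dom h) :
    ψ x + (h x).toReal + inner ℝ v (u - x) + μ / 2 * ‖u - x‖ ^ 2 ≤ ψ u + (h u).toReal := by
  have h1 := ((mem_subdiff_iff hh hψ).1 hv).2 u hu
  have h2 := hψ.lower x u
  rw [inner_sub_left] at h1
  linarith

theorem isProxStep_proxStep {n : ℕ} {h : Vec n → EReal} (hh : ClosedConvex h) (ψ : Vec n → ℝ)
    (L : ℝ) (y : Vec n) : IsProxStep ψ h L y (proxStep ψ h L y) :=
  Classical.epsilon_spec (hh.exists_min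
    (φ := fun x => inner ℝ (gradient ψ y) x + L / 2 * ‖x - y‖ ^ 2) (by fun_prop))

theorem proxStep_mem {n : ℕ} {h : Vec n → EReal} (hh : ClosedConvex h) (ψ : Vec n → ℝ)
    (L : ℝ) (y : Vec n) : proxStep ψ h L y ∈ dom h :=
  (isProxStep_proxStep hh ψ L y).1

theorem proxStep_first_order {n : ℕ} {h : Vec n → EReal} (hh : ClosedConvex h) (ψ : Vec n → ℝ)
    (L : ℝ) (y : Vec n) {u : Vec n} (hu : u ∈ dom h) :
    (h (proxStep ψ h L y)).toReal ≤ (h u).toReal +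
      inner ℝ (gradient ψ y + L • (proxStep ψ h L y - y)) (u - proxStep ψ h L y) := by
  obtain ⟨hx, hmin⟩ := isProxStep_proxStep hh ψ L y
  set x := proxStep ψ h L y
  refine hh.first_order (φ := fun x => inner ℝ (gradient ψ y) x + L / 2 * ‖x - y‖ ^ 2)
    (b := L / 2 * ‖u - x‖ ^ 2) hx hu hmin fun t ht _ => le_of_eq ?_
  have h1 : x + t • (u - x) - y = (x - y) + t • (u - x) := by abel
  rw [h1, norm_add_sq_real, norm_smul, inner_add_right, inner_smul_right, inner_smul_right,
    inner_add_left, inner_smul_left, mul_pow, Real.norm_of_nonneg ht.le]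
  simp only [conj_trivial]
  ring

/-- Progress of an accepted proximal gradient step. -/
theorem proxStep_progress {n : ℕ} {h : Vec n → EReal} (hh : ClosedConvex h) {ψ : Vec n → ℝ}
    {Lψ μ L : ℝ} (hψ : SmoothStrong ψ Lψ μ) {x y u : Vec n} (hx : x = proxStep ψ h L y)
    (hacc : ψ x ≤ ψ y + inner ℝ (gradient ψ y) (x - y) + L / 2 * ‖x - y‖ ^ 2) (hu : u ∈ dom h) :
    ψ x + (h x).toReal ≤ ψ u + (h u).toReal - L / 2 * ‖x - y‖ ^ 2 + L * inner ℝ (x - y) (u - y) -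
      μ / 2 * ‖u - y‖ ^ 2 := by
  have h1 := proxStep_first_order hh ψ L y hu
  rw [← hx] at h1
  have h2 := hψ.lower y u
  have h3 : u - x = (u - y) - (x - y) := by abel
  rw [h3, inner_sub_right, inner_add_left, inner_add_left, inner_smul_left, inner_smul_left,
    real_inner_self_eq_norm_sq] at h1
  simp only [conj_trivial] at h1
  linarith

/-- The residual `∇ψ(x) - ∇ψ(y) - L(x - y)` of a proximal gradient step is a subgradient. -/
theorem proxStep_residual_mem {n : ℕ} {h : Vec n → EReal} (hh : ClosedConvex h) {ψ : Vec n → ℝ}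
    {Lψ μ L : ℝ} (hψ : SmoothStrong ψ Lψ μ) {x y : Vec n} (hx : x = proxStep ψ h L y) :
    gradient ψ x - gradient ψ y - L • (x - y) ∈ subdiff ψ h x := by
  rw [mem_subdiff_iff hh hψ]
  refine ⟨hx ▸ proxStep_mem hh ψ L y, fun u hu => ?_⟩
  have h1 := proxStep_first_order hh ψ L y hu
  rw [← hx] at h1
  have h2 : gradient ψ x - gradient ψ y - L • (x - y) - gradient ψ x =
    -(gradient ψ y + L • (x - y)) := by abel
  rw [h2, inner_neg_left]
  linarith

/-- A minimizer of `ψ + h` over the domain of `h`. -/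
def IsArgmin {n : ℕ} (ψ : Vec n → ℝ) (h : Vec n → EReal) (x : Vec n) : Prop :=
  x ∈ dom h ∧ ∀ u ∈ dom h, ψ x + (h x).toReal ≤ ψ u + (h u).toReal

theorem IsArgmin.zero_mem {n : ℕ} {ψ : Vec n → ℝ} {h : Vec n → EReal} {x : Vec n}
    (hx : IsArgmin ψ h x) : (0 : Vec n) ∈ subdiff ψ h x :=
  ⟨hx.1, fun u hu => by simpa using hx.2 u hu⟩

theorem IsArgmin.lower {n : ℕ} {h : Vec n → EReal} (hh : ClosedConvex h)
    {ψ : Vec n → ℝ} {L μ : ℝ} (hψ : SmoothStrong ψ L μ) {x u : Vec n}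
    (hx : IsArgmin ψ h x) (hu : u ∈ dom h) :
    ψ x + (h x).toReal + μ / 2 * ‖u - x‖ ^ 2 ≤ ψ u + (h u).toReal := by
  simpa using hψ.subdiff_lower hh hx.zero_mem hu

/-- Near-stationary points are close to the minimizer. -/
theorem SmoothStrong.dist_argmin_le {n : ℕ} {h : Vec n → EReal} (hh : ClosedConvex h)
    {ψ : Vec n → ℝ} {L μ : ℝ} (hψ : SmoothStrong ψ L μ) {x w : Vec n} {τ : ℝ}
    (hx : IsArgmin ψ h x) (hw : NearStationary ψ h w τ) : ‖w - x‖ ≤ τ / μ := by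
  obtain ⟨v, hv, hvτ⟩ := hw
  have h1 := hψ.subdiff_lower hh hv hx.1
  have h2 := hx.lower hh hψ hv.1
  have h3 := real_inner_le_norm v (w - x)
  have h4 : inner ℝ v (x - w) = -inner ℝ v (w - x) := by rw [← inner_neg_right, neg_sub]
  rw [norm_sub_rev x w, h4] at h1
  rw [le_div_iff₀ hψ.μ_pos]
  by_contra! hlt
  have h5 := norm_nonneg (w - x)
  have h6 : 0 < ‖w - x‖ := by
    rcases h5.lt_or_eq with h | h
    · exact h
    · rw [← h] at hlt
      linarith [norm_nonneg v]
  nlinarith [mul_le_mul_of_nonneg_right hvτ h5]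

/-! ### The accelerated proximal gradient method -/

/-- The descent condition under which a line search accepts the step from `y` to `x`. -/
def Accepted {n : ℕ} (ψ : Vec n → ℝ) (L : ℝ) (y x : Vec n) : Prop :=
  ψ x ≤ ψ y + inner ℝ (gradient ψ y) (x - y) + L / 2 * ‖x - y‖ ^ 2

/-- A bound for the number of trials of a line search. -/
noncomputable def trialBound (Lψ Lmin γ₁ : ℝ) : ℝ := 2 + Real.posLog (Lψ / Lmin) / Real.log γ₁

theorem two_le_trialBound {Lψ Lmin γ₁ : ℝ} (hγ : 1 < γ₁) : 2 ≤ trialBound Lψ Lmin γ₁ := by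
  have := div_nonneg (Real.posLog_nonneg (x := Lψ / Lmin)) (Real.log_pos hγ).le
  unfold trialBound
  linarith

theorem lineSearch_spec {n : ℕ} {h : Vec n → EReal} {ψ : Vec n → ℝ}
    {Lψ μ γ₁ Lmin L₀ : ℝ} (hψ : SmoothStrong ψ Lψ μ) (hγ : 1 < γ₁) (hLmin : 0 < Lmin)
    (hL₀ : Lmin ≤ L₀) (query : ℝ → Vec n) :
    Spec (lineSearch ψ h γ₁ query L₀) (6 * trialBound Lψ Lmin γ₁) fun r =>
      L₀ ≤ r.1 ∧ r.1 ≤ max L₀ (γ₁ * Lψ) ∧ r.2 = proxStep ψ h r.1 (query r.1) ∧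
        Accepted ψ r.1 (query r.1) r.2 := by
  have hL₀' : 0 < L₀ := hLmin.trans_le hL₀
  have hγ0 : 0 < γ₁ := one_pos.trans hγ
  have hlog := Real.log_pos hγ
  unfold lineSearch
  refine Spec.mono (spec_loop (c := 6)
    (I := fun j L => L = γ₁ ^ j * L₀ ∧ (0 < j → γ₁ ^ (j - 1) * L₀ < Lψ))
    (A := 1 + Real.posLog (Lψ / Lmin) / Real.log γ₁) ?_ ?_ ?_) (le_of_eq ?_) fun _ h => h
  · rintro j L ⟨-, hj⟩
    rcases Nat.eq_zero_or_pos j with rfl | hj0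
    · have := div_nonneg (Real.posLog_nonneg (x := Lψ / Lmin)) hlog.le
      push_cast
      linarith
    · have h1 := hj hj0
      have h2 : γ₁ ^ (j - 1) ≤ Lψ / Lmin := by
        rw [le_div_iff₀ hLmin]
        exact (mul_le_mul_of_nonneg_left hL₀ (by positivity)).trans h1.le
      have h3 := Real.log_le_log (by positivity) h2
      rw [Real.log_pow] at h3
      have h4 : ((j - 1 : ℕ) : ℝ) ≤ Real.posLog (Lψ / Lmin) / Real.log γ₁ := by
        rw [le_div_iff₀ hlog]
        exact h3.trans (le_max_right _ _)
      rw [Nat.cast_sub hj0] at h4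
      push_cast at h4
      linarith
  · rintro j L ⟨hL, hj⟩
    have hjL : 1 ≤ γ₁ ^ j := one_le_pow₀ hγ.le
    refine Spec.mono (Spec.bind (c' := 0) spec_tick fun _ _ => ?_) (by simp) fun _ h => h
    split_ifs with hacc
    · refine spec_pure ⟨?_, ?_, rfl, hacc⟩
      · show L₀ ≤ L
        rw [hL]
        nlinarith
      · show L ≤ max L₀ (γ₁ * Lψ)
        rcases Nat.eq_zero_or_pos j with rfl | hj0
        · simp [hL]
        · refine le_max_of_le_right ?_
          obtain ⟨i, rfl⟩ : ∃ i, j = i + 1 := ⟨j - 1, by omega⟩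
          have := hj hj0
          rw [hL, pow_succ]
          simp only [add_tsub_cancel_right] at this
          nlinarith
    · refine spec_pure ⟨?_, fun _ => ?_⟩
      · rw [hL, pow_succ]
        ring
      · simp only [add_tsub_cancel_right, ← hL]
        by_contra! hge
        have := hψ.upper (query L) (proxStep ψ h L (query L))
        refine hacc (this.trans ?_)
        gcongr
  · simp
  · unfold trialBound
    ring

/-- One step of the accelerated method, from `x` to `x'` through the query point `y`, contracts the
Lyapunov function "gap plus `μ/2` times the squared distance of the auxiliary point to `w`" by
`1 - α`. The auxiliary point is `z` before and `x + (x' - x)/α` after the step, and the momentum is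
such that `y` is the convex combination `(x + α z)/(1 + α)`. The proof adds the inequalities of
`proxStep_progress` at `x` and at `w` with weights `1 - α` and `α`. -/
theorem apg_contraction {n : ℕ} {h : Vec n → EReal} (hh : ClosedConvex h) {ψ : Vec n → ℝ}
    {Lψ μ L α : ℝ} (hψ : SmoothStrong ψ Lψ μ) (hα : 0 < α) (hα1 : α ≤ 1) (hμ : μ = α ^ 2 * L)
    {x y z w x' : Vec n} (hx : x ∈ dom h) (hw : w ∈ dom h)
    (hy : (1 + α) • y = x + α • z) (hx' : x' = proxStep ψ h L y)
    (hacc : Accepted ψ L y x') :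
    ψ x' + (h x').toReal - (ψ w + (h w).toReal) +
        μ / 2 * ‖x + α⁻¹ • (x' - x) - w‖ ^ 2 ≤
      (1 - α) * (ψ x + (h x).toReal - (ψ w + (h w).toReal) + μ / 2 * ‖z - w‖ ^ 2) := by
  have h1 := proxStep_progress hh hψ hx' hacc hx
  have h2 := proxStep_progress hh hψ hx' hacc hw
  have hμ0 := hψ.μ_pos
  set d := x' - y with hd
  set a := y - w with ha
  set b := z - w with hb
  have e1 : w - y = -a := by rw [ha]; abel
  have e2 : x - y = α • a - α • b := by
    have : x = (1 + α) • y - α • z := by rw [hy]; abel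
    rw [this, ha, hb]
    module
  have e3 : x + α⁻¹ • (x' - x) - w = ((1 - α) • b + α • a) + α⁻¹ • d := by
    have h3 : x' - x = d - (α • a - α • b) := by rw [← e2, hd]; abel
    have h4 : x - w = (α • a - α • b) + a := by rw [← e2, ha]; abel
    have h5 : x + α⁻¹ • (x' - x) - w = (x - w) + α⁻¹ • (x' - x) := by abel
    rw [h5, h3, h4]
    clear_value a b d
    match_scalars <;> field_simp <;> ring
  have e4 : ‖(1 - α) • b + α • a‖ ^ 2 ≤ (1 - α) * ‖b‖ ^ 2 + α * ‖a‖ ^ 2 := by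
    have := norm_sub_sq_real b a
    have h6 : 0 ≤ ‖b - a‖ ^ 2 := sq_nonneg _
    have h7 : 0 ≤ α * (1 - α) := mul_nonneg hα.le (by linarith)
    rw [norm_add_sq_real, norm_smul, norm_smul, inner_smul_left, inner_smul_right, mul_pow,
      mul_pow, Real.norm_of_nonneg hα.le, Real.norm_of_nonneg (sub_nonneg.2 hα1)]
    simp only [conj_trivial]
    nlinarith
  rw [e3, norm_add_sq_real, norm_smul, mul_pow, inner_smul_right, inner_add_left,
    inner_smul_left, inner_smul_left, Real.norm_of_nonneg (inv_pos.2 hα).le]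
  rw [e1, norm_neg, inner_neg_right] at h2
  rw [e2, inner_sub_right, inner_smul_right, inner_smul_right] at h1
  simp only [conj_trivial]
  rw [real_inner_comm d b, real_inner_comm d a]
  have h1' := mul_le_mul_of_nonneg_left h1 (sub_nonneg.2 hα1)
  have h2' := mul_le_mul_of_nonneg_left h2 hα.le
  have e4' := mul_le_mul_of_nonneg_left e4 (half_pos hμ0).le
  have e5 : μ / 2 * (2 * (α⁻¹ * ((1 - α) * inner ℝ d b + α * inner ℝ d a)) + α⁻¹ ^ 2 * ‖d‖ ^ 2) =
      L * α * ((1 - α) * inner ℝ d b + α * inner ℝ d a) + L / 2 * ‖d‖ ^ 2 := by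
    rw [hμ]
    field_simp
  have e6 : 0 ≤ (1 - α) * (μ / 2 * ‖α • a - α • b‖ ^ 2) := by
    have : 0 ≤ 1 - α := sub_nonneg.2 hα1
    positivity
  linarith

/-- A bound for the cost of the accelerated method in terms of the largest step parameter `Lmax`
and the diameter `D` of the domain. -/
noncomputable def apgCost (Lψ μ Lmin γ₁ D tol : ℝ) : ℝ :=
  14 * trialBound Lψ Lmin γ₁ * (√(max Lmin (γ₁ * Lψ) / μ) *
    Real.posLog (4 * max Lmin (γ₁ * Lψ) ^ 2 * (max Lmin (γ₁ * Lψ) + μ) * D ^ 2 /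
      (Lmin * tol ^ 2)) + 3)

/-- A step from `x` whose functional gap is small produces a point at which the stopping test of the
accelerated method succeeds. -/
theorem nearStationary_of_gap {n : ℕ} {h : Vec n → EReal} (hh : ClosedConvex h) {ψ : Vec n → ℝ}
    {Lψ μ L Lmin Lmax tol Δ : ℝ} (hψ : SmoothStrong ψ Lψ μ) (hLmin : 0 < Lmin)
    (h1 : Lmin ≤ L) (h2 : L ≤ Lmax) (h3 : Lψ ≤ Lmax) (htol : 0 < tol)
    {w x x' : Vec n} (hw : IsArgmin ψ h w) (hx : x ∈ dom h) (hx' : x' = proxStep ψ h L x)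
    (hacc : Accepted ψ L x x') (hgap : ψ x + (h x).toReal - (ψ w + (h w).toReal) ≤ Δ)
    (hΔ : 8 * Lmax ^ 2 / Lmin * Δ ≤ tol ^ 2) : NearStationary ψ h x' tol := by
  refine ⟨_, proxStep_residual_mem hh hψ hx', ?_⟩
  have hx'd : x' ∈ dom h := hx' ▸ proxStep_mem hh ψ L x
  have g1 := proxStep_progress hh hψ hx' hacc hx
  simp only [sub_self, inner_zero_right, mul_zero, norm_zero, add_zero] at g1
  have g2 := hw.2 x' hx'd
  have hLmax : 0 < Lmax := hLmin.trans_le (h1.trans h2)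
  have g3 : ‖gradient ψ x' - gradient ψ x - L • (x' - x)‖ ≤ 2 * Lmax * ‖x' - x‖ := by
    have a1 := hψ.lip x' x
    have a2 := norm_sub_le (gradient ψ x' - gradient ψ x) (L • (x' - x))
    rw [norm_smul, Real.norm_of_nonneg (hLmin.trans_le h1).le] at a2
    have a3 := norm_nonneg (x' - x)
    nlinarith
  have g4 : Lmin / 2 * ‖x' - x‖ ^ 2 ≤ Δ := by
    have : Lmin / 2 * ‖x' - x‖ ^ 2 ≤ L / 2 * ‖x' - x‖ ^ 2 := by gcongr
    norm_num at g1
    linarith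
  refine g3.trans (abs_le_of_sq_le_sq' ?_ htol.le).2
  calc (2 * Lmax * ‖x' - x‖) ^ 2 = 8 * Lmax ^ 2 / Lmin * (Lmin / 2 * ‖x' - x‖ ^ 2) := by
        field_simp
        ring
    _ ≤ 8 * Lmax ^ 2 / Lmin * Δ := by gcongr
    _ ≤ tol ^ 2 := hΔ

/-- An accepted step with `L < μ` is only possible at the minimizer. -/
theorem isArgmin_of_accepted_of_lt {n : ℕ} {h : Vec n → EReal} (hh : ClosedConvex h)
    {ψ : Vec n → ℝ} {Lψ μ L : ℝ} (hψ : SmoothStrong ψ Lψ μ) {x y : Vec n}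
    (hx : x = proxStep ψ h L y) (hacc : Accepted ψ L y x) (hL : L < μ) : IsArgmin ψ h x := by
  have h1 := hψ.lower y x
  have h2 : ‖x - y‖ ^ 2 ≤ 0 := by
    unfold Accepted at hacc
    by_contra! h3
    nlinarith
  have h3 : x = y := by
    have : ‖x - y‖ = 0 := by
      have := sq_nonneg ‖x - y‖
      exact pow_eq_zero_iff (two_ne_zero) |>.1 (le_antisymm h2 this)
    exact sub_eq_zero.1 (norm_eq_zero.1 this)
  refine ⟨hx ▸ proxStep_mem hh ψ L y, fun u hu => ?_⟩
  have h4 := (proxStep_residual_mem hh hψ hx).2 u hu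
  simpa [h3] using h4

/-- As long as `j` contractions by the factor `1 - q` have not brought `K` down to `τ`, the number
`j` is at most `q⁻¹ log⁺(K/τ)`. -/
theorem steps_le_of_contraction {q K τ : ℝ} {j : ℕ} (hq : 0 < q) (hq1 : q ≤ 1) (hτ : 0 < τ)
    (h : τ < K * (1 - q) ^ j) : (j : ℝ) ≤ q⁻¹ * Real.posLog (K / τ) := by
  have hp : (1 - q) ^ j ≤ Real.exp (-(q * j)) := by
    calc (1 - q) ^ j ≤ Real.exp (-q) ^ j := by
          refine pow_le_pow_left₀ (by linarith) ?_ j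
          linarith [Real.add_one_le_exp (-q)]
      _ = _ := by rw [← Real.exp_nat_mul]; ring_nf
  have hK : 0 < K := by
    by_contra! hK
    have : K * (1 - q) ^ j ≤ 0 :=
      mul_nonpos_of_nonpos_of_nonneg hK (pow_nonneg (by linarith) j)
    linarith
  have h1 : Real.exp (q * j) ≤ K / τ := by
    rw [le_div_iff₀ hτ]
    have h2 : τ < K * Real.exp (-(q * j)) := h.trans_le (by gcongr)
    have h3 := mul_lt_mul_of_pos_left h2 (Real.exp_pos (q * j))
    rw [mul_left_comm, ← Real.exp_add, add_neg_cancel, Real.exp_zero, mul_one] at h3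
    exact h3.le
  have h2 : q * j ≤ Real.posLog (K / τ) := by
    refine le_trans ?_ (le_max_right _ _)
    rw [Real.le_log_iff_exp_le (by positivity)]
    exact h1
  rw [inv_mul_eq_div, le_div_iff₀ hq]
  linarith

/-- The accelerated method terminates with a near-stationary point, at a cost of the order of
`√(Lmax/μ) log (1/tol)`, where `Lmax = max (Lmin, γ₁ Lψ)` bounds all accepted parameters. -/
theorem apg_spec {n : ℕ} {h : Vec n → EReal} (hh : ClosedConvex h) {ψ : Vec n → ℝ}
    {Lψ μ γ₁ γ₂ Lmin tol D : ℝ} (hψ : SmoothStrong ψ Lψ μ) (hn : 0 < n) (hγ : 1 < γ₁)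
    (hLmin : 0 < Lmin) (htol : 0 < tol) (hγ₂ : 1 ≤ γ₂)
    (hD : ∀ x ∈ dom h, ∀ y ∈ dom h, ‖x - y‖ ≤ D) {y₀ : Vec n} (hy₀ : y₀ ∈ dom h) :
    Spec (apg ψ h μ Lmin tol γ₁ γ₂ y₀) (apgCost Lψ μ Lmin γ₁ D tol) fun x =>
      NearStationary ψ h x tol := by
  obtain ⟨w, hw⟩ : ∃ w, IsArgmin ψ h w := by
    obtain ⟨w, h1, h2⟩ := hh.exists_min hψ.diff.continuous
    exact ⟨w, h1, h2⟩
  have hμ := hψ.μ_pos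
  have hμL := hψ.le hn
  set Lmax := max Lmin (γ₁ * Lψ) with hLmax
  have hLψ : Lψ ≤ Lmax := le_max_of_le_right (by nlinarith)
  have hLM : Lmin ≤ Lmax := le_max_left _ _
  have hLmax0 : 0 < Lmax := hLmin.trans_le hLM
  set ρ := √(μ / Lmax) with hρ
  have hρ0 : 0 < ρ := Real.sqrt_pos.2 (by positivity)
  have hρ1 : ρ ≤ 1 := Real.sqrt_le_one.2 ((div_le_one hLmax0).2 (hμL.trans hLψ))
  set V₀ := (Lmax + μ) / 2 * D ^ 2 with hV₀
  set T := trialBound Lψ Lmin γ₁ with hT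
  have hT2 : 2 ≤ T := two_le_trialBound hγ
  set A := ρ⁻¹ * Real.posLog (8 * Lmax ^ 2 / Lmin * V₀ / tol ^ 2) with hA
  have hA0 : 0 ≤ A := mul_nonneg (inv_pos.2 hρ0).le Real.posLog_nonneg
  have hcost : 6 * T + (A + 1) * (14 * T) ≤ apgCost Lψ μ Lmin γ₁ D tol := by
    have h1 : 8 * Lmax ^ 2 / Lmin * V₀ / tol ^ 2 =
        4 * Lmax ^ 2 * (Lmax + μ) * D ^ 2 / (Lmin * tol ^ 2) := by
      rw [hV₀]
      field_simp
      ring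
    have h2 : ρ⁻¹ = √(Lmax / μ) := by rw [hρ, ← Real.sqrt_inv, inv_div]
    have h3 : apgCost Lψ μ Lmin γ₁ D tol = 14 * T * (A + 3) := by
      rw [hA, h1, h2]
      rfl
    rw [h3]
    nlinarith
  unfold apg
  refine Spec.mono (Spec.bind (lineSearch_spec hψ hγ hLmin le_rfl _) fun r hr => ?_) hcost
    fun _ h => h
  obtain ⟨hr1, hr2, hr3, hr4⟩ := hr
  have hmax : ∀ {L L' : ℝ}, L ≤ Lmax → L' ≤ max L (γ₁ * Lψ) → L' ≤ Lmax := fun h1 h2 =>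
    h2.trans (max_le h1 (le_max_right _ _))
  have hnext : ∀ {L : ℝ}, Lmin ≤ L → L ≤ Lmax → Lmin ≤ max Lmin (L / γ₂) ∧
      max Lmin (L / γ₂) ≤ Lmax := fun h1 h2 =>
    ⟨le_max_left _ _, max_le hLM ((div_le_self (hLmin.le.trans h1) hγ₂).trans h2)⟩
  have hrL := hmax hLM hr2
  have hrd : r.2 ∈ dom h := hr3 ▸ proxStep_mem hh ψ _ _
  -- Invariant: the Lyapunov function has contracted `j` times by `1 - √(μ/Lmax)`, and as the
  -- previous rounds went on, it still exceeds what the stopping test needs.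
  refine spec_loop (I := fun j (s : APGState n) => s.x ∈ dom h ∧ Lmin ≤ s.L ∧ s.L ≤ Lmax ∧
    0 < s.α ∧ s.α ≤ 1 ∧
    ψ s.x + (h s.x).toReal - (ψ w + (h w).toReal) +
      μ / 2 * ‖s.xprev + s.α⁻¹ • (s.x - s.xprev) - w‖ ^ 2 ≤ V₀ * (1 - ρ) ^ j ∧
    (0 < j → tol ^ 2 < 8 * Lmax ^ 2 / Lmin * V₀ * (1 - ρ) ^ j)) ?_ ?_ ?_
  · rintro j s ⟨-, -, -, -, -, -, hj⟩
    rcases Nat.eq_zero_or_pos j with rfl | hj0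
    · simpa using hA0
    · exact steps_le_of_contraction hρ0 hρ1 (by positivity) (hj hj0)
  · rintro j s ⟨hx, hL1, hL2, hα0, hα1, hV, -⟩
    refine Spec.mono (Spec.bind (lineSearch_spec hψ hγ hLmin hL1 _) fun t ht =>
      Spec.bind (lineSearch_spec hψ hγ hLmin (hL1.trans ht.1) _) fun t' ht' =>
      Spec.bind (c' := 0) spec_tick fun _ _ => ?_)
      (show 6 * T + (6 * T + ((2 : ℕ) + 0)) ≤ 14 * T by push_cast; linarith) fun _ h => h
    obtain ⟨ht1, ht2, ht3, ht4⟩ := ht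
    obtain ⟨ht1', ht2', ht3', ht4'⟩ := ht'
    have htL := hmax hL2 ht2
    have htL' := hmax htL ht2'
    have htd : t.2 ∈ dom h := ht3 ▸ proxStep_mem hh ψ _ _
    have ht0 : 0 < t.1 := hLmin.trans_le (hL1.trans ht1)
    split_ifs with hstat
    · exact spec_pure hstat
    · have hgap_large : ∀ Δ, ψ t.2 + (h t.2).toReal - (ψ w + (h w).toReal) ≤ Δ →
          tol ^ 2 < 8 * Lmax ^ 2 / Lmin * Δ := fun Δ hΔ => by
        by_contra! hle
        exact hstat (nearStationary_of_gap hh hψ hLmin (hL1.trans (ht1.trans ht1')) htL' hLψ htol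
          hw htd ht3' ht4' hΔ hle)
      -- An accepted parameter below `μ` would mean that the minimizer has been found.
      have hμt : μ ≤ t.1 := by
        by_contra! hlt
        have hopt := isArgmin_of_accepted_of_lt hh hψ ht3 ht4 hlt
        have := hgap_large 0 (by linarith [hopt.2 w hw.1])
        rw [mul_zero] at this
        exact absurd this (not_lt.2 (sq_nonneg _))
      have hα0' : 0 < √(μ / t.1) := Real.sqrt_pos.2 (by positivity)
      have hα1' : √(μ / t.1) ≤ 1 := Real.sqrt_le_one.2 ((div_le_one ht0).2 hμt)
      have hρα : ρ ≤ √(μ / t.1) := Real.sqrt_le_sqrt (by gcongr)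
      have hcon := apg_contraction hh hψ hα0' hα1'
        (by rw [Real.sq_sqrt (by positivity)]; field_simp) hx hw.1
        (z := s.xprev + s.α⁻¹ • (s.x - s.xprev)) (by
          match_scalars <;> field_simp <;> ring) ht3 ht4
      have hV' : ψ t.2 + (h t.2).toReal - (ψ w + (h w).toReal) +
          μ / 2 * ‖s.x + (√(μ / t.1))⁻¹ • (t.2 - s.x) - w‖ ^ 2 ≤ V₀ * (1 - ρ) ^ (j + 1) := by
        have hgap := hw.2 s.x hx
        have hV0' : 0 ≤ V₀ * (1 - ρ) ^ j := by
          have : 0 ≤ 1 - ρ := sub_nonneg.2 hρ1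
          positivity
        refine hcon.trans ((mul_le_mul_of_nonneg_left hV (sub_nonneg.2 hα1')).trans ?_)
        rw [pow_succ]
        nlinarith
      have hx2 : 0 ≤ μ / 2 * ‖s.x + (√(μ / t.1))⁻¹ • (t.2 - s.x) - w‖ ^ 2 := by positivity
      obtain ⟨hn1, hn2⟩ := hnext (hL1.trans ht1) htL
      refine spec_pure ⟨htd, hn1, hn2, hα0', hα1', hV', fun _ => ?_⟩
      have := hgap_large _ (by linarith : _ ≤ V₀ * (1 - ρ) ^ (j + 1))
      rwa [← mul_assoc] at this
  · obtain ⟨hn1, hn2⟩ := hnext hr1 hrL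
    refine ⟨hrd, hn1, hn2, one_pos, le_rfl, ?_, fun h => absurd h (lt_irrefl _)⟩
    have h1 := proxStep_progress hh hψ hr3 hr4 hw.1
    have h2 := hD y₀ hy₀ w hw.1
    have h3 := hD r.2 hrd w hw.1
    have h4 : r.1 * inner ℝ (r.2 - y₀) (w - y₀) ≤
        r.1 / 2 * ‖r.2 - y₀‖ ^ 2 + r.1 / 2 * ‖w - y₀‖ ^ 2 := by
      have h5 := norm_sub_sq_real (r.2 - y₀) (w - y₀)
      have h6 := sq_nonneg ‖(r.2 - y₀) - (w - y₀)‖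
      have h7 : 0 ≤ r.1 := hLmin.le.trans hr1
      nlinarith
    rw [norm_sub_rev w y₀] at h1 h4
    have h5 : ‖y₀ - w‖ ^ 2 ≤ D ^ 2 := pow_le_pow_left₀ (norm_nonneg _) h2 2
    have h6 : ‖r.2 - w‖ ^ 2 ≤ D ^ 2 := pow_le_pow_left₀ (norm_nonneg _) h3 2
    simp only [sub_self, smul_zero, add_zero, pow_zero, mul_one]
    have h7 : r.1 / 2 * ‖y₀ - w‖ ^ 2 ≤ Lmax / 2 * D ^ 2 := by gcongr
    have h8 : μ / 2 * ‖r.2 - w‖ ^ 2 ≤ μ / 2 * D ^ 2 := by gcongr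
    have h9 : 0 ≤ μ / 2 * ‖y₀ - w‖ ^ 2 := by positivity
    rw [hV₀]
    linarith

/-! ### Geometry of the ellipsoid method -/

open scoped MatrixOrder Matrix.Norms.L2Operator in
theorem exists_eq_transpose_mul_self {m : ℕ} {N : Matrix (Fin m) (Fin m) ℝ} (hN : N.PosDef) :
    ∃ C : Matrix (Fin m) (Fin m) ℝ, N = C.transpose * C := by
  obtain ⟨C, hC⟩ := CStarAlgebra.nonneg_iff_eq_star_mul_self.mp hN.posSemidef.nonneg
  exact ⟨C, by rw [hC, Matrix.star_eq_conjTranspose, Matrix.conjTranspose_eq_transpose_of_trivial]⟩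

/-- With `B⁻¹ = Cᵀ C`, the ellipsoid is the preimage of the unit ball under `y ↦ C (y - c)`. -/
theorem volume_ellSet {m : ℕ} {B : Matrix (Fin m) (Fin m) ℝ} (hB : B.PosDef) (c : Vec m) :
    volume (ellSet B c) = ENNReal.ofReal √B.det * volume (Metric.closedBall (0 : Vec m) 1) := by
  obtain ⟨C, hC⟩ := exists_eq_transpose_mul_self hB.inv
  have hdet : B.det = (C.det ^ 2)⁻¹ := by
    have : B⁻¹.det = C.det ^ 2 := by rw [hC, Matrix.det_mul, Matrix.det_transpose, sq]
    rw [← this, Matrix.det_nonsing_inv, Ring.inverse_eq_inv', inv_inv]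
  have hC0 : C.det ≠ 0 := fun h => by
    rw [h] at hdet
    have := hB.det_pos
    simp [hdet] at this
  set f : Vec m →ₗ[ℝ] Vec m :=
    Matrix.toLin (EuclideanSpace.basisFun (Fin m) ℝ).toBasis
      (EuclideanSpace.basisFun (Fin m) ℝ).toBasis C with hf
  have hfdet : LinearMap.det f = C.det := by rw [hf, LinearMap.det_toLin]
  have hfapp : ∀ v : Vec m, (f v).ofLp = C.mulVec v.ofLp := fun v => by
    rw [hf, ← Matrix.toEuclideanLin_eq_toLin_orthonormal]
    rfl
  have hset : ellSet B c = (fun y => y - c) ⁻¹' (f ⁻¹' Metric.closedBall (0 : Vec m) 1) := by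
    ext y
    simp only [ellSet, Set.mem_ofPred_eq, Set.mem_preimage, Metric.mem_closedBall,
      dist_zero_right]
    rw [hC, ← Matrix.mulVec_mulVec, Matrix.dotProduct_mulVec, Matrix.vecMul_transpose, ← hfapp]
    have : (f (y - c)).ofLp ⬝ᵥ (f (y - c)).ofLp = ‖f (y - c)‖ ^ 2 := by
      rw [EuclideanSpace.real_norm_sq_eq]
      simp [dotProduct, sq]
    rw [this, sq_le_one_iff₀ (norm_nonneg _)]
  rw [hset]
  simp_rw [sub_eq_add_neg]
  rw [measure_preimage_add_right, Measure.addHaar_preimage_linearMap _ (hfdet ▸ hC0), hfdet,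
    hdet, Real.sqrt_inv, Real.sqrt_sq_eq_abs, abs_inv]

/-- The inverse of the matrix of the next ellipsoid, up to the factor `(m² - 1)/m²`. -/
noncomputable def cutInv {m : ℕ} (B : Matrix (Fin m) (Fin m) ℝ) (a : Fin m → ℝ) :
    Matrix (Fin m) (Fin m) ℝ :=
  (((m : ℝ) ^ 2 - 1) / (m : ℝ) ^ 2) •
    (B⁻¹ + (2 / (((m : ℝ) - 1) * (a ⬝ᵥ B.mulVec a))) • Matrix.vecMulVec a a)

/-- The Sherman-Morrison formula for the rank-one update of the ellipsoid method. -/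
theorem cut_B_mul_cutInv {m : ℕ} (hm : 1 < m) {s : EllState m} (hB : s.B.PosDef) {a : Vec m}
    (ha : a ≠ 0) : (s.cut a).B * cutInv s.B a.ofLp = 1 := by
  have hm' : (1 : ℝ) < m := by exact_mod_cast hm
  have ha' : a.ofLp ≠ 0 := fun h => ha (by ext i; simpa using congrFun h i)
  have hq : 0 < a.ofLp ⬝ᵥ s.B.mulVec a.ofLp := by
    simpa using hB.dotProduct_mulVec_pos ha'
  set q := a.ofLp ⬝ᵥ s.B.mulVec a.ofLp with hqdef
  set u := s.B.mulVec a.ofLp with hu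
  have hunit : IsUnit s.B.det := (Matrix.isUnit_iff_isUnit_det _).1 hB.isUnit
  have hsymm : s.B.transpose = s.B := by
    simpa [Matrix.conjTranspose_eq_transpose_of_trivial] using hB.isHermitian.eq
  have h1 : s.B * s.B⁻¹ = 1 := Matrix.mul_nonsing_inv _ hunit
  have h2 : s.B * Matrix.vecMulVec a.ofLp a.ofLp = Matrix.vecMulVec u a.ofLp := by
    rw [Matrix.mul_vecMulVec]
  have h3 : Matrix.vecMulVec u u * s.B⁻¹ = Matrix.vecMulVec u a.ofLp := by
    rw [Matrix.vecMulVec_mul]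
    congr 1
    rw [hu, ← Matrix.vecMul_transpose, hsymm, Matrix.vecMul_vecMul, h1, Matrix.vecMul_one]
  have h4 : Matrix.vecMulVec u u * Matrix.vecMulVec a.ofLp a.ofLp =
      q • Matrix.vecMulVec u a.ofLp := by
    rw [Matrix.vecMulVec_mul_vecMulVec, dotProduct_comm u, Matrix.vecMulVec_smul]
  simp only [EllState.cut, cutInv]
  rw [← hu, ← hqdef, Matrix.smul_mul, Matrix.mul_smul, Matrix.sub_mul, Matrix.mul_add,
    Matrix.mul_add, Matrix.smul_mul, Matrix.smul_mul, Matrix.mul_smul, Matrix.mul_smul, h1, h2, h3,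
    h4, smul_smul]
  have e1 : (m : ℝ) ^ 2 / ((m : ℝ) ^ 2 - 1) * (((m : ℝ) ^ 2 - 1) / (m : ℝ) ^ 2) = 1 := by
    have : (m : ℝ) ^ 2 - 1 ≠ 0 := by nlinarith
    field_simp
  rw [e1, one_smul]
  have h5 : (m : ℝ) - 1 ≠ 0 := by linarith
  have h6 : (m : ℝ) + 1 ≠ 0 := by linarith
  match_scalars
  · ring
  · field_simp
    ring

theorem cutInv_posDef {m : ℕ} (hm : 1 < m) {B : Matrix (Fin m) (Fin m) ℝ} (hB : B.PosDef)
    {a : Fin m → ℝ} : (cutInv B a).PosDef := by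
  have hm' : (1 : ℝ) < m := by exact_mod_cast hm
  have hq : 0 ≤ a ⬝ᵥ B.mulVec a := by simpa using hB.posSemidef.dotProduct_mulVec_nonneg a
  refine Matrix.PosDef.smul (hB.inv.add_posSemidef (Matrix.PosSemidef.smul ?_ ?_)) ?_
  · simpa using Matrix.posSemidef_vecMulVec_self_star a
  · have : 0 ≤ (m : ℝ) - 1 := by linarith
    positivity
  · have : 0 < (m : ℝ) ^ 2 - 1 := by nlinarith
    positivity

theorem cut_inv_eq {m : ℕ} (hm : 1 < m) {s : EllState m} (hB : s.B.PosDef) {a : Vec m}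
    (ha : a ≠ 0) : (s.cut a).B⁻¹ = cutInv s.B a.ofLp :=
  Matrix.inv_eq_right_inv (cut_B_mul_cutInv hm hB ha)

theorem cut_posDef {m : ℕ} (hm : 1 < m) {s : EllState m} (hB : s.B.PosDef) {a : Vec m}
    (ha : a ≠ 0) : (s.cut a).B.PosDef := by
  rw [← Matrix.inv_eq_left_inv (cut_B_mul_cutInv hm hB ha)]
  exact (cutInv_posDef hm hB).inv

/-- The next ellipsoid contains the half of the current one that is kept by the cut. -/
theorem mem_ellSet_cut {m : ℕ} (hm : 1 < m) {s : EllState m} (hB : s.B.PosDef) {a : Vec m}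
    (ha : a ≠ 0) {y : Vec m} (hy : y ∈ ellSet s.B s.y) (hcut : inner ℝ a (y - s.y) ≤ 0) :
    y ∈ ellSet (s.cut a).B (s.cut a).y := by
  have hm' : (1 : ℝ) < m := by exact_mod_cast hm
  have ha' : a.ofLp ≠ 0 := fun h => ha (by ext i; simpa using congrFun h i)
  have hq : 0 < a.ofLp ⬝ᵥ s.B.mulVec a.ofLp := by
    simpa using hB.dotProduct_mulVec_pos ha'
  have hcut' : a.ofLp ⬝ᵥ (y - s.y).ofLp ≤ 0 := by
    rw [EuclideanSpace.inner_eq_star_dotProduct] at hcut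
    simpa [dotProduct_comm] using hcut
  unfold ellSet at hy ⊢
  rw [Set.mem_ofPred_eq, cut_inv_eq hm hB ha]
  rw [Set.mem_ofPred_eq] at hy
  set q := a.ofLp ⬝ᵥ s.B.mulVec a.ofLp with hqdef
  set u := s.B.mulVec a.ofLp with hu
  set w := (y - s.y).ofLp with hw
  set k := 1 / ((m : ℝ) + 1) * (1 / √q) with hk
  have hy' : (y - (s.cut a).y).ofLp = w + k • u := by
    simp only [EllState.cut, hw]
    rw [← hu, ← hqdef, hk, mul_smul]
    ext i
    simp
    ring
  rw [hy']
  have hunit : IsUnit s.B.det := (Matrix.isUnit_iff_isUnit_det _).1 hB.isUnit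
  have hBu : (s.B⁻¹).mulVec u = a.ofLp := by
    rw [hu, Matrix.mulVec_mulVec, Matrix.nonsing_inv_mul _ hunit, Matrix.one_mulVec]
  have hsymm : s.B⁻¹.transpose = s.B⁻¹ := by
    simpa [Matrix.conjTranspose_eq_transpose_of_trivial] using hB.inv.isHermitian.eq
  have hu1 : u ⬝ᵥ (s.B⁻¹).mulVec w = a.ofLp ⬝ᵥ w := by
    rw [Matrix.dotProduct_mulVec, ← Matrix.mulVec_transpose, hsymm, hBu]
  have hquad : ∀ t : ℝ, (w + t • u) ⬝ᵥ (s.B⁻¹).mulVec (w + t • u) =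
      w ⬝ᵥ (s.B⁻¹).mulVec w + 2 * t * (a.ofLp ⬝ᵥ w) + t ^ 2 * q := by
    intro t
    rw [Matrix.mulVec_add, Matrix.mulVec_smul, hBu, add_dotProduct, dotProduct_add, dotProduct_add,
      smul_dotProduct, smul_dotProduct, hu1, dotProduct_smul, dotProduct_smul,
      dotProduct_comm w a.ofLp, dotProduct_comm u, ← hqdef]
    simp only [smul_eq_mul]
    ring
  set r := √q with hr
  have hr0 : 0 < r := Real.sqrt_pos.2 hq
  have hr2 : r ^ 2 = q := Real.sq_sqrt hq.le
  set p := a.ofLp ⬝ᵥ w with hp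
  set Q := w ⬝ᵥ (s.B⁻¹).mulVec w with hQ
  -- Cauchy-Schwarz in the metric of the ellipsoid
  have hCS : p ^ 2 ≤ Q * q := by
    have h1 : 0 ≤ (w + (-(p / q)) • u) ⬝ᵥ (s.B⁻¹).mulVec (w + (-(p / q)) • u) := by
      simpa using hB.inv.posSemidef.dotProduct_mulVec_nonneg (w + (-(p / q)) • u)
    rw [hquad] at h1
    have h2 : Q + 2 * -(p / q) * p + (-(p / q)) ^ 2 * q = (Q * q - p ^ 2) / q := by
      field_simp
      ring
    rw [h2] at h1
    have h3 := mul_nonneg h1 hq.le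
    rw [div_mul_cancel₀ _ hq.ne'] at h3
    linarith
  set σ := p / r with hσ
  have hpσ : p = σ * r := by rw [hσ]; field_simp
  have hσ0 : σ ≤ 0 := div_nonpos_of_nonpos_of_nonneg hcut' hr0.le
  have hσ1 : -1 ≤ σ := by
    have h1 : σ ^ 2 ≤ 1 := by
      rw [hσ, div_pow, hr2, div_le_one hq]
      nlinarith
    exact (abs_le.1 ((sq_le_one_iff_abs_le_one σ).1 h1)).1
  have hmul : (Matrix.vecMulVec a.ofLp a.ofLp).mulVec (w + k • u) = (p + k * q) • a.ofLp := by
    rw [Matrix.vecMulVec_mulVec, dotProduct_add, dotProduct_smul]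
    ext i
    simp [hp, hqdef]
    ring
  rw [cutInv, Matrix.smul_mulVec, Matrix.add_mulVec, Matrix.smul_mulVec, hmul, dotProduct_smul,
    dotProduct_add, dotProduct_smul, dotProduct_smul, hquad, dotProduct_comm _ a.ofLp,
    dotProduct_add, dotProduct_smul]
  simp only [smul_eq_mul]
  rw [← hu, ← hqdef, ← hp, hpσ, hk, ← hr2]
  have h5 : 0 < (m : ℝ) - 1 := by linarith
  have h6 : 0 < (m : ℝ) + 1 := by linarith
  have e : ((m : ℝ) ^ 2 - 1) / (m : ℝ) ^ 2 *
      (Q + 2 * (1 / ((m : ℝ) + 1) * (1 / r)) * (σ * r) +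
        (1 / ((m : ℝ) + 1) * (1 / r)) ^ 2 * r ^ 2 +
        2 / (((m : ℝ) - 1) * r ^ 2) * ((σ * r + 1 / ((m : ℝ) + 1) * (1 / r) * r ^ 2) *
          (σ * r + 1 / ((m : ℝ) + 1) * (1 / r) * r ^ 2))) =
      1 + ((m : ℝ) ^ 2 - 1) / (m : ℝ) ^ 2 * (Q - 1 + 2 / ((m : ℝ) - 1) * (σ * (1 + σ))) := by
    field_simp
    ring
  -- `σ ∈ [-1, 0]` is the normalized position of `y` along the cut, so that `σ (1 + σ) ≤ 0`
  rw [e]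
  have h7 : σ * (1 + σ) ≤ 0 := mul_nonpos_of_nonpos_of_nonneg hσ0 (by linarith)
  have h8 : 2 / ((m : ℝ) - 1) * (σ * (1 + σ)) ≤ 0 :=
    mul_nonpos_of_nonneg_of_nonpos (by positivity) h7
  have h9 : 0 ≤ ((m : ℝ) ^ 2 - 1) / (m : ℝ) ^ 2 := by
    have : 0 ≤ (m : ℝ) ^ 2 - 1 := by nlinarith
    positivity
  nlinarith

/-- The ratio of the determinants is `(m²/(m² - 1))^m (m - 1)/(m + 1)`, which equals
`(1 + 1/(m² - 1))^(m - 1) (1 - 1/(m + 1))²`; both factors are estimated by `1 + t ≤ exp t`. -/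
theorem det_cut_le {m : ℕ} (hm : 1 < m) {s : EllState m} (hB : s.B.PosDef) {a : Vec m}
    (ha : a ≠ 0) : (s.cut a).B.det ≤ Real.exp (-(1 / ((m : ℝ) + 1))) * s.B.det := by
  have hm' : (1 : ℝ) < m := by exact_mod_cast hm
  have ha' : a.ofLp ≠ 0 := fun h => ha (by ext i; simpa using congrFun h i)
  have hq : 0 < a.ofLp ⬝ᵥ s.B.mulVec a.ofLp := by
    simpa using hB.dotProduct_mulVec_pos ha'
  have hunit : IsUnit s.B.det := (Matrix.isUnit_iff_isUnit_det _).1 hB.isUnit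
  have h5 : 0 < (m : ℝ) - 1 := by linarith
  have h6 : 0 < (m : ℝ) + 1 := by linarith
  set c := 2 / (((m : ℝ) + 1) * (a.ofLp ⬝ᵥ s.B.mulVec a.ofLp)) with hc
  set u := s.B.mulVec a.ofLp with hu
  have hdet : (s.B - c • Matrix.vecMulVec u u).det = s.B.det * (((m : ℝ) - 1) / ((m : ℝ) + 1)) := by
    have h1 : s.B - c • Matrix.vecMulVec u u =
        s.B * (1 + Matrix.replicateCol Unit ((-c) • a.ofLp) * Matrix.replicateRow Unit u) := by
      rw [← Matrix.vecMulVec_eq, Matrix.mul_add, mul_one, Matrix.mul_vecMulVec, Matrix.mulVec_smul,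
        Matrix.smul_vecMulVec, neg_smul, sub_eq_add_neg]
    rw [h1, Matrix.det_mul, Matrix.det_one_add_replicateCol_mul_replicateRow, dotProduct_smul,
      dotProduct_comm u, hc, smul_eq_mul]
    congr 1
    field_simp
    ring
  have e : (s.cut a).B = ((m : ℝ) ^ 2 / ((m : ℝ) ^ 2 - 1)) • (s.B - c • Matrix.vecMulVec u u) := rfl
  rw [e, Matrix.det_smul, hdet, Fintype.card_fin]
  obtain ⟨k, rfl⟩ : ∃ k, m = k + 1 := ⟨m - 1, by omega⟩
  have h8 : 0 < ((k + 1 : ℕ) : ℝ) ^ 2 - 1 := by nlinarith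
  have hk0 : 0 < (k : ℝ) := by push_cast at h5; linarith
  have h7 : ((k + 1 : ℕ) : ℝ) ^ 2 / (((k + 1 : ℕ) : ℝ) ^ 2 - 1) =
      1 + 1 / (((k + 1 : ℕ) : ℝ) ^ 2 - 1) := by
    field_simp
    ring
  have h9 : (((k + 1 : ℕ) : ℝ) ^ 2 / (((k + 1 : ℕ) : ℝ) ^ 2 - 1)) ^ k ≤
      Real.exp (1 / (((k + 1 : ℕ) : ℝ) + 1)) := by
    calc _ ≤ Real.exp (1 / (((k + 1 : ℕ) : ℝ) ^ 2 - 1)) ^ k := by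
          rw [h7]
          refine pow_le_pow_left₀ (by positivity) ?_ k
          linarith [Real.add_one_le_exp (1 / (((k + 1 : ℕ) : ℝ) ^ 2 - 1))]
      _ = Real.exp (1 / (((k + 1 : ℕ) : ℝ) + 1)) := by
          rw [← Real.exp_nat_mul]
          congr 1
          field_simp
          push_cast
          ring
  have h10 : ((k + 1 : ℕ) : ℝ) ^ 2 / (((k + 1 : ℕ) : ℝ) ^ 2 - 1) *
      ((((k + 1 : ℕ) : ℝ) - 1) / (((k + 1 : ℕ) : ℝ) + 1)) =
      (((k + 1 : ℕ) : ℝ) / (((k + 1 : ℕ) : ℝ) + 1)) ^ 2 := by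
    field_simp
    push_cast
    ring
  have h11 : ((k + 1 : ℕ) : ℝ) / (((k + 1 : ℕ) : ℝ) + 1) ≤
      Real.exp (-(1 / (((k + 1 : ℕ) : ℝ) + 1))) := by
    have := Real.add_one_le_exp (-(1 / (((k + 1 : ℕ) : ℝ) + 1)))
    refine le_trans (le_of_eq ?_) this
    field_simp
    ring
  have hBpos := hB.det_pos
  calc _ = (((k + 1 : ℕ) : ℝ) ^ 2 / (((k + 1 : ℕ) : ℝ) ^ 2 - 1)) ^ k *
        (((k + 1 : ℕ) : ℝ) / (((k + 1 : ℕ) : ℝ) + 1)) ^ 2 * s.B.det := by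
        rw [← h10, pow_succ]
        ring
    _ ≤ Real.exp (1 / (((k + 1 : ℕ) : ℝ) + 1)) *
        (Real.exp (-(1 / (((k + 1 : ℕ) : ℝ) + 1)))) ^ 2 * s.B.det := by
        gcongr
    _ = _ := by
        rw [← Real.exp_nat_mul, ← Real.exp_add]
        congr 2
        push_cast
        ring

/-- The part of the ball of radius `b` in the nonnegative orthant. -/
def orthantBall (m : ℕ) (b : ℝ) : Set (Vec m) := {y | (∀ i, 0 ≤ y i) ∧ ‖y‖ ≤ b}

theorem measurableSet_orthantBall (m : ℕ) (b : ℝ) : MeasurableSet (orthantBall m b) := by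
  have h : orthantBall m b = (⋂ i, {y : Vec m | 0 ≤ y i}) ∩ {y | ‖y‖ ≤ b} := by
    ext y
    simp [orthantBall]
  rw [h]
  exact ((isClosed_iInter fun i => isClosed_le continuous_const (by fun_prop)).inter
    (isClosed_le continuous_norm continuous_const)).measurableSet

/-- The ball is covered by the `2^m` reflections of its part in the nonnegative orthant. -/
theorem volume_closedBall_le_orthantBall (m : ℕ) (b : ℝ) :
    volume (Metric.closedBall (0 : Vec m) b) ≤ 2 ^ m * volume (orthantBall m b) := by
  let R : (Fin m → Bool) → (Vec m ≃ₗᵢ[ℝ] Vec m) := fun s =>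
    LinearIsometryEquiv.piLpCongrRight 2 fun i =>
      if s i then LinearIsometryEquiv.refl ℝ ℝ else LinearIsometryEquiv.neg ℝ
  have hR : ∀ s y i, R s y i = if s i then y i else - y i := by
    intro s y i
    simp only [R, LinearIsometryEquiv.piLpCongrRight_apply]
    split_ifs <;> simp
  have hcov : Metric.closedBall (0 : Vec m) b ⊆ ⋃ s, R s ⁻¹' orthantBall m b := by
    intro y hy
    refine Set.mem_iUnion.2 ⟨fun i => decide (0 ≤ y i), fun i => ?_, ?_⟩
    · rw [hR]
      by_cases h : 0 ≤ y i
      · simp [h]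
      · simpa [h] using (not_le.1 h).le
    · rw [LinearIsometryEquiv.norm_map]
      exact mem_closedBall_zero_iff.1 hy
  calc volume (Metric.closedBall (0 : Vec m) b)
      ≤ ∑ s : Fin m → Bool, volume (R s ⁻¹' orthantBall m b) :=
        (measure_mono hcov).trans (measure_iUnion_fintype_le _ _)
    _ = ∑ s : Fin m → Bool, volume (orthantBall m b) := by
        refine Finset.sum_congr rfl fun s _ => ?_
        exact (R s).measurePreserving.measure_preimage
          (measurableSet_orthantBall m b).nullMeasurableSet
    _ = 2 ^ m * volume (orthantBall m b) := by simp

/-- The diameter of `orthantBall m b` is in fact `√2 b`, since its points have nonnegative inner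
products. -/
theorem dist_le_of_mem_orthantBall {m : ℕ} {b : ℝ} {y w : Vec m} (hy : y ∈ orthantBall m b)
    (hw : w ∈ orthantBall m b) : ‖w - y‖ ≤ 3 / 2 * b := by
  have hb : 0 ≤ b := (norm_nonneg y).trans hy.2
  have h1 : 0 ≤ inner ℝ w y := by
    rw [PiLp.inner_apply]
    exact Finset.sum_nonneg fun i _ => by simpa using mul_nonneg (hy.1 i) (hw.1 i)
  have h2 := norm_sub_sq_real w y
  have h3 := pow_le_pow_left₀ (norm_nonneg _) hy.2 2
  have h4 := pow_le_pow_left₀ (norm_nonneg _) hw.2 2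
  exact (abs_le_of_sq_le_sq' (by nlinarith) (by positivity)).2

/-- A neighbourhood of radius `η` of a point of `orthantBall m b`, intersected with this set,
contains a copy of it scaled by `2η/(3b)`; so its volume exceeds that of a ball of radius
`η / 4`. -/
theorem lt_volume_orthantBall_inter {m : ℕ} (hm : 0 < m) {b η : ℝ} (hη : 0 < η) (hηb : η ≤ b)
    {y : Vec m} (hy : y ∈ orthantBall m b) :
    (4 : ENNReal)⁻¹ ^ m * volume (Metric.closedBall (0 : Vec m) η) <
      volume (orthantBall m b ∩ Metric.closedBall y η) := by
  have hb : 0 < b := hη.trans_le hηb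
  set t := 2 * η / (3 * b) with ht
  have ht0 : 0 < t := by positivity
  have ht1 : t ≤ 1 := by
    rw [ht, div_le_one (by positivity)]
    linarith
  have hsub : AffineMap.homothety y t '' orthantBall m b ⊆
      orthantBall m b ∩ Metric.closedBall y η := by
    rintro _ ⟨w, hw, rfl⟩
    have hform : AffineMap.homothety y t w = (1 - t) • y + t • w := by
      simp only [AffineMap.homothety_apply, vsub_eq_sub, vadd_eq_add]
      module
    rw [hform]
    refine ⟨⟨fun i => ?_, ?_⟩, ?_⟩
    · have h1 := mul_nonneg (sub_nonneg.2 ht1) (hy.1 i)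
      have h2 := mul_nonneg ht0.le (hw.1 i)
      simpa using add_nonneg h1 h2
    · refine (norm_add_le _ _).trans ?_
      rw [norm_smul, norm_smul, Real.norm_of_nonneg ht0.le, Real.norm_of_nonneg (sub_nonneg.2 ht1)]
      have h1 := mul_le_mul_of_nonneg_left hy.2 (sub_nonneg.2 ht1)
      have h2 := mul_le_mul_of_nonneg_left hw.2 ht0.le
      linarith
    · have h1 : (1 - t) • y + t • w - y = t • (w - y) := by module
      rw [Metric.mem_closedBall, dist_eq_norm, h1, norm_smul, Real.norm_of_nonneg ht0.le]
      have h2 := mul_le_mul_of_nonneg_left (dist_le_of_mem_orthantBall hy hw) ht0.le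
      have h3 : t * (3 / 2 * b) = η := by
        rw [ht]
        field_simp
      linarith
  have hV0 : volume (Metric.closedBall (0 : Vec m) 1) ≠ 0 :=
    (Metric.measure_closedBall_pos _ _ one_pos).ne'
  have hVtop : volume (Metric.closedBall (0 : Vec m) 1) ≠ ⊤ :=
    measure_closedBall_lt_top.ne
  have hball : ∀ r : ℝ, 0 ≤ r → volume (Metric.closedBall (0 : Vec m) r) =
      ENNReal.ofReal (r ^ m) * volume (Metric.closedBall (0 : Vec m) 1) := fun r hr => by
    rw [Measure.addHaar_closedBall' _ _ hr, finrank_euclideanSpace_fin]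
  have h4 : (4 : ENNReal)⁻¹ ^ m = ENNReal.ofReal ((1 / 4) ^ m) := by
    rw [ENNReal.ofReal_pow (by norm_num), one_div, ENNReal.ofReal_inv_of_pos (by norm_num)]
    norm_num
  have h2 : (2 : ENNReal) ^ m = ENNReal.ofReal (2 ^ m) := by
    rw [ENNReal.ofReal_pow (by norm_num)]
    norm_num
  have horth : ENNReal.ofReal ((b / 2) ^ m) * volume (Metric.closedBall (0 : Vec m) 1) ≤
      volume (orthantBall m b) := by
    have h1 := volume_closedBall_le_orthantBall m b
    rw [hball b hb.le, h2] at h1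
    have h3 : ENNReal.ofReal ((1 / 2) ^ m) * (ENNReal.ofReal (2 ^ m) * volume (orthantBall m b)) =
        volume (orthantBall m b) := by
      rw [← mul_assoc, ← ENNReal.ofReal_mul (by positivity), ← mul_pow]
      norm_num
    rw [← h3]
    refine le_trans (le_of_eq ?_) (mul_le_mul_right h1 _)
    rw [← mul_assoc, ← ENNReal.ofReal_mul (by positivity), ← mul_pow]
    congr 3
    ring
  calc (4 : ENNReal)⁻¹ ^ m * volume (Metric.closedBall (0 : Vec m) η)
      = ENNReal.ofReal ((η / 4) ^ m) * volume (Metric.closedBall (0 : Vec m) 1) := by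
        rw [h4, hball η hη.le, ← mul_assoc, ← ENNReal.ofReal_mul (by positivity), ← mul_pow]
        congr 3
        ring
    _ < ENNReal.ofReal ((η / 3) ^ m) * volume (Metric.closedBall (0 : Vec m) 1) := by
        rw [ENNReal.mul_lt_mul_iff_left hV0 hVtop,
          ENNReal.ofReal_lt_ofReal_iff (by positivity)]
        exact pow_lt_pow_left₀ (by linarith) (by positivity) hm.ne'
    _ = ENNReal.ofReal |t ^ m| * (ENNReal.ofReal ((b / 2) ^ m) *
          volume (Metric.closedBall (0 : Vec m) 1)) := by
        rw [abs_of_pos (by positivity), ← mul_assoc, ← ENNReal.ofReal_mul (by positivity),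
          ← mul_pow]
        congr 3
        rw [ht]
        field_simp
    _ ≤ ENNReal.ofReal |t ^ m| * volume (orthantBall m b) := mul_le_mul_right horth _
    _ = volume (AffineMap.homothety y t '' orthantBall m b) := by
        rw [Measure.addHaar_image_homothety, finrank_euclideanSpace_fin]
    _ ≤ _ := measure_mono hsub

/-- As long as the volume test of the ellipsoid method fails, the number of cuts is at most
`2 m (m + 1) log (4 b / η)`. -/
theorem cuts_le_of_volume {m k : ℕ} {b η : ℝ} (hη : 0 < η) (hb : 0 < b)
    {B : Matrix (Fin m) (Fin m) ℝ} (hB : B.PosDef) {c : Vec m}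
    (hdet : B.det ≤ Real.exp (-(k / ((m : ℝ) + 1))) * b ^ (2 * m))
    (hvol : ¬ volume (ellSet B c) ≤
      (4 : ENNReal)⁻¹ ^ m * volume (Metric.closedBall (0 : Vec m) η)) :
    (k : ℝ) ≤ 2 * m * (m + 1) * Real.log (4 * b / η) := by
  have h4 : (4 : ENNReal)⁻¹ ^ m = ENNReal.ofReal ((1 / 4) ^ m) := by
    rw [ENNReal.ofReal_pow (by norm_num), one_div, ENNReal.ofReal_inv_of_pos (by norm_num)]
    norm_num
  rw [volume_ellSet hB, Measure.addHaar_closedBall' _ _ hη.le, finrank_euclideanSpace_fin, h4,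
    ← mul_assoc, ← ENNReal.ofReal_mul (by positivity), ← mul_pow] at hvol
  have h1 : (1 / 4 * η) ^ m < √B.det := by
    by_contra! h
    exact hvol (mul_le_mul_left (ENNReal.ofReal_le_ofReal h) _)
  have h2 : (1 / 4 * η) ^ (2 * m) < Real.exp (-(k / ((m : ℝ) + 1))) * b ^ (2 * m) := by
    refine lt_of_lt_of_le ?_ hdet
    rw [mul_comm 2 m, pow_mul]
    exact (Real.lt_sqrt (by positivity)).1 h1
  have h3 : Real.exp (k / ((m : ℝ) + 1)) ≤ (4 * b / η) ^ (2 * m) := by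
    have h5 : (4 * b / η) ^ (2 * m) = b ^ (2 * m) / (1 / 4 * η) ^ (2 * m) := by
      rw [← div_pow]
      congr 1
      field_simp
    rw [h5, le_div_iff₀ (by positivity)]
    have h6 := mul_lt_mul_of_pos_left h2 (Real.exp_pos (k / ((m : ℝ) + 1)))
    rw [← mul_assoc, ← Real.exp_add, add_neg_cancel, Real.exp_zero, one_mul] at h6
    exact h6.le
  have h5 := (Real.le_log_iff_exp_le (by positivity)).2 h3
  rw [Real.log_pow, div_le_iff₀ (by positivity)] at h5
  push_cast at h5
  linarith

/-! ### Positive parts -/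

theorem pos_apply {m : ℕ} (v : Vec m) (i : Fin m) : pos v i = max (v i) 0 := rfl

theorem pos_nonneg {m : ℕ} (v : Vec m) (i : Fin m) : 0 ≤ pos v i := le_max_right _ _

theorem pos_smul {m : ℕ} {c : ℝ} (hc : 0 ≤ c) (v : Vec m) : pos (c • v) = c • pos v := by
  ext i
  simp [pos_apply, mul_max_of_nonneg _ _ hc]

theorem norm_pos_sub_pos_le {m : ℕ} (v w : Vec m) : ‖pos v - pos w‖ ≤ ‖v - w‖ := by
  rw [EuclideanSpace.norm_eq, EuclideanSpace.norm_eq]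
  refine Real.sqrt_le_sqrt (Finset.sum_le_sum fun i _ => ?_)
  refine pow_le_pow_left₀ (norm_nonneg _) ?_ 2
  simpa [pos_apply] using abs_max_sub_max_le_abs (v i) (w i) 0

/-- `pos v` is the projection of `v` onto the nonnegative orthant. -/
theorem inner_pos_sub_le {m : ℕ} (v : Vec m) {w : Vec m} (hw : ∀ i, 0 ≤ w i) :
    inner ℝ (pos v - w) (pos v - v) ≤ 0 := by
  rw [PiLp.inner_apply]
  refine Finset.sum_nonpos fun i _ => ?_
  have := hw i
  rcases le_total (v i) 0 with h | h
  · simp [pos_apply, h]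
    nlinarith
  · simp [pos_apply, h]

/-- The function `‖[·]₊‖²/2` has a quadratic majorant with gradient `[·]₊`. -/
theorem norm_pos_sq_le {m : ℕ} (v w : Vec m) :
    ‖pos v‖ ^ 2 / 2 ≤ ‖pos w‖ ^ 2 / 2 + inner ℝ (pos w) (v - w) + ‖v - w‖ ^ 2 / 2 := by
  rw [EuclideanSpace.real_norm_sq_eq, EuclideanSpace.real_norm_sq_eq,
    EuclideanSpace.real_norm_sq_eq, PiLp.inner_apply, Finset.sum_div, Finset.sum_div,
    Finset.sum_div, ← Finset.sum_add_distrib, ← Finset.sum_add_distrib]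
  refine Finset.sum_le_sum fun i _ => ?_
  simp only [pos_apply, PiLp.sub_apply, RCLike.inner_apply, conj_trivial]
  rcases le_total (v i) 0 with h | h <;> rcases le_total (w i) 0 with h' | h' <;>
    simp [h, h'] <;> nlinarith

/-! ### The Lagrangian -/

/-- The smooth part `f + ⟨w, g⟩` of the Lagrangian. -/
noncomputable def lagr {n m : ℕ} (P : Problem n m) (w : Vec m) (u : Vec n) : ℝ :=
  P.f u + inner ℝ w (P.g u)

section

variable {n m : ℕ} {P : Problem n m} {Lf Lg μ : ℝ}

theorem Regular.closedConvex (hR : Regular P Lf Lg μ) (hne : (dom P.h).Nonempty) :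
    ClosedConvex P.h :=
  ⟨hR.h_ne_bot, hR.h_closed, hR.h_convex, hR.dom_bounded, hne⟩

theorem Regular.hasGradientAt_lagr (hR : Regular P Lf Lg μ) (w : Vec m) (x : Vec n) :
    HasGradientAt (lagr P w) (gradient P.f x + (fderiv ℝ P.g x).adjoint w) x := by
  rw [hasGradientAt_iff_hasFDerivAt]
  have h1 := (hR.f_diff x).hasFDerivAt
  have h2 := (innerSL ℝ w).hasFDerivAt.comp x (hR.g_diff x).hasFDerivAt
  refine (h1.add h2).congr_fderiv ?_
  ext v
  simp [ContinuousLinearMap.adjoint_inner_left]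

theorem Regular.gradient_lagr (hR : Regular P Lf Lg μ) (w : Vec m) (x : Vec n) :
    gradient (lagr P w) x = gradient P.f x + (fderiv ℝ P.g x).adjoint w :=
  (hR.hasGradientAt_lagr w x).gradient

theorem Regular.smoothStrong_lagr (hR : Regular P Lf Lg μ) {w : Vec m} (hw : ∀ i, 0 ≤ w i) :
    SmoothStrong (lagr P w) (Lf + ‖w‖ * Lg) μ := by
  refine SmoothStrong.of_strongConvexOn
    (fun x => (hR.hasGradientAt_lagr w x).differentiableAt) (fun x y => ?_) hR.μ_pos ?_
  · have h1 := hR.f_smooth x y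
    have h2 : ‖(fderiv ℝ P.g x).adjoint w - (fderiv ℝ P.g y).adjoint w‖ ≤
        ‖w‖ * (Lg * ‖x - y‖) := by
      rw [← sub_apply, ← map_sub]
      refine (ContinuousLinearMap.le_opNorm _ _).trans ?_
      rw [LinearIsometryEquiv.norm_map, mul_comm]
      exact mul_le_mul_of_nonneg_left (hR.g_smooth x y) (norm_nonneg _)
    rw [hR.gradient_lagr, hR.gradient_lagr, add_sub_add_comm]
    refine (norm_add_le _ _).trans ?_
    linarith
  · refine ⟨convex_univ, fun x _ y _ a b ha hb hab => ?_⟩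
    have h1 := hR.f_strong.2 (Set.mem_univ x) (Set.mem_univ y) ha hb hab
    have h2 : inner ℝ w (P.g (a • x + b • y)) ≤ a * inner ℝ w (P.g x) + b * inner ℝ w (P.g y) := by
      simp only [PiLp.inner_apply, Finset.mul_sum, ← Finset.sum_add_distrib]
      refine Finset.sum_le_sum fun i _ => ?_
      have := (hR.g_convex i).2 (Set.mem_univ x) (Set.mem_univ y) ha hb hab
      simp only [smul_eq_mul] at this
      have := mul_le_mul_of_nonneg_left this (hw i)
      simp only [RCLike.inner_apply, conj_trivial]
      linarith
    simp only [lagr, smul_eq_mul] at h1 ⊢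
    linarith

theorem Regular.Lg_nonneg (hR : Regular P Lf Lg μ) (hn : 0 < n) : 0 ≤ Lg := by
  have : Nontrivial (Vec n) := by
    have : Nonempty (Fin n) := ⟨⟨0, hn⟩⟩
    infer_instance
  obtain ⟨x, hx⟩ := exists_ne (0 : Vec n)
  have h := (norm_nonneg _).trans (hR.g_smooth x 0)
  rw [sub_zero] at h
  exact nonneg_of_mul_nonneg_left h (norm_pos_iff.2 hx)

theorem Regular.smoothStrong_f (hR : Regular P Lf Lg μ) : SmoothStrong P.f Lf μ :=
  SmoothStrong.of_strongConvexOn hR.f_diff hR.f_smooth hR.μ_pos hR.f_strong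

theorem Regular.μ_le_Lf (hR : Regular P Lf Lg μ) (hn : 0 < n) : μ ≤ Lf :=
  hR.smoothStrong_f.le hn

/-- Changing the multiplier changes the subgradients of the Lagrangian by `J_gᵀ`. -/
theorem Regular.subdiff_lagr (hR : Regular P Lf Lg μ) {w w' : Vec m} (hw : ∀ i, 0 ≤ w i)
    (hw' : ∀ i, 0 ≤ w' i) {x v : Vec n} (hv : v ∈ subdiff (lagr P w) P.h x) :
    v + (fderiv ℝ P.g x).adjoint (w' - w) ∈ subdiff (lagr P w') P.h x := by
  have hh := hR.closedConvex ⟨x, hv.1⟩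
  rw [mem_subdiff_iff hh (hR.smoothStrong_lagr hw)] at hv
  rw [mem_subdiff_iff hh (hR.smoothStrong_lagr hw')]
  refine ⟨hv.1, fun u hu => ?_⟩
  have := hv.2 u hu
  rw [hR.gradient_lagr] at this ⊢
  have e : v + (fderiv ℝ P.g x).adjoint (w' - w) -
      (gradient P.f x + (fderiv ℝ P.g x).adjoint w') =
      v - (gradient P.f x + (fderiv ℝ P.g x).adjoint w) := by
    rw [map_sub]
    abel
  rwa [e]

theorem lagr_zero : lagr P 0 = P.f := by
  ext u
  simp [lagr]

theorem IsKKT.zero_mem {xs : Vec n} {zs : Vec m} (hK : IsKKT P xs zs)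
    (hR : Regular P Lf Lg μ) : (0 : Vec n) ∈ subdiff (lagr P zs) P.h xs := by
  obtain ⟨⟨v, hv, hv0⟩, hz, -, -⟩ := hK
  rw [← lagr_zero] at hv
  have := hR.subdiff_lagr (fun _ => le_rfl) hz hv
  rwa [sub_zero, hv0] at this

/-! ### Bounds on the domain of `h` -/

theorem Regular.bddAbove_fderiv (hR : Regular P Lf Lg μ) (hne : (dom P.h).Nonempty) :
    BddAbove ((fun x => ‖fderiv ℝ P.g x‖) '' dom P.h) := by
  obtain ⟨x₀, hx₀⟩ := hne
  refine ⟨‖fderiv ℝ P.g x₀‖ + |Lg| * Metric.diam (dom P.h), ?_⟩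
  rintro _ ⟨x, hx, rfl⟩
  have h1 := hR.g_smooth x x₀
  have h2 := Metric.dist_le_diam_of_mem hR.dom_bounded hx hx₀
  rw [dist_eq_norm] at h2
  have h3 := norm_sub_norm_le (fderiv ℝ P.g x) (fderiv ℝ P.g x₀)
  have h4 := mul_le_mul_of_nonneg_right (le_abs_self Lg) (norm_nonneg (x - x₀))
  have h5 := mul_le_mul_of_nonneg_left h2 (abs_nonneg Lg)
  show ‖fderiv ℝ P.g x‖ ≤ _
  linarith

theorem Regular.norm_fderiv_le (hR : Regular P Lf Lg μ) {x : Vec n} (hx : x ∈ dom P.h) :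
    ‖fderiv ℝ P.g x‖ ≤ boundJ P :=
  le_csSup (hR.bddAbove_fderiv ⟨x, hx⟩) ⟨x, hx, rfl⟩

theorem Regular.boundJ_nonneg (hR : Regular P Lf Lg μ) {x : Vec n} (hx : x ∈ dom P.h) :
    0 ≤ boundJ P := (norm_nonneg _).trans (hR.norm_fderiv_le hx)

theorem Regular.norm_adjoint_le (hR : Regular P Lf Lg μ) {x : Vec n} (hx : x ∈ dom P.h)
    (w : Vec m) : ‖(fderiv ℝ P.g x).adjoint w‖ ≤ boundJ P * ‖w‖ := by
  refine (ContinuousLinearMap.le_opNorm _ _).trans ?_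
  rw [LinearIsometryEquiv.norm_map]
  exact mul_le_mul_of_nonneg_right (hR.norm_fderiv_le hx) (norm_nonneg _)

theorem Regular.norm_g_sub_le (hR : Regular P Lf Lg μ) {x y : Vec n} (hx : x ∈ dom P.h)
    (hy : y ∈ dom P.h) : ‖P.g x - P.g y‖ ≤ boundJ P * ‖x - y‖ :=
  (hR.h_convex.1).norm_image_sub_le_of_norm_fderiv_le (𝕜 := ℝ) (fun u _ => hR.g_diff u)
    (fun _ hu => hR.norm_fderiv_le hu) hy hx

theorem Regular.norm_sub_le_diamDom (hR : Regular P Lf Lg μ) {x y : Vec n} (hx : x ∈ dom P.h)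
    (hy : y ∈ dom P.h) : ‖x - y‖ ≤ diamDom P := by
  rw [← dist_eq_norm]
  exact Metric.dist_le_diam_of_mem hR.dom_bounded hx hy

theorem Regular.norm_g_le (hR : Regular P Lf Lg μ) {x : Vec n} (hx : x ∈ dom P.h) :
    ‖P.g x‖ ≤ boundG P := by
  refine le_csSup ⟨‖P.g x‖ + boundJ P * diamDom P, ?_⟩ ⟨x, hx, rfl⟩
  rintro _ ⟨y, hy, rfl⟩
  have h1 := hR.norm_g_sub_le hy hx
  have h2 := mul_le_mul_of_nonneg_left (hR.norm_sub_le_diamDom hy hx) (hR.boundJ_nonneg hx)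
  have h3 := norm_sub_norm_le (P.g y) (P.g x)
  show ‖P.g y‖ ≤ _
  linarith

end

/-! ### The dual function -/

section

variable {n m : ℕ} {P : Problem n m} {Lf Lg μ β : ℝ} {z y y' : Vec m}

theorem smoothPhi_eq_lagr (P : Problem n m) (hβ : β ≠ 0) (z y : Vec m) (x : Vec n) :
    smoothPhi P β z y x = lagr P (β • y) x + (inner ℝ y z - β * (‖y‖ ^ 2 / 2)) := by
  simp only [smoothPhi, lagr, theta, inner_add_right, inner_smul_left, inner_smul_right,
    conj_trivial]
  field_simp
  ring

theorem subdiff_add_const (ψ : Vec n → ℝ) (h : Vec n → EReal) (c : ℝ) (x : Vec n) :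
    subdiff (fun u => ψ u + c) h x = subdiff ψ h x := by
  ext v
  simp only [subdiff, Set.mem_ofPred_eq, add_right_comm _ c]
  refine and_congr_right fun _ => forall₂_congr fun u _ => ?_
  constructor <;> intro h <;> linarith

theorem SmoothStrong.add_const {ψ : Vec n → ℝ} {L : ℝ} (hψ : SmoothStrong ψ L μ) (c : ℝ) :
    SmoothStrong (fun u => ψ u + c) L μ := by
  have hg : gradient (fun u => ψ u + c) = gradient ψ := by
    ext1 x
    simp [gradient]
  refine ⟨hψ.diff.add_const c, ?_, fun x u => ?_, fun x u => ?_, hψ.μ_pos⟩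
  · rw [hg]
    exact hψ.lip
  · rw [hg]
    linarith [hψ.upper x u]
  · rw [hg]
    linarith [hψ.lower x u]

theorem smoothPhi_eq (P : Problem n m) (hβ : β ≠ 0) (z y : Vec m) :
    smoothPhi P β z y = fun u => lagr P (β • y) u + (inner ℝ y z - β * (‖y‖ ^ 2 / 2)) :=
  funext (smoothPhi_eq_lagr P hβ z y)

theorem subdiff_smoothPhi (P : Problem n m) (hβ : β ≠ 0) (z y : Vec m) (x : Vec n) :
    subdiff (smoothPhi P β z y) P.h x = subdiff (lagr P (β • y)) P.h x := by
  rw [smoothPhi_eq P hβ, subdiff_add_const]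

theorem Regular.smoothStrong_smoothPhi (hR : Regular P Lf Lg μ) (hβ : 0 < β) (z : Vec m)
    (hy : ∀ i, 0 ≤ y i) : SmoothStrong (smoothPhi P β z y) (Lf + β * ‖y‖ * Lg) μ := by
  rw [smoothPhi_eq P hβ.ne']
  have h : ∀ i, 0 ≤ (β • y) i := fun i => mul_nonneg hβ.le (hy i)
  have := (hR.smoothStrong_lagr h).add_const (inner ℝ y z - β * (‖y‖ ^ 2 / 2))
  rwa [norm_smul, Real.norm_of_nonneg hβ.le] at this

theorem Regular.continuous_theta (hR : Regular P Lf Lg μ) : Continuous (theta P β z) :=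
  hR.g_diff.continuous.add continuous_const

theorem Regular.continuous_smoothPhi (hR : Regular P Lf Lg μ) (β : ℝ) (z y : Vec m) :
    Continuous (smoothPhi P β z y) := by
  have h1 := hR.f_diff.continuous
  have h2 := hR.continuous_theta (β := β) (z := z)
  unfold smoothPhi
  fun_prop

/-- `Φ(u, ·)` is a quadratic function. -/
theorem smoothPhi_expand (P : Problem n m) (β : ℝ) (z y y' : Vec m) (u : Vec n) :
    smoothPhi P β z y' u = smoothPhi P β z y u + β * inner ℝ (theta P β z u - y) (y' - y) -
      β / 2 * ‖y' - y‖ ^ 2 := by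
  simp only [smoothPhi]
  rw [inner_sub_left, inner_sub_right, inner_sub_right, norm_sub_sq_real,
    real_inner_self_eq_norm_sq, real_inner_comm y' (theta P β z u),
    real_inner_comm y (theta P β z u), real_inner_comm y' y]
  ring

theorem theta_sub_theta (P : Problem n m) (β : ℝ) (z : Vec m) (u x : Vec n) :
    theta P β z u - theta P β z x = P.g u - P.g x := by
  simp [theta]

theorem Regular.exists_argmin (hR : Regular P Lf Lg μ) (hne : (dom P.h).Nonempty) (β : ℝ)
    (z y : Vec m) : ∃ x, IsArgmin (smoothPhi P β z y) P.h x := by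
  obtain ⟨x, h1, h2⟩ := (hR.closedConvex hne).exists_min (hR.continuous_smoothPhi β z y)
  exact ⟨x, h1, h2⟩

theorem dualFun_eq {x : Vec n} (hx : IsArgmin (smoothPhi P β z y) P.h x) :
    dualFun P β z y = smoothPhi P β z y x + (P.h x).toReal :=
  IsLeast.csInf_eq ⟨⟨x, hx.1, rfl⟩, by rintro _ ⟨u, hu, rfl⟩; exact hx.2 u hu⟩

theorem Regular.dualFun_le (hR : Regular P Lf Lg μ) (β : ℝ) (z y : Vec m) {u : Vec n}
    (hu : u ∈ dom P.h) : dualFun P β z y ≤ smoothPhi P β z y u + (P.h u).toReal := by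
  obtain ⟨x, hx⟩ := hR.exists_argmin ⟨u, hu⟩ β z y
  rw [dualFun_eq hx]
  exact hx.2 u hu

/-- Danskin's theorem: the dual function is differentiable at every `y ≥ 0`, with gradient
`β (θ(x(y)) - y)` where `x(y)` is the unique minimizer of `Φ(·, y)`. -/
theorem Regular.hasGradientAt_dualFun (hR : Regular P Lf Lg μ) (hβ : 0 < β) (hy : ∀ i, 0 ≤ y i)
    {x : Vec n} (hx : IsArgmin (smoothPhi P β z y) P.h x) :
    HasGradientAt (dualFun P β z) (β • (theta P β z x - y)) y := by
  have hμ := hR.μ_pos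
  have hh := hR.closedConvex ⟨x, hx.1⟩
  -- the lower bound compares `Φ(·, y)` at `x` and at the minimizer `u` for `y'`, using that
  -- `Φ(·, y)` grows quadratically away from `x`
  set K := β / 2 + β ^ 2 * boundJ P ^ 2 / (2 * μ) with hK
  have hbound : ∀ y', ‖dualFun P β z y' - dualFun P β z y -
      inner ℝ (β • (theta P β z x - y)) (y' - y)‖ ≤ K * ‖y' - y‖ ^ 2 := by
    intro y'
    have hup := hR.dualFun_le β z y' hx.1
    rw [smoothPhi_expand P β z y y' x] at hup
    rw [inner_smul_left, conj_trivial, Real.norm_eq_abs, abs_le, dualFun_eq hx]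
    have hK0 : 0 ≤ β ^ 2 * boundJ P ^ 2 / (2 * μ) * ‖y' - y‖ ^ 2 := by positivity
    have hβ0 : 0 ≤ β / 2 * ‖y' - y‖ ^ 2 := by positivity
    constructor
    · obtain ⟨u, hu⟩ := hR.exists_argmin ⟨x, hx.1⟩ β z y'
      rw [dualFun_eq hu, smoothPhi_expand P β z y y' u]
      have h1 := hx.lower hh (hR.smoothStrong_smoothPhi hβ z hy) hu.1
      have h2 := hR.norm_g_sub_le hu.1 hx.1
      have h3 := abs_le.1 (abs_real_inner_le_norm (P.g u - P.g x) (y' - y))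
      have h4 : theta P β z u - y = (P.g u - P.g x) + (theta P β z x - y) := by
        rw [← theta_sub_theta P β z]
        abel
      rw [h4, inner_add_left]
      have h5 := mul_le_mul_of_nonneg_right h2 (norm_nonneg (y' - y))
      have h6 : β * (boundJ P * ‖u - x‖ * ‖y' - y‖) ≤ μ / 2 * ‖u - x‖ ^ 2 +
          β ^ 2 * boundJ P ^ 2 / (2 * μ) * ‖y' - y‖ ^ 2 := by
        have h7 := sq_nonneg (μ * ‖u - x‖ - β * boundJ P * ‖y' - y‖)
        have h8 : 0 ≤ (μ * ‖u - x‖ - β * boundJ P * ‖y' - y‖) ^ 2 / (2 * μ) := by positivity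
        have h9 : (μ * ‖u - x‖ - β * boundJ P * ‖y' - y‖) ^ 2 / (2 * μ) =
            μ / 2 * ‖u - x‖ ^ 2 + β ^ 2 * boundJ P ^ 2 / (2 * μ) * ‖y' - y‖ ^ 2 -
              β * (boundJ P * ‖u - x‖ * ‖y' - y‖) := by
          field_simp
          ring
        linarith
      have h10 : -(β * (boundJ P * ‖u - x‖ * ‖y' - y‖)) ≤
          β * inner ℝ (P.g u - P.g x) (y' - y) := by
        rw [← mul_neg]
        exact mul_le_mul_of_nonneg_left (by linarith [h3.1]) hβ.le
      rw [hK]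
      linarith
    · rw [hK]
      linarith
  rw [hasGradientAt_iff_isLittleO]
  have hO : (fun y' => dualFun P β z y' - dualFun P β z y -
      inner ℝ (β • (theta P β z x - y)) (y' - y)) =O[nhds y] fun y' => ‖y' - y‖ ^ 2 :=
    Asymptotics.IsBigO.of_bound K (Filter.Eventually.of_forall fun y' => by
      rw [Real.norm_of_nonneg (sq_nonneg _)]
      exact hbound y')
  refine hO.trans_isLittleO ?_
  have h1 : (fun v : Vec m => ‖v‖ ^ 2) =o[nhds 0] fun v => v := by
    simpa using (Asymptotics.isLittleO_norm_pow_id (E' := Vec m) one_lt_two)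
  have h2 : Filter.Tendsto (fun y' : Vec m => y' - y) (nhds y) (nhds 0) := by
    have : Continuous fun y' : Vec m => y' - y := by fun_prop
    simpa using this.tendsto y
  exact h1.comp_tendsto h2

/-- The saddle point of `Φ` over `dom h` and the nonnegative orthant: a minimizer of `Φ(·, y)` with
`y = [θ(x)]₊`. It is obtained by minimizing the augmented Lagrangian. -/
theorem Regular.exists_saddle (hR : Regular P Lf Lg μ) (hne : (dom P.h).Nonempty) (hβ : 0 < β)
    (z : Vec m) : ∃ x, IsArgmin (smoothPhi P β z (pos (theta P β z x))) P.h x := by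
  have hh := hR.closedConvex hne
  have hcont : Continuous fun x => P.f x + β * (‖pos (theta P β z x)‖ ^ 2 / 2) := by
    have h1 := hR.f_diff.continuous
    have h2 := hR.continuous_theta (β := β) (z := z)
    have h3 : Continuous (pos : Vec m → Vec m) := by
      refine LipschitzWith.continuous (K := 1) (LipschitzWith.of_dist_le_mul fun v w => ?_)
      simpa [dist_eq_norm] using norm_pos_sub_pos_le v w
    fun_prop
  obtain ⟨x, hx, hmin⟩ := hh.exists_min hcont
  refine ⟨x, hx, fun u hu => ?_⟩
  set y := pos (theta P β z x) with hy
  have hψ := hR.smoothStrong_smoothPhi hβ z (y := y) (pos_nonneg _)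
  have hfo := hh.first_order (φ := fun x => P.f x + β * (‖pos (theta P β z x)‖ ^ 2 / 2))
    (x := x) (u := u) (a := inner ℝ (gradient (smoothPhi P β z y) x) (u - x))
    (b := (Lf + β * ‖y‖ * Lg) / 2 * ‖u - x‖ ^ 2 + β / 2 * (boundJ P * ‖u - x‖) ^ 2)
    hx hu hmin (fun t ht ht1 => by
      have h1 := hψ.upper x (x + t • (u - x))
      have h2 := norm_pos_sq_le (theta P β z (x + t • (u - x))) (theta P β z x)
      have h3 := (hR.norm_g_sub_le (hh.line hx hu ht.le ht1).1 hx)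
      rw [add_sub_cancel_left, norm_smul, Real.norm_of_nonneg ht.le] at h1 h3
      rw [inner_smul_right] at h1
      rw [theta_sub_theta, ← theta_sub_theta P β z, inner_sub_right, theta_sub_theta, ← hy] at h2
      have h4 := pow_le_pow_left₀ (norm_nonneg _) h3 2
      have h5 := mul_le_mul_of_nonneg_left h2 hβ.le
      have h6 := mul_le_mul_of_nonneg_left h4 hβ.le
      simp only [smoothPhi] at h1
      show P.f (x + t • (u - x)) + β * (‖pos (theta P β z (x + t • (u - x)))‖ ^ 2 / 2) ≤
        P.f x + β * (‖pos (theta P β z x)‖ ^ 2 / 2) + _ + _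
      rw [← hy]
      linarith)
  have hlow := hψ.lower x u
  have : 0 ≤ μ / 2 * ‖u - x‖ ^ 2 := mul_nonneg (half_pos hR.μ_pos).le (sq_nonneg _)
  linarith

/-- The minimizer of `Φ(·, y)` depends on `y` in a Lipschitz way. -/
theorem Regular.argmin_lipschitz (hR : Regular P Lf Lg μ) (hβ : 0 < β) (hy : ∀ i, 0 ≤ y i)
    (hy' : ∀ i, 0 ≤ y' i) {x x' : Vec n} (hx : IsArgmin (smoothPhi P β z y) P.h x)
    (hx' : IsArgmin (smoothPhi P β z y') P.h x') :
    μ * ‖x - x'‖ ≤ β * boundJ P * ‖y - y'‖ := by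
  have hh := hR.closedConvex ⟨x, hx.1⟩
  have h1 := hx.lower hh (hR.smoothStrong_smoothPhi hβ z hy) hx'.1
  have h2 := hx'.lower hh (hR.smoothStrong_smoothPhi hβ z hy') hx.1
  rw [smoothPhi_expand P β z y' y x, smoothPhi_expand P β z y' y x'] at h1
  rw [norm_sub_rev x' x] at h1
  have h3 : inner ℝ (theta P β z x' - y') (y - y') - inner ℝ (theta P β z x - y') (y - y') =
      inner ℝ (P.g x' - P.g x) (y - y') := by
    rw [← inner_sub_left, sub_sub_sub_cancel_right, theta_sub_theta]
  have h4 := real_inner_le_norm (P.g x' - P.g x) (y - y')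
  have h5 := mul_le_mul_of_nonneg_right (hR.norm_g_sub_le hx'.1 hx.1) (norm_nonneg (y - y'))
  rw [norm_sub_rev x' x] at h5
  have h6 : μ * ‖x - x'‖ ^ 2 ≤ β * (boundJ P * ‖x - x'‖ * ‖y - y'‖) := by
    have := mul_le_mul_of_nonneg_left (h4.trans h5) hβ.le
    rw [← h3] at this
    linarith
  rcases (norm_nonneg (x - x')).eq_or_lt with h0 | h0
  · rw [← h0, mul_zero]
    have := hR.boundJ_nonneg hx.1
    positivity
  · refine le_of_mul_le_mul_right ?_ h0
    linarith

end

/-! ### Accuracy of the cuts -/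

section

variable {n m : ℕ} {P : Problem n m} {Lf Lg μ β b δ : ℝ} {z y y' : Vec m}

theorem Regular.gradient_dualFun_le (hR : Regular P Lf Lg μ) (hβ : 0 < β)
    (hy : y ∈ orthantBall m b) {x : Vec n} (hx : IsArgmin (smoothPhi P β z y) P.h x) :
    ‖gradient (dualFun P β z) y‖ ≤ β * (boundG P + b) + ‖z‖ := by
  rw [(hR.hasGradientAt_dualFun hβ hy.1 hx).gradient, norm_smul, Real.norm_of_nonneg hβ.le]
  have h1 : ‖theta P β z x - y‖ ≤ boundG P + β⁻¹ * ‖z‖ + b := by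
    refine (norm_sub_le _ _).trans (add_le_add ((norm_add_le _ _).trans ?_) hy.2)
    rw [norm_smul, Real.norm_of_nonneg (inv_pos.2 hβ).le]
    exact add_le_add (hR.norm_g_le hx.1) le_rfl
  refine (mul_le_mul_of_nonneg_left h1 hβ.le).trans (le_of_eq ?_)
  field_simp
  ring

theorem Regular.boundDualGrad_le (hR : Regular P Lf Lg μ) (hne : (dom P.h).Nonempty) (hβ : 0 < β)
    (hb : 0 ≤ b) (z : Vec m) : boundDualGrad P β z b ≤ β * (boundG P + b) + ‖z‖ := by
  refine csSup_le ⟨_, 0, ⟨fun _ => le_rfl, by simpa using hb⟩, rfl⟩ ?_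
  rintro _ ⟨y, hy, rfl⟩
  obtain ⟨x, hx⟩ := hR.exists_argmin hne β z y
  exact hR.gradient_dualFun_le hβ hy hx

theorem Regular.le_boundDualGrad (hR : Regular P Lf Lg μ) (hβ : 0 < β)
    (hy : y ∈ orthantBall m b) {x : Vec n} (hx : IsArgmin (smoothPhi P β z y) P.h x) :
    β * ‖theta P β z x - y‖ ≤ boundDualGrad P β z b := by
  have h : ‖gradient (dualFun P β z) y‖ = β * ‖theta P β z x - y‖ := by
    rw [(hR.hasGradientAt_dualFun hβ hy.1 hx).gradient, norm_smul, Real.norm_of_nonneg hβ.le]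
  rw [← h]
  refine le_csSup ⟨β * (boundG P + b) + ‖z‖, ?_⟩ ⟨y, hy, rfl⟩
  rintro _ ⟨y', hy', rfl⟩
  obtain ⟨x', hx'⟩ := hR.exists_argmin ⟨x, hx.1⟩ β z y'
  exact hR.gradient_dualFun_le hβ hy' hx'

theorem Regular.boundDualGrad_nonneg (hR : Regular P Lf Lg μ) (hne : (dom P.h).Nonempty)
    (hβ : 0 < β) (hb : 0 ≤ b) (z : Vec m) : 0 ≤ boundDualGrad P β z b := by
  obtain ⟨x, hx⟩ := hR.exists_argmin hne β z 0
  have := hR.le_boundDualGrad hβ (b := b) (y := 0) ⟨fun _ => le_rfl, by simpa using hb⟩ hx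
  exact le_trans (by positivity) this

/-- The equation `κ (η + √(2 η B / β)) = δ / 4` has exactly one positive root. -/
theorem exists_root_eta {κ B : ℝ} (hκ : 0 < κ) (hB : 0 ≤ B) (hβ : 0 < β) (hδ : 0 < δ) :
    ∃ e : ℝ, {η : ℝ | 0 < η ∧ κ * (η + √(2 * η * B / β)) = δ / 4} = {e} ∧ 0 < e ∧
      κ * (e + √(2 * e * B / β)) = δ / 4 := by
  set F : ℝ → ℝ := fun η => κ * (η + √(2 * η * B / β)) with hF
  have hcont : Continuous F := by fun_prop
  have hmono : StrictMono F := fun a c hac => by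
    refine mul_lt_mul_of_pos_left (add_lt_add_of_lt_of_le hac (Real.sqrt_le_sqrt ?_)) hκ
    gcongr
  have h0 : F 0 = 0 := by simp [hF]
  have h1 : δ / 4 ≤ F (δ / (4 * κ)) := by
    have : κ * (δ / (4 * κ)) = δ / 4 := by field_simp
    simp only [hF, mul_add, this]
    have := mul_nonneg hκ.le (Real.sqrt_nonneg (2 * (δ / (4 * κ)) * B / β))
    linarith
  obtain ⟨e, he, hFe⟩ := intermediate_value_Icc (by positivity : (0 : ℝ) ≤ δ / (4 * κ))
    hcont.continuousOn (show δ / 4 ∈ Set.Icc (F 0) (F (δ / (4 * κ))) from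
      ⟨by rw [h0]; positivity, h1⟩)
  have he0 : 0 < e := by
    refine lt_of_le_of_ne he.1 fun h => ?_
    rw [← h, h0] at hFe
    linarith
  refine ⟨e, Set.eq_singleton_iff_unique_mem.2 ⟨⟨he0, hFe⟩, fun η hη => ?_⟩, he0, hFe⟩
  exact hmono.injective (hη.2.trans hFe.symm)

/-- The condition number `(μ + β B_g²) / μ` of the dual problem. -/
noncomputable def dualCond {n m : ℕ} (P : Problem n m) (μ β : ℝ) : ℝ :=
  (μ + β * boundJ P ^ 2) / μ

theorem Regular.one_le_dualCond (hR : Regular P Lf Lg μ) (hβ : 0 < β) : 1 ≤ dualCond P μ β := by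
  rw [dualCond, le_div_iff₀ hR.μ_pos]
  have : 0 ≤ β * boundJ P ^ 2 := by positivity
  linarith

theorem Regular.etaPlus_spec (hR : Regular P Lf Lg μ) (hne : (dom P.h).Nonempty) (hβ : 0 < β)
    (hδ : 0 < δ) (hb : 0 ≤ b) (z : Vec m) :
    0 < etaPlus P μ β z δ b ∧
      dualCond P μ β * (etaPlus P μ β z δ b +
        √(2 * etaPlus P μ β z δ b * boundDualGrad P β z b / β)) = δ / 4 := by
  obtain ⟨e, h1, h2, h3⟩ := exists_root_eta (B := boundDualGrad P β z b)
    (one_pos.trans_le (hR.one_le_dualCond hβ)) (hR.boundDualGrad_nonneg hne hβ hb z) hβ hδ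
  have : etaPlus P μ β z δ b = e := by
    rw [etaPlus]
    exact (congrArg sInf h1).trans (csInf_singleton e)
  rw [this]
  exact ⟨h2, h3⟩

theorem Regular.inv_etaPlus_le (hR : Regular P Lf Lg μ) (hne : (dom P.h).Nonempty) (hβ : 0 < β)
    (hδ : 0 < δ) (hb : 0 ≤ b) (z : Vec m) :
    (etaPlus P μ β z δ b)⁻¹ ≤ 8 * dualCond P μ β / δ +
      128 * dualCond P μ β ^ 2 * boundDualGrad P β z b / (β * δ ^ 2) := by
  obtain ⟨h1, h2⟩ := hR.etaPlus_spec hne hβ hδ hb z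
  have hB := hR.boundDualGrad_nonneg hne hβ hb z
  have hκ := one_pos.trans_le (hR.one_le_dualCond hβ)
  set e := etaPlus P μ β z δ b
  set B := boundDualGrad P β z b
  set κ := dualCond P μ β
  have hA : 0 ≤ 8 * κ / δ := by positivity
  have hC : 0 ≤ 128 * κ ^ 2 * B / (β * δ ^ 2) := by positivity
  -- one of the two terms of the equation is at least half of the right-hand side
  rcases le_total (δ / 8) (κ * e) with h | h
  · have : e⁻¹ ≤ 8 * κ / δ := by
      rw [inv_le_iff_one_le_mul₀ h1, div_mul_eq_mul_div, le_div_iff₀ hδ]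
      linarith
    linarith
  · have h3 : δ / 8 ≤ κ * √(2 * e * B / β) := by linarith
    have h4 : (δ / 8) ^ 2 ≤ κ ^ 2 * (2 * e * B / β) := by
      have := pow_le_pow_left₀ (by positivity) h3 2
      rwa [mul_pow, Real.sq_sqrt (by positivity)] at this
    have : e⁻¹ ≤ 128 * κ ^ 2 * B / (β * δ ^ 2) := by
      rw [inv_le_iff_one_le_mul₀ h1, div_mul_eq_mul_div, le_div_iff₀ (by positivity)]
      have h5 : κ ^ 2 * (2 * e * B / β) * (64 * β) = 128 * κ ^ 2 * B * e := by
        field_simp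
        ring
      have h6 := mul_le_mul_of_nonneg_right h4 (show 0 ≤ 64 * β by positivity)
      linarith
    linarith

/-- The tolerance of the inner solver in the ellipsoid method. -/
noncomputable def ellTol {n m : ℕ} (P : Problem n m) (μ β δ : ℝ) : ℝ :=
  min (μ * δ / (4 * boundJ P)) (μ ^ 2 * δ / (8 * boundJ P * (μ + β * boundJ P ^ 2)))

theorem Regular.ellTol_pos (hR : Regular P Lf Lg μ) (hJ : 0 < boundJ P) (hβ : 0 < β)
    (hδ : 0 < δ) : 0 < ellTol P μ β δ := by
  have := hR.μ_pos
  exact lt_min (by positivity) (by positivity)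

/-- With this tolerance the constraint values are accurate to `δ / 4` and to `δ / (8 κ)`. -/
theorem Regular.theta_error (hR : Regular P Lf Lg μ) (hJ : 0 < boundJ P) (hβ : 0 < β)
    (hy : ∀ i, 0 ≤ y i) {x w : Vec n} (hx : IsArgmin (smoothPhi P β z y) P.h x)
    (hw : NearStationary (smoothPhi P β z y) P.h w (ellTol P μ β δ)) :
    ‖theta P β z w - theta P β z x‖ ≤ δ / 4 ∧
      ‖theta P β z w - theta P β z x‖ ≤ δ / (8 * dualCond P μ β) := by
  have hμ := hR.μ_pos
  have hh := hR.closedConvex ⟨x, hx.1⟩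
  have hwd : w ∈ dom P.h := by
    obtain ⟨v, hv, -⟩ := hw
    exact hv.1
  have h1 := (hR.smoothStrong_smoothPhi hβ z hy).dist_argmin_le hh hx hw
  have h2 := hR.norm_g_sub_le hwd hx.1
  rw [theta_sub_theta]
  have h3 : ‖P.g w - P.g x‖ ≤ boundJ P * (ellTol P μ β δ / μ) :=
    h2.trans (mul_le_mul_of_nonneg_left h1 hJ.le)
  have hpos : 0 < μ + β * boundJ P ^ 2 := by positivity
  constructor
  · refine h3.trans ?_
    calc boundJ P * (ellTol P μ β δ / μ) ≤ boundJ P * (μ * δ / (4 * boundJ P) / μ) := by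
          gcongr
          exact min_le_left _ _
      _ = δ / 4 := by field_simp
  · refine h3.trans ?_
    calc boundJ P * (ellTol P μ β δ / μ)
        ≤ boundJ P * (μ ^ 2 * δ / (8 * boundJ P * (μ + β * boundJ P ^ 2)) / μ) := by
          gcongr
          exact min_le_right _ _
      _ = δ / (8 * dualCond P μ β) := by
          rw [dualCond]
          field_simp

/-- The residual of the fixed point equation `y = [θ(x(y))]₊` bounds the distance to the saddle
point from below. -/
theorem Regular.residual_le (hR : Regular P Lf Lg μ) (hβ : 0 < β) (hy : ∀ i, 0 ≤ y i)
    {x xb : Vec n} (hx : IsArgmin (smoothPhi P β z y) P.h x)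
    (hxb : IsArgmin (smoothPhi P β z (pos (theta P β z xb))) P.h xb) :
    ‖pos (theta P β z x) - y‖ ≤ dualCond P μ β * ‖y - pos (theta P β z xb)‖ := by
  have hμ := hR.μ_pos
  have h1 := hR.argmin_lipschitz hβ hy (pos_nonneg _) hx hxb
  have h2 := norm_pos_sub_pos_le (theta P β z x) (theta P β z xb)
  rw [theta_sub_theta] at h2
  have h3 := hR.norm_g_sub_le hx.1 hxb.1
  have h4 := norm_sub_le_norm_sub_add_norm_sub (pos (theta P β z x)) (pos (theta P β z xb)) y
  rw [norm_sub_rev (pos (theta P β z xb)) y] at h4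
  have h5 : dualCond P μ β * ‖y - pos (theta P β z xb)‖ =
      boundJ P * (β * boundJ P * ‖y - pos (theta P β z xb)‖ / μ) +
        ‖y - pos (theta P β z xb)‖ := by
    rw [dualCond]
    field_simp
    ring
  have h6 : ‖x - xb‖ ≤ β * boundJ P * ‖y - pos (theta P β z xb)‖ / μ := by
    rw [le_div_iff₀ hμ]
    linarith
  have h7 := mul_le_mul_of_nonneg_left h6 (hR.boundJ_nonneg hx.1)
  rw [h5]
  linarith

/-- The key property of the cuts: if the stopping test fails at `y`, then the cut does not remove
any feasible point in the ball of radius `η₊` around the dual solution. -/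
theorem Regular.cut_keeps (hR : Regular P Lf Lg μ) (hJ : 0 < boundJ P) (hβ : 0 < β) (hδ : 0 < δ)
    {xb w : Vec n} (hxb : IsArgmin (smoothPhi P β z (pos (theta P β z xb))) P.h xb)
    (hy : y ∈ orthantBall m b)
    (hw : NearStationary (smoothPhi P β z y) P.h w (ellTol P μ β δ))
    (hfail : ¬ ‖pos (theta P β z w) - y‖ ≤ 3 * δ / 4)
    (hy' : y' ∈ orthantBall m b)
    (hy'η : ‖y' - pos (theta P β z xb)‖ ≤ etaPlus P μ β z δ b) :
    inner ℝ (y - theta P β z w) (y' - y) ≤ 0 := by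
  have hμ := hR.μ_pos
  have hne : (dom P.h).Nonempty := ⟨xb, hxb.1⟩
  have hb : 0 ≤ b := (norm_nonneg y).trans hy.2
  obtain ⟨hη0, hη⟩ := hR.etaPlus_spec hne hβ hδ hb z
  have hκ := one_pos.trans_le (hR.one_le_dualCond hβ)
  have hBd := hR.boundDualGrad_nonneg hne hβ hb z
  obtain ⟨x, hx⟩ := hR.exists_argmin hne β z y
  obtain ⟨x', hx'⟩ := hR.exists_argmin hne β z y'
  obtain ⟨he1, he2⟩ := hR.theta_error hJ hβ hy.1 hx hw
  set κ := dualCond P μ β with hκdef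
  set η := etaPlus P μ β z δ b
  set yb := pos (theta P β z xb) with hyb
  set Bd := boundDualGrad P β z b
  set s := √(2 * η * Bd / β) with hs
  have hs0 : 0 ≤ s := Real.sqrt_nonneg _
  have hs2 : β / 2 * s ^ 2 = Bd * η := by
    rw [hs, Real.sq_sqrt (by positivity)]
    field_simp
  -- the center is far from the dual solution
  have hfar : δ / (2 * κ) < ‖y - yb‖ := by
    have h1 := norm_sub_le_norm_sub_add_norm_sub (pos (theta P β z w)) (pos (theta P β z x)) y
    have h2 := (norm_pos_sub_pos_le (theta P β z w) (theta P β z x)).trans he1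
    have h3 := hR.residual_le hβ hy.1 hx hxb
    rw [div_lt_iff₀ (by positivity)]
    rw [← hκdef, ← hyb] at h3
    linarith [not_le.1 hfail]
  have hηs : η + s = δ / (4 * κ) := by
    rw [eq_div_iff (by positivity)]
    linarith
  have h2κ : δ / (2 * κ) = 2 * (δ / (4 * κ)) := by
    field_simp
    ring
  have h8κ : δ / (8 * κ) = δ / (4 * κ) / 2 := by
    field_simp
    ring
  have hr : δ / (4 * κ) ≤ ‖y' - y‖ := by
    have h1 := norm_sub_le_norm_sub_add_norm_sub y y' yb
    rw [norm_sub_rev y y'] at h1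
    linarith
  by_contra! hneg
  -- the inexact gradient is negative at `y'`, so the exact one is not much larger than zero
  have hcut : inner ℝ (theta P β z x - y) (y' - y) ≤ ‖y' - y‖ / 2 * ‖y' - y‖ := by
    have h1 : theta P β z x - y =
      -(y - theta P β z w) - (theta P β z w - theta P β z x) := by abel
    rw [h1, inner_sub_left, inner_neg_left]
    have h2 := abs_le.1 (abs_real_inner_le_norm (theta P β z w - theta P β z x) (y' - y))
    have h3 := mul_le_mul_of_nonneg_right (he2.trans (by linarith : _ ≤ ‖y' - y‖ / 2))
      (norm_nonneg (y' - y))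
    linarith [h2.1]
  -- compare the dual values at `y'`, at `y` and at the dual solution
  have hd1 := hR.dualFun_le β z y' hx.1
  rw [smoothPhi_expand P β z y y' x] at hd1
  have hd2 := hR.dualFun_le β z y hxb.1
  rw [smoothPhi_expand P β z yb y xb] at hd2
  have hd3 := hR.dualFun_le β z yb hx'.1
  rw [smoothPhi_expand P β z y' yb x'] at hd3
  have hdy := dualFun_eq hx
  have hdy' := dualFun_eq hx'
  have hdyb := dualFun_eq hxb
  have hproj : inner ℝ (theta P β z xb - yb) (y - yb) ≤ 0 := by
    have := inner_pos_sub_le (theta P β z xb) hy.1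
    rw [← hyb] at this
    rw [real_inner_comm, ← neg_sub yb y, ← neg_sub yb (theta P β z xb), inner_neg_neg]
    exact this
  have hgrad : β * inner ℝ (theta P β z x' - y') (yb - y') ≤ Bd * η := by
    have h1 := hR.le_boundDualGrad hβ hy' hx'
    have h2 := real_inner_le_norm (theta P β z x' - y') (yb - y')
    rw [norm_sub_rev yb y'] at h2
    calc β * inner ℝ (theta P β z x' - y') (yb - y')
        ≤ β * (‖theta P β z x' - y'‖ * ‖y' - yb‖) := mul_le_mul_of_nonneg_left h2 hβ.le
      _ = β * ‖theta P β z x' - y'‖ * ‖y' - yb‖ := by ring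
      _ ≤ Bd * η := mul_le_mul h1 hy'η (norm_nonneg _) hBd
  have hproj' := mul_nonpos_of_nonneg_of_nonpos hβ.le hproj
  have hcut' := mul_le_mul_of_nonneg_left hcut hβ.le
  have hq : 0 ≤ β / 2 * ‖yb - y'‖ ^ 2 := by positivity
  have hfin : β / 2 * ‖y - yb‖ ^ 2 ≤ β / 2 * s ^ 2 := by
    rw [hs2]
    linarith
  have hle : ‖y - yb‖ ^ 2 ≤ s ^ 2 := le_of_mul_le_mul_left hfin (half_pos hβ)
  have := abs_le_of_sq_le_sq' hle hs0
  linarith [this.2, div_pos hδ (show 0 < 4 * κ by positivity)]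

end

/-! ### The ellipsoid method -/

theorem SmoothStrong.mono {n : ℕ} {ψ : Vec n → ℝ} {L L' μ : ℝ} (hψ : SmoothStrong ψ L μ)
    (h : L ≤ L') : SmoothStrong ψ L' μ where
  diff := hψ.diff
  lip x y := (hψ.lip x y).trans (mul_le_mul_of_nonneg_right h (norm_nonneg _))
  upper x u := (hψ.upper x u).trans (by gcongr)
  lower := hψ.lower
  μ_pos := hψ.μ_pos

theorem posDef_smul_one {m : ℕ} {b : ℝ} (hb : 0 < b) :
    ((b ^ 2) • (1 : Matrix (Fin m) (Fin m) ℝ)).PosDef :=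
  Matrix.PosDef.one.smul (by positivity)

theorem orthantBall_subset_ellSet {m : ℕ} {b : ℝ} (hb : 0 < b) :
    orthantBall m b ⊆ ellSet ((b ^ 2) • (1 : Matrix (Fin m) (Fin m) ℝ)) 0 := by
  intro y hy
  have h1 : ((b ^ 2) • (1 : Matrix (Fin m) (Fin m) ℝ))⁻¹ = (b ^ 2)⁻¹ • 1 := by
    refine Matrix.inv_eq_right_inv ?_
    rw [Matrix.smul_mul, Matrix.one_mul, smul_smul, mul_inv_cancel₀ (by positivity), one_smul]
  have h2 : y.ofLp ⬝ᵥ y.ofLp = ‖y‖ ^ 2 := by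
    rw [EuclideanSpace.real_norm_sq_eq]
    simp [dotProduct, sq]
  rw [ellSet, Set.mem_ofPred_eq, sub_zero, h1, Matrix.smul_mulVec, Matrix.one_mulVec,
    dotProduct_smul, h2, smul_eq_mul, inv_mul_le_one₀ (by positivity)]
  exact pow_le_pow_left₀ (norm_nonneg _) hy.2 2

/-- The radius `η` of the volume test of the ellipsoid method. -/
noncomputable def ellEta {n m : ℕ} (P : Problem n m) (μ β : ℝ) (z : Vec m) (δ b : ℝ) : ℝ :=
  min b (etaPlus P μ β z δ b)

/-- A bound for the number of cuts of the ellipsoid method. -/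
noncomputable def ellSteps (m : ℕ) (b η : ℝ) : ℝ := 2 * m * (m + 1) * Real.log (4 * b / η)

/-- The pair returned by a successful run of the ellipsoid method with radius `b` is an approximate
saddle point. -/
structure IsEllOutput {n m : ℕ} (P : Problem n m) (μ β : ℝ) (z : Vec m) (δ b : ℝ)
    (r : Vec n × Vec m) : Prop where
  mem : r.2 ∈ orthantBall m b
  stat : NearStationary (smoothPhi P β z r.2) P.h r.1 (ellTol P μ β δ)
  residual : ‖pos (theta P β z r.1) - r.2‖ ≤ 3 * δ / 4

/-- Some saddle point `(x, y)` of `Φ`, described as in `Regular.exists_saddle`, has `‖y‖ ≤ b`. -/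
def SaddleIn {n m : ℕ} (P : Problem n m) (β : ℝ) (z : Vec m) (b : ℝ) : Prop :=
  ∃ x, IsArgmin (smoothPhi P β z (pos (theta P β z x))) P.h x ∧ ‖pos (theta P β z x)‖ ≤ b

/-- The ellipsoid method terminates, and it is successful if its search radius is large enough. -/
theorem Regular.ellipsoid_spec {n m : ℕ} {P : Problem n m} {Lf Lg μ β b δ γ₁ γ₂ Lmin : ℝ}
    {z : Vec m} (hR : Regular P Lf Lg μ) (hn : 0 < n) (hm : 1 < m) (hne : (dom P.h).Nonempty)
    (hJ : 0 < boundJ P) (hβ : 0 < β) (hδ : 0 < δ) (hb : 0 < b) (hγ₁ : 1 < γ₁) (hγ₂ : 1 ≤ γ₂)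
    (hLmin : 0 < Lmin) {start : ℕ → Vec n} (hstart : ∀ k, start k ∈ dom P.h)
    {idx : ℕ → Vec m → Fin m} (hidx : ∀ (k : ℕ) (y : Vec m) (l : Fin m), y (idx k y) ≤ y l) :
    Spec (ellipsoid P ⟨μ, Lmin, γ₁, γ₂⟩ β z δ b start idx)
      ((ellSteps m b (ellEta P μ β z δ b) + 2) *
        (apgCost (Lf + β * b * Lg) μ Lmin γ₁ (diamDom P) (ellTol P μ β δ) + 1))
      fun r => match r with
        | some xy => IsEllOutput P μ β z δ b xy
        | none => ¬ SaddleIn P β z b := by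
  have hLg := hR.Lg_nonneg hn
  have hh := hR.closedConvex hne
  have hη0 : 0 < ellEta P μ β z δ b := lt_min hb (hR.etaPlus_spec hne hβ hδ hb.le z).1
  have hηb : ellEta P μ β z δ b ≤ b := min_le_left _ _
  set η := ellEta P μ β z δ b with hη
  set cA := apgCost (Lf + β * b * Lg) μ Lmin γ₁ (diamDom P) (ellTol P μ β δ) with hcA
  have htol := hR.ellTol_pos hJ hβ hδ
  have hapg : ∀ (y : Vec m) (k : ℕ), y ∈ orthantBall m b →
      Spec (apg (smoothPhi P β z y) P.h μ Lmin (ellTol P μ β δ) γ₁ γ₂ (start k)) cA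
        fun x => NearStationary (smoothPhi P β z y) P.h x (ellTol P μ β δ) := by
    intro y k hy
    refine apg_spec hh ((hR.smoothStrong_smoothPhi hβ z hy.1).mono ?_) hn hγ₁ hLmin htol hγ₂
      (fun x hx y hy => hR.norm_sub_le_diamDom hx hy) (hstart k)
    have := mul_le_mul_of_nonneg_right (mul_le_mul_of_nonneg_left hy.2 hβ.le) hLg
    linarith
  have hcA0 : 0 ≤ cA := (hapg 0 0 ⟨fun _ => le_rfl, by simpa using hb.le⟩).nonneg
  have hsteps : 0 ≤ ellSteps m b η := by
    have : 0 ≤ Real.log (4 * b / η) := Real.log_nonneg (by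
      rw [le_div_iff₀ hη0]
      linarith)
    unfold ellSteps
    positivity
  -- Invariant: the neighbourhood of a dual solution of norm at most `b` has never been cut.
  set I : ℕ → EllState m → Prop := fun k s => s.B.PosDef ∧
    s.B.det ≤ Real.exp (-(k / ((m : ℝ) + 1))) * b ^ (2 * m) ∧
    (∀ x, IsArgmin (smoothPhi P β z (pos (theta P β z x))) P.h x →
      ‖pos (theta P β z x)‖ ≤ b →
      orthantBall m b ∩ Metric.closedBall (pos (theta P β z x)) η ⊆ ellSet s.B s.y) ∧
    (k : ℝ) ≤ ellSteps m b η + 1 with hI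
  have hcut : ∀ (k : ℕ) (s : EllState m) (a : Vec m), I k s →
      ¬ volume (ellSet s.B s.y) ≤ (4 : ENNReal)⁻¹ ^ m *
        volume (Metric.closedBall (0 : Vec m) η) → a ≠ 0 →
      (∀ x, IsArgmin (smoothPhi P β z (pos (theta P β z x))) P.h x →
        ∀ y' ∈ orthantBall m b, ‖y' - pos (theta P β z x)‖ ≤ η → inner ℝ a (y' - s.y) ≤ 0) →
      I (k + 1) (s.cut a) := by
    rintro k s a ⟨h1, h2, h3, -⟩ hvol ha hkeep
    refine ⟨cut_posDef hm h1 ha, ?_, ?_, ?_⟩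
    · refine (det_cut_le hm h1 ha).trans ((mul_le_mul_of_nonneg_left h2
        (Real.exp_pos _).le).trans (le_of_eq ?_))
      rw [← mul_assoc, ← Real.exp_add]
      congr 2
      push_cast
      ring
    · rintro x hx hxb y' ⟨hy', hy'η⟩
      exact mem_ellSet_cut hm h1 ha (h3 x hx hxb ⟨hy', hy'η⟩)
        (hkeep x hx y' hy' (by rwa [← dist_eq_norm]))
    · have := cuts_le_of_volume hη0 hb h1 h2 hvol
      rw [← ellSteps] at this
      push_cast
      linarith
  unfold ellipsoid
  refine Spec.mono (spec_loop (I := I) (A := ellSteps m b η + 1) (c := cA + 1)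
    (fun k s h => h.2.2.2) ?_ ?_) (le_of_eq (by ring)) fun _ h => h
  · intro k s hs
    have hpure : ∀ (a : Option (Vec n × Vec m) ⊕ EllState m) (Q : _ → Prop), Q a →
        Spec (pure a : Prog _) (cA + 1) Q := fun a Q h =>
      (spec_pure h).mono (by linarith) fun _ h => h
    split_ifs with hvol hnn hbig
    · -- the ellipsoid is too small to contain such a neighbourhood
      refine hpure _ _ ?_
      rintro ⟨x, hx, hxb⟩
      have h1 := lt_volume_orthantBall_inter (by omega : 0 < m) hη0 hηb
        (y := pos (theta P β z x)) ⟨pos_nonneg _, hxb⟩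
      exact absurd (h1.trans_le (measure_mono (hs.2.2.1 x hx hxb))) (not_lt.2 hvol)
    · refine hpure _ _ (hcut k s _ hs hvol ?_ fun x _ y' hy' _ => ?_)
      · intro h
        rw [h, norm_zero] at hbig
        linarith
      · rw [inner_sub_right, real_inner_self_eq_norm_sq]
        have h1 := real_inner_le_norm s.y y'
        have h2 := mul_le_mul_of_nonneg_left (hy'.2.trans hbig.le) (norm_nonneg s.y)
        nlinarith
    · have hy : s.y ∈ orthantBall m b := ⟨hnn, not_lt.1 hbig⟩
      refine Spec.mono (Spec.bind (hapg s.y s.k hy) fun w hw =>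
        Spec.bind (c' := 0) spec_tick fun _ _ => ?_)
        (show cA + ((1 : ℕ) + 0) ≤ cA + 1 by simp) fun _ h => h
      split_ifs with hres
      · exact spec_pure ⟨hy, hw, hres⟩
      · refine spec_pure (hcut k s _ hs hvol ?_ fun x hx y' hy' hy'η => ?_)
        · intro h
          refine hres ?_
          rw [← sub_eq_zero.1 h]
          have : pos s.y = s.y := by
            ext i
            simp [pos_apply, hnn i]
          rw [this, sub_self, norm_zero]
          positivity
        · exact hR.cut_keeps hJ hβ hδ hx hy hw hres hy' (hy'η.trans (min_le_right _ _))
    · refine hpure _ _ (hcut k s _ hs hvol ?_ fun x _ y' hy' _ => ?_)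
      · rw [neg_ne_zero]
        intro h
        simpa using congrArg (fun v : Vec m => v (idx s.k s.y)) h
      · push Not at hnn
        obtain ⟨i, hi⟩ := hnn
        have h1 := (hidx s.k s.y i).trans_lt hi
        have h2 := hy'.1 (idx s.k s.y)
        rw [inner_neg_left, EuclideanSpace.inner_single_left]
        simp
        linarith
  · refine ⟨posDef_smul_one hb, le_of_eq ?_, fun x _ _ => ?_, ?_⟩
    · rw [Matrix.det_smul, Matrix.det_one, Fintype.card_fin, ← pow_mul]
      simp
    · exact Set.inter_subset_left.trans (orthantBall_subset_ellSet hb)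
    · push_cast
      linarith

theorem SaddleIn.mono {n m : ℕ} {P : Problem n m} {β b b' : ℝ} {z : Vec m}
    (h : SaddleIn P β z b) (hb : b ≤ b') : SaddleIn P β z b' := by
  obtain ⟨x, h1, h2⟩ := h
  exact ⟨x, h1, h2.trans hb⟩

theorem IsEllOutput.mono {n m : ℕ} {P : Problem n m} {μ β δ b b' : ℝ} {z : Vec m}
    {r : Vec n × Vec m} (h : IsEllOutput P μ β z δ b r) (hb : b ≤ b') :
    IsEllOutput P μ β z δ b' r :=
  ⟨⟨h.mem.1, h.mem.2.trans hb⟩, h.stat, h.residual⟩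

/-- A bound for the cost of the ellipsoid method with radius `b`. -/
noncomputable def ellCost {n m : ℕ} (P : Problem n m) (Lf Lg μ Lmin γ₁ β : ℝ) (z : Vec m)
    (δ b : ℝ) : ℝ :=
  (ellSteps m b (ellEta P μ β z δ b) + 2) *
    (apgCost (Lf + β * b * Lg) μ Lmin γ₁ (diamDom P) (ellTol P μ β δ) + 1)

/-- StEM is successful as soon as `β b ≥ R`, where `R` bounds the exact multiplier; so it makes
at most `2 + log₂ R` rounds, with radii between `1 / β` and `2 R / β`. -/
theorem Regular.stem_spec {n m : ℕ} {P : Problem n m} {Lf Lg μ β δ γ₁ γ₂ Lmin R c : ℝ}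
    {z : Vec m} (hR : Regular P Lf Lg μ) (hn : 0 < n) (hm : 1 < m) (hne : (dom P.h).Nonempty)
    (hJ : 0 < boundJ P) (hβ : 0 < β) (hδ : 0 < δ) (hγ₁ : 1 < γ₁) (hγ₂ : 1 ≤ γ₂)
    (hLmin : 0 < Lmin) (hR1 : 1 ≤ R) (hsaddle : SaddleIn P β z (R / β))
    (hc : ∀ b, 1 / β ≤ b → b ≤ 2 * R / β → ellCost P Lf Lg μ Lmin γ₁ β z δ b ≤ c)
    {start : ℕ → ℕ → Vec n} (hstart : ∀ j k, start j k ∈ dom P.h)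
    {idx : ℕ → ℕ → Vec m → Fin m} (hidx : ∀ j k (y : Vec m) l, y (idx j k y) ≤ y l) :
    Spec (stem P ⟨μ, Lmin, γ₁, γ₂⟩ β z δ start idx) ((2 + Real.log R / Real.log 2) * c)
      (IsEllOutput P μ β z δ (2 * R / β)) := by
  have hlog2 := Real.log_pos one_lt_two
  have hlogR := Real.log_nonneg hR1
  unfold stem
  refine Spec.mono (spec_loop (I := fun j (s : ℕ × ℝ) => s.2 = 2 ^ j / β ∧
    (0 < j → (2 : ℝ) ^ (j - 1) < R)) (A := 1 + Real.log R / Real.log 2) (c := c) ?_ ?_ ?_)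
    (le_of_eq (by ring)) fun _ h => h
  · rintro j s ⟨-, hj⟩
    rcases Nat.eq_zero_or_pos j with rfl | hj0
    · push_cast
      positivity
    · have h1 := Real.log_le_log (by positivity) (hj hj0).le
      rw [Real.log_pow, ← le_div_iff₀ hlog2, Nat.cast_sub hj0] at h1
      push_cast at h1
      linarith
  · rintro j ⟨i, b⟩ ⟨hb, hj⟩
    simp only at hb
    have h2j : (1 : ℝ) ≤ 2 ^ j := one_le_pow₀ one_le_two
    have hb1 : 1 / β ≤ b := by
      rw [hb]
      gcongr
    have hb2 : b ≤ 2 * R / β := by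
      rw [hb]
      gcongr
      rcases Nat.eq_zero_or_pos j with rfl | hj0
      · norm_num
        linarith
      · have h1 := (hj hj0).le
        obtain ⟨i, rfl⟩ : ∃ i, j = i + 1 := ⟨j - 1, by omega⟩
        rw [add_tsub_cancel_right] at h1
        rw [pow_succ]
        linarith
    have hb0 : 0 < b := lt_of_lt_of_le (by positivity) hb1
    refine Spec.mono (Spec.bind (c' := 0) (hR.ellipsoid_spec hn hm hne hJ hβ hδ hb0 hγ₁ hγ₂ hLmin
      (hstart i) (hidx i)) fun r hr => ?_)
      (show ellCost P Lf Lg μ Lmin γ₁ β z δ b + 0 ≤ c by linarith [hc b hb1 hb2]) fun _ h => h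
    match r, hr with
    | some xy, hr => exact spec_pure (hr.mono hb2)
    | none, hr =>
      refine spec_pure ⟨?_, fun _ => ?_⟩
      · show 2 * b = _
        rw [hb, pow_succ]
        ring
      · rw [add_tsub_cancel_right]
        by_contra! hle
        refine hr (hsaddle.mono ?_)
        rw [hb]
        gcongr
  · simp

/-! ### The augmented Lagrangian iteration -/

section

variable {n m : ℕ} {P : Problem n m} {Lf Lg μ β b δ : ℝ} {z y : Vec m}

theorem smul_pos_theta (hβ : 0 < β) (z : Vec m) (x : Vec n) :
    β • pos (theta P β z x) = pos (z + β • P.g x) := by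
  rw [← pos_smul hβ.le, theta, smul_add, smul_smul, mul_inv_cancel₀ hβ.ne', one_smul, add_comm]

/-- Near-stationarity for the multiplier `β y` carries over to the updated multiplier. -/
theorem Regular.nearStationary_update (hR : Regular P Lf Lg μ) (hβ : 0 < β) (hy : ∀ i, 0 ≤ y i)
    {x : Vec n} {τ ρ : ℝ} (hx : NearStationary (lagr P (β • y)) P.h x τ)
    (hρ : ‖pos (theta P β z x) - y‖ ≤ ρ) :
    NearStationary (lagr P (pos (z + β • P.g x))) P.h x (τ + boundJ P * (β * ρ)) := by
  obtain ⟨v, hv, hvτ⟩ := hx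
  have hw : ∀ i, 0 ≤ (β • y) i := fun i => mul_nonneg hβ.le (hy i)
  refine ⟨_, hR.subdiff_lagr hw (pos_nonneg _) hv, (norm_add_le _ _).trans (add_le_add hvτ ?_)⟩
  refine (hR.norm_adjoint_le hv.1 _).trans
    (mul_le_mul_of_nonneg_left ?_ (hR.boundJ_nonneg hv.1))
  rw [← smul_pos_theta hβ, ← smul_sub, norm_smul, Real.norm_of_nonneg hβ.le]
  exact mul_le_mul_of_nonneg_left hρ hβ.le

/-- The inexact proximal point inequality for the multipliers. -/
theorem Regular.multiplier_progress (hR : Regular P Lf Lg μ) (hβ : 0 < β) {xs x : Vec n}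
    {zs : Vec m} (hK : IsKKT P xs zs) {e : ℝ}
    (hx : NearStationary (lagr P (pos (z + β • P.g x))) P.h x e) :
    ‖pos (z + β • P.g x) - zs‖ ^ 2 + ‖pos (z + β • P.g x) - z‖ ^ 2 ≤
      ‖z - zs‖ ^ 2 + β * (e ^ 2 / (2 * μ)) := by
  have hμ := hR.μ_pos
  obtain ⟨v, hv, hve⟩ := hx
  have hK0 := hK.zero_mem hR
  obtain ⟨-, hzs, hgs, hcomp⟩ := hK
  have hh := hR.closedConvex ⟨x, hv.1⟩
  set z' := pos (z + β • P.g x) with hz'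
  have h1 := (hR.smoothStrong_lagr (pos_nonneg (z + β • P.g x))).subdiff_lower hh hv hK0.1
  have h2 := (hR.smoothStrong_lagr hzs).subdiff_lower hh hK0 hv.1
  rw [inner_zero_left] at h2
  rw [norm_sub_rev xs x, ← hz'] at h1
  simp only [lagr] at h1 h2
  have h3 : inner ℝ z' (P.g xs) ≤ 0 := by
    rw [PiLp.inner_apply]
    refine Finset.sum_nonpos fun i _ => ?_
    have := mul_nonpos_of_nonpos_of_nonneg (hgs i) (pos_nonneg (z + β • P.g x) i)
    simpa using this
  rw [real_inner_comm] at hcomp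
  have h4 := abs_le.1 (abs_real_inner_le_norm v (xs - x))
  rw [norm_sub_rev xs x] at h4
  have h5 := mul_le_mul_of_nonneg_right hve (norm_nonneg (x - xs))
  have h6 : inner ℝ (z' - zs) (P.g x) ≤ e ^ 2 / (4 * μ) := by
    have h7 : e * ‖x - xs‖ - μ * ‖x - xs‖ ^ 2 ≤ e ^ 2 / (4 * μ) := by
      have h8 : e ^ 2 / (4 * μ) - (e * ‖x - xs‖ - μ * ‖x - xs‖ ^ 2) =
          (e - 2 * μ * ‖x - xs‖) ^ 2 / (4 * μ) := by
        field_simp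
        ring
      have : 0 ≤ (e - 2 * μ * ‖x - xs‖) ^ 2 / (4 * μ) := by positivity
      linarith
    rw [inner_sub_left]
    linarith [h4.1]
  have h9 := inner_pos_sub_le (z + β • P.g x) hzs
  rw [← hz'] at h9
  have h10 : z' - (z + β • P.g x) = (z' - z) - β • P.g x := by abel
  rw [h10, inner_sub_right, inner_smul_right] at h9
  have h11 : z - zs = (z' - zs) - (z' - z) := by abel
  rw [h11, norm_sub_sq_real (z' - zs) (z' - z)]
  have h12 := mul_le_mul_of_nonneg_left h6 hβ.le
  have h13 : β * (e ^ 2 / (2 * μ)) = 2 * (β * (e ^ 2 / (4 * μ))) := by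
    field_simp
    ring
  linarith

/-- Multipliers of exact solutions of the subproblems are no further from `z*` than `z` is. -/
theorem Regular.saddleIn (hR : Regular P Lf Lg μ) (hβ : 0 < β) {xs : Vec n} {zs : Vec m}
    (hK : IsKKT P xs zs) (z : Vec m) : SaddleIn P β z ((‖zs‖ + ‖z - zs‖) / β) := by
  obtain ⟨x, hx⟩ := hR.exists_saddle ⟨xs, (hK.zero_mem hR).1⟩ hβ z
  refine ⟨x, hx, ?_⟩
  have h0 := hx.zero_mem
  rw [subdiff_smoothPhi P hβ.ne', smul_pos_theta hβ] at h0
  have h1 := hR.multiplier_progress hβ hK (e := 0) ⟨0, h0, by simp⟩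
  have h2 : ‖pos (z + β • P.g x) - zs‖ ≤ ‖z - zs‖ := by
    refine (abs_le_of_sq_le_sq' ?_ (norm_nonneg _)).2
    have := sq_nonneg ‖pos (z + β • P.g x) - z‖
    simp only [ne_eq, OfNat.ofNat_ne_zero, not_false_eq_true, zero_pow, zero_div, mul_zero,
      add_zero] at h1
    linarith
  rw [le_div_iff₀ hβ]
  have h3 : ‖pos (theta P β z x)‖ * β = ‖pos (z + β • P.g x)‖ := by
    rw [← smul_pos_theta hβ, norm_smul, Real.norm_of_nonneg hβ.le, mul_comm]
  rw [h3]
  linarith [norm_sub_norm_le (pos (z + β • P.g x)) zs]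

/-- The `ε`-KKT test succeeds once `β ε` is at least `max {1/4, 16 ‖z*‖²}`. -/
theorem isEpsKKTPair_of_large (hβ : 0 < β) {ε e : ℝ} (hε : 0 < ε) (heε : e ≤ ε) {x : Vec n}
    {zs : Vec m}
    (hx : NearStationary (lagr P (pos (z + β • P.g x))) P.h x e)
    (hprog : ‖pos (z + β • P.g x) - zs‖ ^ 2 + ‖pos (z + β • P.g x) - z‖ ^ 2 ≤
      ‖zs‖ ^ 2 + β * ε / 16)
    (h1 : 1 / 4 ≤ β * ε) (h2 : 16 * ‖zs‖ ^ 2 ≤ β * ε) :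
    IsEpsKKTPair P ε x (pos (z + β • P.g x)) := by
  set z' := pos (z + β • P.g x) with hz'
  obtain ⟨v, hv, hve⟩ := hx
  set s := √(β * ε) with hs
  have hs0 : 0 ≤ s := Real.sqrt_nonneg _
  have hs2 : s ^ 2 = β * ε := Real.sq_sqrt (by positivity)
  have hs1 : 1 / 2 ≤ s := by
    refine (abs_le_of_sq_le_sq' ?_ hs0).2
    rw [hs2]
    linarith
  have hzs : 4 * ‖zs‖ ≤ s := by
    refine (abs_le_of_sq_le_sq' ?_ hs0).2
    rw [hs2]
    linarith
  have hzn := norm_nonneg zs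
  have hd : ‖z' - z‖ ≤ s / 2 := by
    refine (abs_le_of_sq_le_sq' ?_ (by positivity)).2
    have := sq_nonneg ‖z' - zs‖
    nlinarith
  have hn : ‖z'‖ ≤ s := by
    have h3 : ‖z' - zs‖ ≤ s / 2 := by
      refine (abs_le_of_sq_le_sq' ?_ (by positivity)).2
      have := sq_nonneg ‖z' - z‖
      nlinarith
    linarith [norm_sub_norm_le z' zs]
  have hval : ∀ i, z' i = max (z i + β * P.g x i) 0 := fun i => by simp [hz', pos_apply]
  refine ⟨hv.1, pos_nonneg _, ⟨v, hv, hve.trans heε⟩, ?_, ?_⟩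
  · have h3 : ‖pos (P.g x)‖ ≤ ‖β⁻¹ • (z' - z)‖ := by
      rw [EuclideanSpace.norm_eq, EuclideanSpace.norm_eq]
      refine Real.sqrt_le_sqrt (Finset.sum_le_sum fun i _ => ?_)
      refine pow_le_pow_left₀ (norm_nonneg _) ?_ 2
      rw [pos_apply, Real.norm_of_nonneg (le_max_right _ _)]
      refine max_le (le_trans ?_ (le_abs_self _)) (abs_nonneg _)
      rw [PiLp.smul_apply, PiLp.sub_apply, smul_eq_mul, inv_mul_eq_div, le_div_iff₀ hβ, hval]
      linarith [le_max_left (z i + β * P.g x i) 0]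
    rw [norm_smul, Real.norm_of_nonneg (inv_pos.2 hβ).le, inv_mul_eq_div] at h3
    refine h3.trans ?_
    rw [div_le_iff₀ hβ]
    nlinarith
  · have h3 : ∀ i, |z' i * P.g x i| ≤ β⁻¹ * (|z' i| * |(z' - z) i|) := by
      intro i
      have : β * (z' i * P.g x i) = z' i * (z' - z) i := by
        rw [PiLp.sub_apply, hval]
        rcases le_total (z i + β * P.g x i) 0 with h | h
        · simp [h]
        · rw [max_eq_left h]
          ring
      rw [← abs_mul, ← this, abs_mul β, abs_of_pos hβ, inv_mul_cancel_left₀ hβ.ne']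
    have h4 : ∑ i, |z' i| * |(z' - z) i| ≤ ‖z'‖ * ‖z' - z‖ := by
      have := Real.sum_mul_le_sqrt_mul_sqrt Finset.univ (fun i => |z' i|) (fun i => |(z' - z) i|)
      simpa [EuclideanSpace.norm_eq] using this
    calc ∑ i, |z' i * P.g x i| ≤ ∑ i, β⁻¹ * (|z' i| * |(z' - z) i|) :=
          Finset.sum_le_sum fun i _ => h3 i
      _ = β⁻¹ * ∑ i, |z' i| * |(z' - z) i| := (Finset.mul_sum _ _ _).symm
      _ ≤ β⁻¹ * (s * (s / 2)) := by
          refine mul_le_mul_of_nonneg_left (h4.trans ?_) (inv_pos.2 hβ).le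
          exact mul_le_mul hn hd (norm_nonneg _) hs0
      _ ≤ ε := by
          rw [inv_mul_eq_div, div_le_iff₀ hβ]
          nlinarith

end

/-! ### The outer loop -/

section

variable {n m : ℕ} {P : Problem n m} {Lf Lg μ β b : ℝ} {z : Vec m}

/-- The output of StEM, with the given tolerance, is accurate enough whenever the condition for the
final correction is violated. -/
theorem Regular.nearStationary_of_ellOutput (hR : Regular P Lf Lg μ) (hJ : 0 < boundJ P)
    (hβ : 0 < β) {e : ℝ} (he : 0 < e) {r : Vec n × Vec m}
    (hr : IsEllOutput P μ β z (e / (3 * β * boundJ P)) b r)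
    (hcond : ¬ 1 < min (μ / (4 * β * boundJ P ^ 2))
      (μ ^ 2 / (8 * β * boundJ P ^ 2 * (μ + β * boundJ P ^ 2)))) :
    NearStationary (lagr P (pos (z + β • P.g r.1))) P.h r.1 e := by
  have hμ := hR.μ_pos
  have htol : ellTol P μ β (e / (3 * β * boundJ P)) ≤ e / 3 := by
    have h1 : ellTol P μ β (e / (3 * β * boundJ P)) = e / 3 * min (μ / (4 * β * boundJ P ^ 2))
        (μ ^ 2 / (8 * β * boundJ P ^ 2 * (μ + β * boundJ P ^ 2))) := by
      have hpos : 0 < μ + β * boundJ P ^ 2 := by positivity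
      rw [ellTol, mul_min_of_nonneg _ _ (by positivity)]
      congr 1 <;> field_simp
    rw [h1]
    exact mul_le_of_le_one_right (by positivity) (not_lt.1 hcond)
  have hx := hr.stat
  rw [NearStationary, subdiff_smoothPhi P hβ.ne'] at hx
  obtain ⟨v, hv, hve⟩ := hR.nearStationary_update hβ hr.mem.1 hx hr.residual
  refine ⟨v, hv, hve.trans ?_⟩
  have h2 : boundJ P * (β * (3 * (e / (3 * β * boundJ P)) / 4)) = e / 4 := by
    field_simp
  rw [h2]
  linarith

/-- After the final correction the point is accurate enough as well. -/
theorem Regular.nearStationary_of_correction (hR : Regular P Lf Lg μ) (hJ : 0 < boundJ P)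
    (hβ : 0 < β) {e : ℝ} (he : 0 < e) {r : Vec n × Vec m} {x : Vec n}
    (hr : IsEllOutput P μ β z (e / (3 * β * boundJ P)) b r)
    (hcond : 1 < min (μ / (4 * β * boundJ P ^ 2))
      (μ ^ 2 / (8 * β * boundJ P ^ 2 * (μ + β * boundJ P ^ 2))))
    (hx : NearStationary (lagr P (β • r.2)) P.h x (e / 3)) :
    NearStationary (lagr P (pos (z + β • P.g x))) P.h x e := by
  have hμ := hR.μ_pos
  have hxd : x ∈ dom P.h := by
    obtain ⟨v, hv, -⟩ := hx
    exact hv.1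
  have hh := hR.closedConvex ⟨x, hxd⟩
  obtain ⟨w, hw⟩ := hR.exists_argmin ⟨x, hxd⟩ β z r.2
  have hδ : 0 < e / (3 * β * boundJ P) := by positivity
  have h1 := (hR.theta_error hJ hβ hr.mem.1 hw hr.stat).1
  have hx' : NearStationary (smoothPhi P β z r.2) P.h x (e / 3) := by
    rwa [NearStationary, subdiff_smoothPhi P hβ.ne']
  have h2 := (hR.smoothStrong_smoothPhi hβ z hr.mem.1).dist_argmin_le hh hw hx'
  have h3 := hR.norm_g_sub_le hxd hw.1
  have h4 := norm_pos_sub_pos_le (theta P β z x) (theta P β z w)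
  have h5 := norm_pos_sub_pos_le (theta P β z r.1) (theta P β z w)
  rw [theta_sub_theta] at h4
  have h6 : ‖pos (theta P β z x) - r.2‖ ≤
      e / (3 * β * boundJ P) + boundJ P * (e / 3 / μ) := by
    have h7 : pos (theta P β z x) - r.2 = (pos (theta P β z x) - pos (theta P β z w)) -
        (pos (theta P β z r.1) - pos (theta P β z w)) + (pos (theta P β z r.1) - r.2) := by abel
    have h8 := mul_le_mul_of_nonneg_left h2 hJ.le
    have h9 := hr.residual
    rw [h7]
    refine (norm_add_le _ _).trans ?_
    linarith [norm_sub_le (pos (theta P β z x) - pos (theta P β z w))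
      (pos (theta P β z r.1) - pos (theta P β z w))]
  obtain ⟨v, hv, hve⟩ := hR.nearStationary_update hβ hr.mem.1 hx h6
  refine ⟨v, hv, hve.trans ?_⟩
  have h10 : β * boundJ P ^ 2 / μ ≤ 1 / 4 := by
    have h11 := hcond.trans_le (min_le_left _ _)
    rw [one_lt_div (by positivity)] at h11
    rw [div_le_div_iff₀ hμ (by norm_num)]
    linarith
  have h12 : boundJ P * (β * (e / (3 * β * boundJ P) + boundJ P * (e / 3 / μ))) =
      e / 3 + e / 3 * (β * boundJ P ^ 2 / μ) := by
    field_simp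
  rw [h12]
  have := mul_le_mul_of_nonneg_left h10 (show 0 ≤ e / 3 by positivity)
  linarith

end

theorem subTol_pos {μ σ ε : ℝ} (hμ : 0 < μ) (hσ : 1 < σ) (hε : 0 < ε) : 0 < subTol μ σ ε := by
  have : 0 < σ - 1 := by linarith
  exact lt_min hε (Real.sqrt_pos.2 (by positivity))

/-- The tolerances of the subproblems are chosen such that their accumulated effect on the
multipliers is negligible. -/
theorem subTol_sq_le {μ σ ε : ℝ} (hμ : 0 < μ) (hσ : 1 < σ) (hε : 0 < ε) :
    σ / (σ - 1) * (subTol μ σ ε ^ 2 / (2 * μ)) ≤ ε / 16 := by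
  have hσ1 : 0 < σ - 1 := by linarith
  have h1 : subTol μ σ ε ^ 2 ≤ ε * μ * (σ - 1) / (8 * σ + 1) := by
    refine (pow_le_pow_left₀ (subTol_pos hμ hσ hε).le (min_le_right _ _) 2).trans (le_of_eq ?_)
    exact Real.sq_sqrt (by positivity)
  calc σ / (σ - 1) * (subTol μ σ ε ^ 2 / (2 * μ))
      ≤ σ / (σ - 1) * (ε * μ * (σ - 1) / (8 * σ + 1) / (2 * μ)) := by gcongr
    _ = ε * (σ / (16 * σ + 2)) := by
        field_simp
        ring
    _ ≤ ε / 16 := by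
        have : σ / (16 * σ + 2) ≤ 1 / 16 := by
          rw [div_le_div_iff₀ (by positivity) (by norm_num)]
          linarith
        have := mul_le_mul_of_nonneg_left this hε.le
        linarith

/-- An upper bound for the penalty parameters that occur in the method. -/
noncomputable def betaMax {m : ℕ} (β₀ σ ε : ℝ) (zs : Vec m) : ℝ :=
  β₀ + 16 * σ * (1 + ‖zs‖) ^ 2 / ε

/-- The method terminates at an `ε`-KKT point, after at most
`2 + log⁺(16 (1 + ‖z*‖)²/(β₀ ε))/log σ` outer iterations; the costs of the inner solvers enter
through uniform bounds `c₁` and `c₂`. -/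
theorem Regular.ialm_spec {n m : ℕ} {P : Problem n m}
    {Lf Lg μ γ₁ γ₂ Lmin β₀ σ ε c₁ c₂ : ℝ} (hR : Regular P Lf Lg μ) (hn : 0 < n) (hm : 1 < m)
    {xs : Vec n} {zs : Vec m} (hK : IsKKT P xs zs) (hJ : 0 < boundJ P) (hβ₀ : 0 < β₀)
    (hσ : 1 < σ) (hε : 0 < ε) (hγ₁ : 1 < γ₁) (hγ₂ : 1 ≤ γ₂) (hLmin : 0 < Lmin)
    {c : Choices n m} (hc : c.Valid P)
    (hc₁ : ∀ (β b : ℝ) (z : Vec m), β₀ ≤ β → β ≤ betaMax β₀ σ ε zs → ‖z‖ ≤ 1 + 3 * ‖zs‖ →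
      1 / β ≤ b → b ≤ 2 * (1 + 3 * ‖zs‖) / β →
      ellCost P Lf Lg μ Lmin γ₁ β z (subTol μ σ ε / (3 * β * boundJ P)) b ≤ c₁)
    (hc₂ : apgCost (Lf + 2 * (1 + 3 * ‖zs‖) * Lg) μ Lmin γ₁ (diamDom P) (subTol μ σ ε / 3) ≤ c₂)
    (hc₂0 : 0 ≤ c₂) :
    Spec (ialm P ⟨μ, Lmin, γ₁, γ₂⟩ β₀ σ ε (fun _ => subTol μ σ ε) c)
      ((2 + Real.posLog (16 * (1 + ‖zs‖) ^ 2 / (β₀ * ε)) / Real.log σ) *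
        ((2 + Real.log (1 + 3 * ‖zs‖) / Real.log 2) * c₁ + c₂ + 4))
      fun r => IsEpsKKTPair P ε r.1 r.2 := by
  have hμ := hR.μ_pos
  have hLg := hR.Lg_nonneg hn
  have hne : (dom P.h).Nonempty := ⟨xs, (hK.zero_mem hR).1⟩
  have hh := hR.closedConvex hne
  have hlogσ := Real.log_pos hσ
  have he := subTol_pos hμ hσ hε
  have heε : subTol μ σ ε ≤ ε := min_le_left _ _
  have hsum := subTol_sq_le hμ hσ hε
  set e := subTol μ σ ε with hedef
  have hzn := norm_nonneg zs
  set Z := ‖zs‖ with hZ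
  have hσ1 : 0 < σ - 1 := by linarith
  set κ := e ^ 2 / (2 * μ) with hκ
  have hκ0 : 0 ≤ κ := by positivity
  unfold ialm
  -- Invariant: the squared distance of the multiplier to `z*` has grown by at most the accumulated
  -- errors `κ (β₀ + … + β_{k-1}) = κ (β_k - β₀)/(σ - 1)`, and as round `k - 1` did not end the
  -- loop, its penalty parameter is small.
  refine Spec.mono (spec_loop (I := fun k (s : ALMState m) => s.k = k ∧ s.β = β₀ * σ ^ k ∧
      ‖s.z - zs‖ ^ 2 ≤ Z ^ 2 + (s.β - β₀) / (σ - 1) * κ ∧ ‖s.z - zs‖ ≤ 1 + 2 * Z ∧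
      (0 < k → β₀ * σ ^ (k - 1) * ε < 16 * (1 + Z) ^ 2))
      (A := 1 + Real.posLog (16 * (1 + Z) ^ 2 / (β₀ * ε)) / Real.log σ)
      (c := (2 + Real.log (1 + 3 * Z) / Real.log 2) * c₁ + c₂ + 4) ?_ ?_ ?_)
    (le_of_eq (by ring)) fun _ h => h
  · rintro k s ⟨-, -, -, -, hk⟩
    rcases Nat.eq_zero_or_pos k with rfl | hk0
    · have := div_nonneg (Real.posLog_nonneg (x := 16 * (1 + Z) ^ 2 / (β₀ * ε))) hlogσ.le
      push_cast
      linarith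
    · have h1 : σ ^ (k - 1) ≤ 16 * (1 + Z) ^ 2 / (β₀ * ε) := by
        rw [le_div_iff₀ (by positivity)]
        linarith [hk hk0]
      have h2 := (Real.log_le_log (by positivity) h1).trans (le_max_right 0 _)
      rw [Real.log_pow, ← le_div_iff₀ hlogσ, Nat.cast_sub hk0] at h2
      push_cast at h2
      change (k : ℝ) - 1 ≤ Real.posLog _ / _ at h2
      linarith
  · rintro k s ⟨hsk, hsβ, hsz, hsz', hk⟩
    have hσk : 1 ≤ σ ^ k := one_le_pow₀ hσ.le
    have hββ : β₀ ≤ s.β := by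
      rw [hsβ]
      exact le_mul_of_one_le_right hβ₀.le hσk
    have hβ : 0 < s.β := hβ₀.trans_le hββ
    have hβmax : s.β ≤ betaMax β₀ σ ε zs := by
      have h0 : 0 ≤ 16 * σ * (1 + Z) ^ 2 / ε := by positivity
      rcases Nat.eq_zero_or_pos k with rfl | hk0
      · rw [betaMax, hsβ]
        simpa using h0
      · obtain ⟨i, rfl⟩ : ∃ i, k = i + 1 := ⟨k - 1, by omega⟩
        have h1 := hk hk0
        rw [add_tsub_cancel_right] at h1
        have h2 : s.β ≤ 16 * σ * (1 + Z) ^ 2 / ε := by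
          rw [le_div_iff₀ hε, hsβ, pow_succ]
          nlinarith
        rw [betaMax]
        linarith
    have hzR : ‖s.z‖ ≤ 1 + 3 * Z := by
      linarith [norm_sub_norm_le s.z zs]
    have hδ : 0 < e / (3 * s.β * boundJ P) := by positivity
    have hstem := hR.stem_spec (R := 1 + 3 * Z) (c := c₁) (γ₂ := γ₂) (z := s.z) hn hm hne hJ hβ hδ
      hγ₁ hγ₂ hLmin (by linarith)
      ((hR.saddleIn hβ hK s.z).mono (div_le_div_of_nonneg_right (by linarith) hβ.le))
      (fun b hb1 hb2 => hc₁ s.β b s.z hββ hβmax hzR hb1 hb2)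
      (start := c.start s.k) (idx := c.idx s.k) (fun j i => hc.start_mem s.k j i)
      (fun j i y l => hc.idx_min s.k j i y l)
    refine Spec.mono (Spec.bind hstem fun r hr => Spec.bind (c := c₂)
      (Q := fun x => NearStationary (lagr P (pos (s.z + s.β • P.g x))) P.h x e) ?_ fun x hx =>
      Spec.bind (c' := 0) spec_tick fun _ _ => ?_)
      (show (2 + Real.log (1 + 3 * Z) / Real.log 2) * c₁ + (c₂ + ((4 : ℕ) + 0)) ≤ _ by
        push_cast
        linarith) fun _ h => h
    · split_ifs with hcond
      · have hfun : (fun u => P.f u + s.β * inner ℝ r.2 (P.g u)) = lagr P (s.β • r.2) := by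
          ext u
          rw [lagr, inner_smul_left, conj_trivial]
        rw [hfun]
        have hw : ∀ i, 0 ≤ (s.β • r.2) i := fun i => mul_nonneg hβ.le (hr.mem.1 i)
        have hL : Lf + ‖s.β • r.2‖ * Lg ≤ Lf + 2 * (1 + 3 * Z) * Lg := by
          have h1 := mul_le_mul_of_nonneg_left hr.mem.2 hβ.le
          rw [mul_div_cancel₀ _ hβ.ne'] at h1
          rw [norm_smul, Real.norm_of_nonneg hβ.le]
          have := mul_le_mul_of_nonneg_right h1 hLg
          linarith
        exact (apg_spec hh ((hR.smoothStrong_lagr hw).mono hL) hn hγ₁ hLmin (by positivity) hγ₂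
          (fun x hx y hy => hR.norm_sub_le_diamDom hx hy) (hc.startFinal_mem s.k)).mono hc₂
          fun x hx => hR.nearStationary_of_correction hJ hβ he hr hcond hx
      · exact Spec.mono (spec_pure (Q := fun x =>
          NearStationary (lagr P (pos (s.z + s.β • P.g x))) P.h x e)
          (hR.nearStationary_of_ellOutput hJ hβ he hr hcond)) hc₂0 fun _ h => h
    · have hprog := hR.multiplier_progress hβ hK hx
      rw [← hκ] at hprog
      have hprog' : ‖pos (s.z + s.β • P.g x) - zs‖ ^ 2 + ‖pos (s.z + s.β • P.g x) - s.z‖ ^ 2 ≤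
          Z ^ 2 + (σ * s.β - β₀) / (σ - 1) * κ := by
        have h1 : (σ * s.β - β₀) / (σ - 1) * κ = (s.β - β₀) / (σ - 1) * κ + s.β * κ := by
          field_simp
          ring
        linarith
      have hprog'' : Z ^ 2 + (σ * s.β - β₀) / (σ - 1) * κ ≤ Z ^ 2 + s.β * ε / 16 := by
        have h1 : (σ * s.β - β₀) / (σ - 1) * κ ≤ s.β * (σ / (σ - 1) * κ) := by
          have h2 : s.β * (σ / (σ - 1) * κ) - (σ * s.β - β₀) / (σ - 1) * κ =
            β₀ / (σ - 1) * κ := by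
            field_simp
            ring
          have : 0 ≤ β₀ / (σ - 1) * κ := by positivity
          linarith
        have h2 := mul_le_mul_of_nonneg_left hsum hβ.le
        linarith
      split_ifs with htest
      · exact spec_pure htest
      · have hsmall : s.β * ε < 16 * (1 / 64 + Z ^ 2) := by
          by_contra! hle
          exact htest (isEpsKKTPair_of_large hβ hε heε hx (hprog'.trans hprog'')
            (by nlinarith) (by linarith))
        refine spec_pure ⟨congrArg (· + 1) hsk, ?_, ?_, ?_, fun _ => ?_⟩
        · show σ * s.β = _
          rw [hsβ, pow_succ]
          ring
        · linarith [sq_nonneg ‖pos (s.z + s.β • P.g x) - s.z‖]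
        · refine (abs_le_of_sq_le_sq' ?_ (by linarith)).2
          have := sq_nonneg ‖pos (s.z + s.β • P.g x) - s.z‖
          show ‖pos (s.z + s.β • P.g x) - zs‖ ^ 2 ≤ _
          nlinarith
        · rw [add_tsub_cancel_right, ← hsβ]
          nlinarith
  · refine ⟨rfl, by simp, ?_, ?_, fun h => absurd h (lt_irrefl _)⟩
    · simp [hZ]
    · simp
      linarith

/-! ### Sizes of the quantities in the complexity bound -/

/-- `x` is nonnegative and at most the `k`-th power of the scale `E`. -/
def PowLe (E x : ℝ) (k : ℕ) : Prop := 0 ≤ x ∧ x ≤ E ^ k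

section

variable {E x y : ℝ} {a b : ℕ}

theorem PowLe.mono (h : PowLe E x a) (hE : 2 ≤ E) (hab : a ≤ b) : PowLe E x b :=
  ⟨h.1, h.2.trans (pow_le_pow_right₀ (by linarith) hab)⟩

theorem PowLe.of_le (h : PowLe E y a) (hx : 0 ≤ x) (hxy : x ≤ y) : PowLe E x a :=
  ⟨hx, hxy.trans h.2⟩

theorem PowLe.mul (hx : PowLe E x a) (hy : PowLe E y b) : PowLe E (x * y) (a + b) :=
  ⟨mul_nonneg hx.1 hy.1, by
    rw [pow_add]
    exact mul_le_mul hx.2 hy.2 hy.1 (hx.1.trans hx.2)⟩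

theorem PowLe.pow (hx : PowLe E x a) (k : ℕ) : PowLe E (x ^ k) (a * k) :=
  ⟨pow_nonneg hx.1 k, by
    rw [pow_mul]
    exact pow_le_pow_left₀ hx.1 hx.2 k⟩

theorem PowLe.add (hx : PowLe E x a) (hE : 2 ≤ E) (hy : PowLe E y a) :
    PowLe E (x + y) (a + 1) :=
  ⟨add_nonneg hx.1 hy.1, by
    have h1 := hx.2
    have h2 := hy.2
    have h3 : 0 ≤ E ^ a := hx.1.trans hx.2
    rw [pow_succ]
    nlinarith⟩

theorem PowLe.max (hx : PowLe E x a) (hy : PowLe E y a) : PowLe E (max x y) a :=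
  ⟨hx.1.trans (le_max_left _ _), max_le hx.2 hy.2⟩

theorem PowLe.inv_min (hx : PowLe E x⁻¹ a) (hy : PowLe E y⁻¹ a) : PowLe E (min x y)⁻¹ a := by
  rcases min_choice x y with h | h <;> rw [h] <;> assumption

theorem PowLe.sqrt (hx : PowLe E x a) (hE : 2 ≤ E) : PowLe E √x a := by
  refine ⟨Real.sqrt_nonneg x, ?_⟩
  have h1 : 1 ≤ E ^ a := one_le_pow₀ (by linarith)
  rw [Real.sqrt_le_left (by linarith)]
  exact hx.2.trans (le_self_pow₀ h1 two_ne_zero)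

theorem powLe_of_le_two_pow (hE : 2 ≤ E) (hx : 0 ≤ x) (h : x ≤ 2 ^ a) : PowLe E x a :=
  ⟨hx, h.trans (pow_le_pow_left₀ two_pos.le hE a)⟩

theorem PowLe.log_le (hx : PowLe E x a) (hE : 2 ≤ E) : Real.log x ≤ a * Real.log E := by
  rcases hx.1.eq_or_lt with h | h
  · rw [← h, Real.log_zero]
    have := Real.log_nonneg (by linarith : 1 ≤ E)
    positivity
  · rw [← Real.log_pow]
    exact Real.log_le_log h hx.2

theorem PowLe.posLog_le (hx : PowLe E x a) (hE : 2 ≤ E) : Real.posLog x ≤ a * Real.log E := by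
  have := Real.log_nonneg (by linarith : 1 ≤ E)
  exact max_le (by positivity) (hx.log_le hE)

end

/-- The data of the problem, of the method and of the KKT pair are at most `E`, as are the
inverses of those that occur in denominators; numbers that depend on `σ` and `γ₁` only are at most
`E ^ s`. -/
structure Scale (E : ℝ) (s : ℕ) (σ γ₁ μ B β₀ Lmin ε Lf Lg Z G D : ℝ) : Prop where
  two_le : 2 ≤ E
  hσ : PowLe E σ s
  hσ' : PowLe E (σ - 1)⁻¹ s
  hγ₁ : PowLe E γ₁ s
  hμ : PowLe E μ 1
  hμ' : PowLe E μ⁻¹ 1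
  hB : PowLe E B 1
  hB' : PowLe E B⁻¹ 1
  hβ₀ : PowLe E β₀ 1
  hβ₀' : PowLe E β₀⁻¹ 1
  hLmin : PowLe E Lmin 1
  hLmin' : PowLe E Lmin⁻¹ 1
  hε : PowLe E ε 1
  hε' : PowLe E ε⁻¹ 1
  hLf : PowLe E Lf 1
  hLg : PowLe E Lg 1
  hZ : PowLe E (1 + Z) 1
  hG : PowLe E G 1
  hD : PowLe E D 1

section

variable {E : ℝ} {s : ℕ} {σ γ₁ μ B β₀ Lmin ε Lf Lg Z G D : ℝ}

theorem Scale.inv_subTol (h : Scale E s σ γ₁ μ B β₀ Lmin ε Lf Lg Z G D) :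
    PowLe E (subTol μ σ ε)⁻¹ (2 * s + 7) := by
  have hE := h.two_le
  refine PowLe.inv_min (h.hε'.mono hE (by omega)) ?_
  rw [← Real.sqrt_inv]
  refine PowLe.sqrt ?_ hE
  have h1 : (ε * μ * (σ - 1) / (8 * σ + 1))⁻¹ = (8 * σ + 1) * (ε⁻¹ * μ⁻¹ * (σ - 1)⁻¹) := by
    rw [inv_div, div_eq_mul_inv, mul_inv, mul_inv]
  have h8 : PowLe E 8 3 := powLe_of_le_two_pow hE (by norm_num) (by norm_num)
  have h0 : PowLe E 1 0 := powLe_of_le_two_pow hE (by norm_num) (by norm_num)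
  rw [h1]
  exact (((h8.mul h.hσ).add hE (h0.mono hE (by omega))).mul
    ((h.hε'.mul h.hμ').mul h.hσ')).mono hE (by omega)

/-- A bound for the cost of the accelerated method in terms of `L`, up to a constant. -/
theorem Scale.apgCost_le (h : Scale E s σ γ₁ μ B β₀ Lmin ε Lf Lg Z G D) (hγ : 1 < γ₁)
    (hμ : 0 < μ) (hLmin : 0 < Lmin) (hLg : 0 ≤ Lg) (hZ : 0 ≤ Z) (hμL : μ ≤ Lf)
    (hM : 1 ≤ Real.log E) {Lψ tol : ℝ} {t : ℕ} (hLψ0 : 0 < Lψ)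
    (hLψ : Lψ ≤ 6 * (Lf + Lg * (1 + Z))) (htol : PowLe E tol⁻¹ t) :
    apgCost Lψ μ Lmin γ₁ D tol ≤
      14 * (2 + 2 / Real.log γ₁) * (√(6 * γ₁) * (3 * s + 24 + 2 * t : ℕ) + 3) *
        ((√(max 1 (Lmin / (Lf + Lg * (1 + Z)))) * √((Lf + Lg * (1 + Z)) / μ) *
          (1 + Real.posLog ((Lf + Lg * (1 + Z)) / Lmin))) * Real.log E) := by
  have hE := h.two_le
  have hlogγ := Real.log_pos hγ
  set L := Lf + Lg * (1 + Z) with hL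
  have hLμ : μ ≤ L := by
    have : 0 ≤ Lg * (1 + Z) := by positivity
    linarith
  have hL0 : 0 < L := hμ.trans_le hLμ
  set M := Real.log E
  set Lmax := max Lmin (γ₁ * Lψ) with hLmax
  have hLmax0 : 0 < Lmax := hLmin.trans_le (le_max_left _ _)
  set k : ℕ := 3 * s + 24 + 2 * t with hk
  have hLsize : PowLe E L 3 :=
    (h.hLf.mono hE (by omega)).add hE (h.hLg.mul h.hZ)
  have hLψsize : PowLe E Lψ 6 :=
    ((powLe_of_le_two_pow hE (by norm_num) (by norm_num) : PowLe E 6 3).mul hLsize).of_le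
      hLψ0.le hLψ
  have hLmaxsize : PowLe E Lmax (s + 6) :=
    (h.hLmin.mono hE (by omega)).max (h.hγ₁.mul hLψsize)
  have hlog : Real.posLog (4 * Lmax ^ 2 * (Lmax + μ) * D ^ 2 / (Lmin * tol ^ 2)) ≤ k * M := by
    have h1 : 4 * Lmax ^ 2 * (Lmax + μ) * D ^ 2 / (Lmin * tol ^ 2) =
        4 * Lmax ^ 2 * (Lmax + μ) * D ^ 2 * (Lmin⁻¹ * tol⁻¹ ^ 2) := by
      rw [div_eq_mul_inv, mul_inv, inv_pow]
    have h4 : PowLe E 4 2 := powLe_of_le_two_pow hE (by norm_num) (by norm_num)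
    rw [h1]
    exact PowLe.posLog_le (((((h4.mul (hLmaxsize.pow 2)).mul
      (hLmaxsize.add hE (h.hμ.mono hE (by omega)))).mul (h.hD.pow 2)).mul
      (h.hLmin'.mul (htol.pow 2))).mono hE (by omega)) hE
  have hsqrt : √(Lmax / μ) ≤ √(6 * γ₁) * (√(max 1 (Lmin / L)) * √(L / μ)) := by
    rw [← Real.sqrt_mul (by positivity), ← Real.sqrt_mul (by positivity)]
    refine Real.sqrt_le_sqrt ?_
    have h1 : Lmax ≤ 6 * γ₁ * max L Lmin := by
      refine max_le ?_ ?_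
      · have h2 := le_max_right L Lmin
        have h3 : 1 ≤ 6 * γ₁ := by linarith
        nlinarith
      · have h2 := mul_le_mul_of_nonneg_left hLψ (by linarith : 0 ≤ γ₁)
        have h3 := mul_le_mul_of_nonneg_left (le_max_left L Lmin) (by linarith : 0 ≤ 6 * γ₁)
        linarith
    have h2 : max 1 (Lmin / L) * L = max L Lmin := by
      rw [max_mul_of_nonneg _ _ hL0.le, one_mul, div_mul_cancel₀ _ hL0.ne']
    have h3 : 6 * γ₁ * (max 1 (Lmin / L) * (L / μ)) = 6 * γ₁ * max L Lmin / μ := by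
      rw [← h2]
      ring
    rw [h3]
    gcongr
  have htrial : trialBound Lψ Lmin γ₁ ≤ (2 + 2 / Real.log γ₁) * (1 + Real.posLog (L / Lmin)) := by
    have h1 : Real.posLog (Lψ / Lmin) ≤ 2 + Real.posLog (L / Lmin) := by
      have h2 : Lψ / Lmin ≤ 6 * (L / Lmin) := by
        rw [← mul_div_assoc]
        gcongr
      have h3 : Real.posLog (Lψ / Lmin) ≤ Real.posLog (6 * (L / Lmin)) :=
        Real.posLog_le_posLog (by positivity) h2
      have h4 := Real.posLog_mul (x := 6) (y := L / Lmin)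
      have h5 : Real.posLog 6 ≤ 2 := by
        refine max_le (by norm_num) ?_
        rw [Real.log_le_iff_le_exp (by norm_num)]
        have := Real.exp_one_gt_d9
        have h6 : Real.exp 2 = Real.exp 1 * Real.exp 1 := by
          rw [← Real.exp_add]
          norm_num
        nlinarith
      linarith
    have h6 := Real.posLog_nonneg (x := L / Lmin)
    have h7 : Real.posLog (Lψ / Lmin) / Real.log γ₁ ≤
        2 / Real.log γ₁ * (1 + Real.posLog (L / Lmin)) := by
      rw [div_mul_eq_mul_div]
      exact div_le_div_of_nonneg_right (by linarith) hlogγ.le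
    rw [trialBound]
    linarith
  set X := √(max 1 (Lmin / L)) * √(L / μ) with hX
  have hX1 : 1 ≤ X := by
    have h1 : 1 ≤ √(max 1 (Lmin / L)) := Real.one_le_sqrt.2 (le_max_left _ _)
    have h2 : 1 ≤ √(L / μ) := Real.one_le_sqrt.2 ((one_le_div hμ).2 hLμ)
    exact one_le_mul_of_one_le_of_one_le h1 h2
  have hpl := Real.posLog_nonneg (x := L / Lmin)
  have hinner : √(Lmax / μ) *
      Real.posLog (4 * Lmax ^ 2 * (Lmax + μ) * D ^ 2 / (Lmin * tol ^ 2)) + 3 ≤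
      (√(6 * γ₁) * k + 3) * (X * M) := by
    have h1 : √(Lmax / μ) * Real.posLog (4 * Lmax ^ 2 * (Lmax + μ) * D ^ 2 / (Lmin * tol ^ 2)) ≤
        √(6 * γ₁) * X * (k * M) :=
      mul_le_mul hsqrt hlog Real.posLog_nonneg (by positivity)
    have h2 : 1 ≤ X * M := one_le_mul_of_one_le_of_one_le hX1 hM
    linarith
  have hc : 0 ≤ 14 * (2 + 2 / Real.log γ₁) := by positivity
  calc apgCost Lψ μ Lmin γ₁ D tol
      ≤ 14 * ((2 + 2 / Real.log γ₁) * (1 + Real.posLog (L / Lmin))) *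
        ((√(6 * γ₁) * k + 3) * (X * M)) := by
        unfold apgCost
        have h0 := two_le_trialBound (Lψ := Lψ) (Lmin := Lmin) hγ
        have h3 : 0 ≤ √(Lmax / μ) *
          Real.posLog (4 * Lmax ^ 2 * (Lmax + μ) * D ^ 2 / (Lmin * tol ^ 2)) + 3 := by
          have := mul_nonneg (Real.sqrt_nonneg (Lmax / μ)) (Real.posLog_nonneg
            (x := 4 * Lmax ^ 2 * (Lmax + μ) * D ^ 2 / (Lmin * tol ^ 2)))
          linarith
        exact mul_le_mul (mul_le_mul_of_nonneg_left htrial (by norm_num)) hinner h3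
          (by positivity)
    _ = _ := by ring

end

/-- The factor of the cost of the accelerated method that depends on the problem other than through
logarithms of its data. -/
noncomputable def condFactor (Lf Lg μ Lmin Z : ℝ) : ℝ :=
  √(max 1 (Lmin / (Lf + Lg * (1 + Z)))) * √((Lf + Lg * (1 + Z)) / μ) *
    (1 + Real.posLog ((Lf + Lg * (1 + Z)) / Lmin))

/-- The constant in the cost of the accelerated method, for tolerances that are at least
`E ^ (-(4 s + 35))`. -/
noncomputable def apgConst (γ₁ : ℝ) (s : ℕ) : ℝ :=
  14 * (2 + 2 / Real.log γ₁) * (√(6 * γ₁) * (3 * s + 24 + 2 * (4 * s + 35) : ℕ) + 3)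

theorem apgCost_nonneg (Lψ μ Lmin D tol : ℝ) {γ₁ : ℝ} (hγ : 1 < γ₁) :
    0 ≤ apgCost Lψ μ Lmin γ₁ D tol := by
  have h0 := two_le_trialBound (Lψ := Lψ) (Lmin := Lmin) hγ
  have h1 := Real.posLog_nonneg (x := 4 * max Lmin (γ₁ * Lψ) ^ 2 * (max Lmin (γ₁ * Lψ) + μ) *
    D ^ 2 / (Lmin * tol ^ 2))
  unfold apgCost
  positivity

theorem apgConst_nonneg {γ₁ : ℝ} (hγ : 1 < γ₁) (s : ℕ) : 0 ≤ apgConst γ₁ s := by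
  have := Real.log_pos hγ
  unfold apgConst
  positivity

theorem one_le_condFactor {Lf Lg μ Lmin Z : ℝ} (hμ : 0 < μ) (hμL : μ ≤ Lf) (hLg : 0 ≤ Lg)
    (hZ : 0 ≤ Z) : 1 ≤ condFactor Lf Lg μ Lmin Z := by
  have h0 : μ ≤ Lf + Lg * (1 + Z) := by
    have : 0 ≤ Lg * (1 + Z) := by positivity
    linarith
  have h1 : 1 ≤ √(max 1 (Lmin / (Lf + Lg * (1 + Z)))) := Real.one_le_sqrt.2 (le_max_left _ _)
  have h2 : 1 ≤ √((Lf + Lg * (1 + Z)) / μ) := Real.one_le_sqrt.2 ((one_le_div hμ).2 h0)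
  have h3 := Real.posLog_nonneg (x := (Lf + Lg * (1 + Z)) / Lmin)
  exact one_le_mul_of_one_le_of_one_le (one_le_mul_of_one_le_of_one_le h1 h2) (by linarith)

section

variable {n m : ℕ} {P : Problem n m} {E : ℝ} {s : ℕ} {σ γ₁ Lf Lg μ Lmin β₀ ε β b : ℝ}
  {z zs : Vec m}

theorem Scale.betaMax (h : Scale E s σ γ₁ μ (boundJ P) β₀ Lmin ε Lf Lg ‖zs‖ (boundG P)
    (diamDom P)) : PowLe E (betaMax β₀ σ ε zs) (s + 8) := by
  have hE := h.two_le
  have h16 : PowLe E 16 4 := powLe_of_le_two_pow hE (by norm_num) (by norm_num)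
  rw [CutPlaneALM.betaMax, div_eq_mul_inv]
  exact ((h.hβ₀.mono hE (by omega)).add hE ((((h16.mul h.hσ).mul (h.hZ.pow 2)).mul h.hε').mono hE
    (by omega : _ ≤ s + 7)))

/-- A bound for the cost of the ellipsoid method, for all parameters that occur in the outer loop:
`m² log E` cuts, each with one call of the accelerated method. -/
theorem Scale.ellCost_le (h : Scale E s σ γ₁ μ (boundJ P) β₀ Lmin ε Lf Lg ‖zs‖ (boundG P)
    (diamDom P)) (hR : Regular P Lf Lg μ) (hn : 0 < n) (hm : 1 < m) (hne : (dom P.h).Nonempty)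
    (hJ : 0 < boundJ P) (hβ₀ : 0 < β₀) (hσ : 1 < σ) (hε : 0 < ε) (hγ₁ : 1 < γ₁)
    (hLmin : 0 < Lmin) (hM : 1 ≤ Real.log E) (hβ : β₀ ≤ β) (hβ' : β ≤ CutPlaneALM.betaMax β₀ σ ε zs)
    (hz : ‖z‖ ≤ 1 + 3 * ‖zs‖) (hb : 1 / β ≤ b) (hb' : b ≤ 2 * (1 + 3 * ‖zs‖) / β) :
    ellCost P Lf Lg μ Lmin γ₁ β z (subTol μ σ ε / (3 * β * boundJ P)) b ≤
      ((27 * s + 275) * (m ^ 2 * Real.log E)) *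
        ((apgConst γ₁ s + 1) * (condFactor Lf Lg μ Lmin ‖zs‖ * Real.log E)) := by
  have hE := h.two_le
  have hμ := hR.μ_pos
  have hLg := hR.Lg_nonneg hn
  have hμL := hR.μ_le_Lf hn
  have hβ0 : 0 < β := hβ₀.trans_le hβ
  have hb0 : 0 < b := lt_of_lt_of_le (by positivity) hb
  have he := subTol_pos hμ hσ hε
  have heinv := h.inv_subTol
  set e := subTol μ σ ε
  have hδ : 0 < e / (3 * β * boundJ P) := by positivity
  set δ := e / (3 * β * boundJ P) with hδdef
  have hzn := norm_nonneg zs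
  -- sizes of the parameters of the run
  have hnum : ∀ {x : ℝ} (a : ℕ), 0 ≤ x → x ≤ 2 ^ a → PowLe E x a := fun a hx hxa =>
    powLe_of_le_two_pow hE hx hxa
  have h3 : PowLe E 3 2 := hnum 2 (by norm_num) (by norm_num)
  have h4 : PowLe E 4 2 := hnum 2 (by norm_num) (by norm_num)
  have h8 : PowLe E 8 3 := hnum 3 (by norm_num) (by norm_num)
  have sβ : PowLe E β (s + 8) := h.betaMax.of_le hβ0.le hβ'
  have sβinv : PowLe E β⁻¹ 1 := h.hβ₀'.of_le (by positivity) (by gcongr)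
  have sR : PowLe E (1 + 3 * ‖zs‖) 3 := (h3.mul h.hZ).of_le (by positivity) (by linarith)
  have sb : PowLe E b 5 := by
    have h2 : PowLe E 2 1 := hnum 1 (by norm_num) (by norm_num)
    rw [div_eq_mul_inv] at hb'
    exact (((h2.mul sR).mul sβinv).mono hE (by omega)).of_le hb0.le hb'
  have sδ : PowLe E δ⁻¹ (3 * s + 18) := by
    rw [hδdef, inv_div, div_eq_mul_inv]
    exact (((h3.mul sβ).mul h.hB).mul heinv).mono hE (by omega)
  have sQ : PowLe E (μ + β * boundJ P ^ 2) (s + 11) :=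
    (h.hμ.mono hE (by omega)).add hE (sβ.mul (h.hB.pow 2))
  have stol : PowLe E (ellTol P μ β δ)⁻¹ (4 * s + 35) := by
    refine PowLe.inv_min ?_ ?_
    · rw [inv_div, div_eq_mul_inv, mul_inv]
      exact ((h4.mul h.hB).mul (h.hμ'.mul sδ)).mono hE (by omega)
    · rw [inv_div, div_eq_mul_inv, mul_inv, ← inv_pow]
      exact (((h8.mul h.hB).mul sQ).mul ((h.hμ'.pow 2).mul sδ)).mono hE (by omega)
  have sκ : PowLe E (dualCond P μ β) (s + 12) := by
    rw [dualCond, div_eq_mul_inv]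
    exact sQ.mul h.hμ'
  have sBd : PowLe E (boundDualGrad P β z b) (s + 15) := by
    refine PowLe.of_le ?_ (hR.boundDualGrad_nonneg hne hβ0 hb0.le z)
      (hR.boundDualGrad_le hne hβ0 hb0.le z)
    exact (sβ.mul ((h.hG.mono hE (by omega)).add hE sb)).add hE
      ((sR.mono hE (by omega)).of_le (norm_nonneg _) hz)
  have sη : PowLe E (ellEta P μ β z δ b)⁻¹ (9 * s + 84) := by
    refine PowLe.inv_min ?_ ?_
    · refine (sβ.mono hE (by omega)).of_le (inv_pos.2 hb0).le ?_
      rw [← inv_inv β, ← one_div β]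
      gcongr
    · refine PowLe.of_le ?_ (inv_pos.2 (hR.etaPlus_spec hne hβ0 hδ hb0.le z).1).le
        (hR.inv_etaPlus_le hne hβ0 hδ hb0.le z)
      rw [div_eq_mul_inv, div_eq_mul_inv, mul_inv, ← inv_pow]
      have h128 : PowLe E 128 7 := hnum 7 (by norm_num) (by norm_num)
      exact ((((h8.mul sκ).mul sδ).mono hE (by omega)).add hE
        (((((h128.mul (sκ.pow 2)).mul sBd).mul (sβinv.mul (sδ.pow 2)))).mono hE
          (by omega : _ ≤ 9 * s + 83)))
  have hsteps : ellSteps m b (ellEta P μ β z δ b) + 2 ≤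
      (27 * s + 275) * (m ^ 2 * Real.log E) := by
    have h1 : Real.log (4 * b / ellEta P μ β z δ b) ≤ ((9 * s + 91 : ℕ) : ℝ) * Real.log E := by
      rw [div_eq_mul_inv]
      exact (((h4.mul sb).mul sη).mono hE (by omega)).log_le hE
    have hm2 : (2 : ℝ) ≤ m := by exact_mod_cast hm
    have h2 : 2 * (m : ℝ) * (m + 1) ≤ 3 * m ^ 2 := by nlinarith
    have h5 : 1 ≤ (m : ℝ) ^ 2 * Real.log E := by
      have : (1 : ℝ) ≤ m ^ 2 := by nlinarith
      exact one_le_mul_of_one_le_of_one_le this hM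
    have h6 : ellSteps m b (ellEta P μ β z δ b) ≤
        3 * m ^ 2 * (((9 * s + 91 : ℕ) : ℝ) * Real.log E) := by
      refine (mul_le_mul_of_nonneg_left h1 (by positivity)).trans
        (mul_le_mul_of_nonneg_right h2 (by positivity))
    push_cast at h6
    linarith
  have hβb : β * b ≤ 6 * (1 + ‖zs‖) := by
    have := (le_div_iff₀ hβ0).1 hb'
    linarith
  have hLψ : Lf + β * b * Lg ≤ 6 * (Lf + Lg * (1 + ‖zs‖)) := by
    have := mul_le_mul_of_nonneg_right hβb hLg
    linarith
  have hLψ0 : 0 < Lf + β * b * Lg := by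
    have : 0 ≤ β * b * Lg := by positivity
    linarith
  have hapg : apgCost (Lf + β * b * Lg) μ Lmin γ₁ (diamDom P) (ellTol P μ β δ) ≤
      apgConst γ₁ s * (condFactor Lf Lg μ Lmin ‖zs‖ * Real.log E) :=
    h.apgCost_le hγ₁ hμ hLmin hLg hzn hμL hM hLψ0 hLψ stol
  have hone : 1 ≤ condFactor Lf Lg μ Lmin ‖zs‖ * Real.log E :=
    one_le_mul_of_one_le_of_one_le (one_le_condFactor hμ hμL hLg hzn) hM
  have hapg0 := apgCost_nonneg (Lf + β * b * Lg) μ Lmin (diamDom P) (ellTol P μ β δ) hγ₁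
  refine mul_le_mul hsteps (by linarith) (by linarith) ?_
  have := zero_le_one.trans hM
  positivity

end

theorem powLe_exp_of_abs_log_le {x M : ℝ} (hx : 0 < x) (h : |Real.log x| ≤ M) :
    PowLe (Real.exp M) x 1 ∧ PowLe (Real.exp M) x⁻¹ 1 := by
  obtain ⟨h1, h2⟩ := abs_le.1 h
  refine ⟨⟨hx.le, ?_⟩, ⟨(inv_pos.2 hx).le, ?_⟩⟩
  · rw [pow_one]
    exact (Real.log_le_iff_le_exp hx).1 h2
  · rw [pow_one, ← Real.log_le_iff_le_exp (inv_pos.2 hx), Real.log_inv]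
    linarith

theorem powLe_exp_of_log_one_add_le {x M : ℝ} (hx : 0 ≤ x) (h : Real.log (1 + x) ≤ M) :
    PowLe (Real.exp M) (1 + x) 1 ∧ PowLe (Real.exp M) x 1 := by
  have h1 : 1 + x ≤ Real.exp M := (Real.log_le_iff_le_exp (by linarith)).1 h
  refine ⟨⟨by linarith, ?_⟩, ⟨hx, ?_⟩⟩ <;> rw [pow_one] <;> linarith

/-- The scale `exp (max |log ε| Λ)` dominates all data. -/
theorem exists_scale {n m : ℕ} {P : Problem n m} {Lf Lg μ Lmin β₀ ε σ γ₁ : ℝ} {zs : Vec m}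
    (hμ : 0 < μ) (hJ : 0 < boundJ P) (hβ₀ : 0 < β₀) (hLmin : 0 < Lmin) (hε : 0 < ε)
    (hLf : 0 ≤ Lf) (hLg : 0 ≤ Lg) (hG : 0 ≤ boundG P) (hD : 0 ≤ diamDom P) (hσ : 1 < σ)
    (hγ₁ : 1 < γ₁) {s : ℕ} (hs : σ + (σ - 1)⁻¹ + γ₁ ≤ s) :
    1 ≤ max |Real.log ε| (logSize P Lf Lg μ β₀ Lmin zs) ∧
    Scale (Real.exp (max |Real.log ε| (logSize P Lf Lg μ β₀ Lmin zs))) s σ γ₁ μ (boundJ P) β₀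
      Lmin ε Lf Lg ‖zs‖ (boundG P) (diamDom P) := by
  set M := max |Real.log ε| (logSize P Lf Lg μ β₀ Lmin zs) with hM
  have hzn := norm_nonneg zs
  have hε' : |Real.log ε| ≤ M := le_max_left _ _
  have hsize : logSize P Lf Lg μ β₀ Lmin zs ≤ M := le_max_right _ _
  have h1 := abs_nonneg (Real.log μ)
  have h2 := abs_nonneg (Real.log (boundJ P))
  have h3 := abs_nonneg (Real.log β₀)
  have h4 := abs_nonneg (Real.log Lmin)
  have h5 := Real.log_nonneg (by linarith : 1 ≤ 1 + Lf)
  have h6 := Real.log_nonneg (by linarith : 1 ≤ 1 + Lg)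
  have h7 := Real.log_nonneg (by linarith : 1 ≤ 1 + ‖zs‖)
  have h8 := Real.log_nonneg (by linarith : 1 ≤ 1 + boundG P)
  have h9 := Real.log_nonneg (by linarith : 1 ≤ 1 + diamDom P)
  unfold logSize at hsize
  have hM1 : 1 ≤ M := by linarith
  have hE : 2 ≤ Real.exp M := by
    have := Real.add_one_le_exp M
    linarith
  have hσ1 : 0 < (σ - 1)⁻¹ := inv_pos.2 (by linarith)
  have hpow : ∀ {x : ℝ}, 0 ≤ x → x ≤ s → PowLe (Real.exp M) x s := fun hx hxs =>
    powLe_of_le_two_pow hE hx (hxs.trans (by exact_mod_cast s.lt_two_pow_self.le))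
  obtain ⟨a1, a1'⟩ := powLe_exp_of_abs_log_le hμ (by linarith : |Real.log μ| ≤ M)
  obtain ⟨a2, a2'⟩ := powLe_exp_of_abs_log_le hJ (by linarith : |Real.log (boundJ P)| ≤ M)
  obtain ⟨a3, a3'⟩ := powLe_exp_of_abs_log_le hβ₀ (by linarith : |Real.log β₀| ≤ M)
  obtain ⟨a4, a4'⟩ := powLe_exp_of_abs_log_le hLmin (by linarith : |Real.log Lmin| ≤ M)
  obtain ⟨a5, a5'⟩ := powLe_exp_of_abs_log_le hε hε'
  exact ⟨hM1, {
    two_le := hE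
    hσ := hpow (by linarith) (by linarith)
    hσ' := hpow hσ1.le (by linarith)
    hγ₁ := hpow (by linarith) (by linarith)
    hμ := a1
    hμ' := a1'
    hB := a2
    hB' := a2'
    hβ₀ := a3
    hβ₀' := a3'
    hLmin := a4
    hLmin' := a4'
    hε := a5
    hε' := a5'
    hLf := (powLe_exp_of_log_one_add_le hLf (by linarith)).2
    hLg := (powLe_exp_of_log_one_add_le hLg (by linarith)).2
    hZ := (powLe_exp_of_log_one_add_le hzn (by linarith)).1
    hG := (powLe_exp_of_log_one_add_le hG (by linarith)).2
    hD := (powLe_exp_of_log_one_add_le hD (by linarith)).2 }⟩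

/-- The number of search radii that are tried by one call of StEM is logarithmic in `‖z*‖`. -/
theorem stem_rounds_le {Z : ℝ} (hZ : 0 ≤ Z) :
    2 + Real.log (1 + 3 * Z) / Real.log 2 ≤ 6 * (1 + Real.posLog Z) := by
  have hl := Real.log_two_gt_d9
  have h0 := Real.posLog_nonneg (x := Z)
  have h1 : Real.log (1 + 3 * Z) ≤ 2 * Real.log 2 + Real.posLog Z := by
    have h4 : 2 * Real.log 2 = Real.log 4 := by
      rw [show (4 : ℝ) = 2 ^ 2 by norm_num, Real.log_pow]
      norm_num
    rcases le_total Z 1 with h | h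
    · have : Real.log (1 + 3 * Z) ≤ Real.log 4 := Real.log_le_log (by linarith) (by linarith)
      linarith
    · have h2 : Real.log (1 + 3 * Z) ≤ Real.log (4 * Z) :=
        Real.log_le_log (by linarith) (by linarith)
      rw [Real.log_mul (by norm_num) (by linarith)] at h2
      have h3 : Real.log Z ≤ Real.posLog Z := le_max_right _ _
      linarith
  have h2 : Real.log (1 + 3 * Z) / Real.log 2 ≤ 4 * (1 + Real.posLog Z) := by
    rw [div_le_iff₀ (by linarith)]
    nlinarith
  linarith

end CutPlaneALM

theorem mainTheorem1 (σ γ₁ : ℝ) (hσ : 1 < σ) (hγ₁ : 1 < γ₁) :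
    ∃ C : ℝ, 0 < C ∧
      ∀ (n m : ℕ) (_ : 0 < n) (_ : 1 < m)
        (P : CutPlaneALM.Problem n m) (Lf Lg μ : ℝ) (_ : CutPlaneALM.Regular P Lf Lg μ)
        (xs : CutPlaneALM.Vec n) (zs : CutPlaneALM.Vec m) (_ : CutPlaneALM.IsKKT P xs zs)
        (β₀ Lmin γ₂ ε : ℝ) (_ : 0 < β₀) (_ : 0 < Lmin) (_ : 1 ≤ γ₂) (_ : 0 < ε)
        (_ : ∀ k : ℕ, CutPlaneALM.subTol μ σ ε ≤
          min ε (24 * CutPlaneALM.boundJ P *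
            (μ + β₀ * σ ^ k * CutPlaneALM.boundJ P ^ 2) / μ))
        (c : CutPlaneALM.Choices n m) (_ : c.Valid P),
        ∃ (x : CutPlaneALM.Vec n) (z : CutPlaneALM.Vec m) (T : ℕ),
          (CutPlaneALM.ialm P ⟨μ, Lmin, γ₁, γ₂⟩ β₀ σ ε
            (fun _ => CutPlaneALM.subTol μ σ ε) c).Returns (x, z) T ∧
          CutPlaneALM.IsEpsKKTPair P ε x z ∧
          CutPlaneALM.IsEpsKKT P ε x ∧
          (T : ℝ) ≤ C * CutPlaneALM.hiddenFactor Lf Lg Lmin zs *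
            ((m : ℝ) ^ 2 * √((Lf + Lg * (1 + ‖zs‖)) / μ) *
              max |Real.log ε| (CutPlaneALM.logSize P Lf Lg μ β₀ Lmin zs) ^ 3) := by
  obtain ⟨s, hs⟩ := exists_nat_ge (σ + (σ - 1)⁻¹ + γ₁)
  have hlogσ := Real.log_pos hσ
  have hA := CutPlaneALM.apgConst_nonneg hγ₁ s
  set A := CutPlaneALM.apgConst γ₁ s with hAdef
  refine ⟨(2 + 8 / Real.log σ) * (6 * ((27 * s + 275) * (A + 1)) + A + 4), by positivity, ?_⟩
  intro n m hn hm P Lf Lg μ hR xs zs hK β₀ Lmin γ₂ ε hβ₀ hLmin hγ₂ hε hsub c hc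
  have hμ := hR.μ_pos
  have hLg := hR.Lg_nonneg hn
  have hμL := hR.μ_le_Lf hn
  have hLf := hμ.trans_le hμL
  have hxs := (hK.zero_mem hR).1
  have hzn := norm_nonneg zs
  -- if `B_g` were zero, then the assumed upper bound for the tolerance would be zero as well
  have hJ : 0 < CutPlaneALM.boundJ P := by
    refine (hR.boundJ_nonneg hxs).lt_of_ne fun h => ?_
    have h1 := (CutPlaneALM.subTol_pos hμ hσ hε).trans_le ((hsub 0).trans (min_le_right _ _))
    rw [← h] at h1
    simp at h1
  obtain ⟨hM, hS⟩ := CutPlaneALM.exists_scale (zs := zs) hμ hJ hβ₀ hLmin hε hLf.le hLg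
    ((norm_nonneg _).trans (hR.norm_g_le hxs)) Metric.diam_nonneg hσ hγ₁ hs
  set M := max |Real.log ε| (CutPlaneALM.logSize P Lf Lg μ β₀ Lmin zs) with hMdef
  have hE := hS.two_le
  have hcond := CutPlaneALM.one_le_condFactor (Lmin := Lmin) hμ hμL hLg hzn
  set K := CutPlaneALM.condFactor Lf Lg μ Lmin ‖zs‖ with hKdef
  have hM' : 1 ≤ Real.log (Real.exp M) := by rwa [Real.log_exp]
  have hm1 : (1 : ℝ) ≤ (m : ℝ) ^ 2 := one_le_pow₀ (by exact_mod_cast hm.le)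
  have hM0 : 0 ≤ M := by linarith
  have h3 : CutPlaneALM.PowLe (Real.exp M) 3 2 :=
    CutPlaneALM.powLe_of_le_two_pow hE (by norm_num) (by norm_num)
  have h16 : CutPlaneALM.PowLe (Real.exp M) 16 4 :=
    CutPlaneALM.powLe_of_le_two_pow hE (by norm_num) (by norm_num)
  have htol : CutPlaneALM.PowLe (Real.exp M) (CutPlaneALM.subTol μ σ ε / 3)⁻¹ (4 * s + 35) := by
    rw [inv_div, div_eq_mul_inv]
    exact (h3.mul hS.inv_subTol).mono hE (by omega)
  have hc₂ : CutPlaneALM.apgCost (Lf + 2 * (1 + 3 * ‖zs‖) * Lg) μ Lmin γ₁ (CutPlaneALM.diamDom P)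
      (CutPlaneALM.subTol μ σ ε / 3) ≤ A * (K * M) := by
    have h := hS.apgCost_le hγ₁ hμ hLmin hLg hzn hμL hM'
      (Lψ := Lf + 2 * (1 + 3 * ‖zs‖) * Lg) (by positivity) ?_ htol
    · rwa [Real.log_exp] at h
    · have : 0 ≤ Lg * ‖zs‖ := by positivity
      linarith
  have hspec := hR.ialm_spec (γ₁ := γ₁) (γ₂ := γ₂) hn hm hK hJ hβ₀ hσ hε hγ₁ hγ₂ hLmin hc
    (c₁ := ((27 * s + 275) * (m ^ 2 * M)) * ((A + 1) * (K * M))) (c₂ := A * (K * M))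
    (fun β b z hβ hβ' hz hb hb' => by
      have h := hS.ellCost_le hR hn hm ⟨xs, hxs⟩ hJ hβ₀ hσ hε hγ₁ hLmin hM' hβ hβ' hz hb hb'
      rwa [Real.log_exp] at h)
    hc₂ (by positivity)
  obtain ⟨r, T, hret, hT, hQ⟩ := hspec
  refine ⟨r.1, r.2, T, hret, hQ, ⟨r.2, hQ⟩, hT.trans ?_⟩
  have hW := CutPlaneALM.stem_rounds_le hzn
  have hpl := Real.posLog_nonneg (x := ‖zs‖)
  have houter : 2 + Real.posLog (16 * (1 + ‖zs‖) ^ 2 / (β₀ * ε)) / Real.log σ ≤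
      (2 + 8 / Real.log σ) * M := by
    have h1 : CutPlaneALM.PowLe (Real.exp M) (16 * (1 + ‖zs‖) ^ 2 / (β₀ * ε)) 8 := by
      rw [div_eq_mul_inv, mul_inv]
      exact ((h16.mul (hS.hZ.pow 2)).mul (hS.hβ₀'.mul hS.hε')).mono hE (by omega)
    have h2 := h1.posLog_le hE
    rw [Real.log_exp] at h2
    have h4 := div_le_div_of_nonneg_right h2 hlogσ.le
    have h5 : (2 + 8 / Real.log σ) * M = 2 * M + 8 * M / Real.log σ := by ring
    rw [h5]
    push_cast at h4
    linarith
  set W := 1 + Real.posLog ‖zs‖ with hWdef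
  have hW1 : 1 ≤ W := by linarith
  set Q := (m : ℝ) ^ 2 * W * K * M ^ 2 with hQdef
  have hKM : 1 ≤ K * M := one_le_mul_of_one_le_of_one_le hcond hM
  have hmWM : 1 ≤ (m : ℝ) ^ 2 * W * M :=
    one_le_mul_of_one_le_of_one_le (one_le_mul_of_one_le_of_one_le hm1 hW1) hM
  have hKMQ : K * M ≤ Q := by
    have := le_mul_of_one_le_left (zero_le_one.trans hKM) hmWM
    calc K * M ≤ m ^ 2 * W * M * (K * M) := this
      _ = Q := by rw [hQdef]; ring
  have hinner : (2 + Real.log (1 + 3 * ‖zs‖) / Real.log 2) *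
      ((27 * s + 275) * (m ^ 2 * M) * ((A + 1) * (K * M))) + A * (K * M) + 4 ≤
      (6 * ((27 * s + 275) * (A + 1)) + A + 4) * Q := by
    have h1 : (2 + Real.log (1 + 3 * ‖zs‖) / Real.log 2) *
        ((27 * s + 275) * (m ^ 2 * M) * ((A + 1) * (K * M))) ≤
        6 * W * ((27 * s + 275) * (m ^ 2 * M) * ((A + 1) * (K * M))) :=
      mul_le_mul_of_nonneg_right hW (by positivity)
    have h2 : 6 * W * ((27 * s + 275) * (m ^ 2 * M) * ((A + 1) * (K * M))) =
        6 * ((27 * s + 275) * (A + 1)) * Q := by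
      rw [hQdef]
      ring
    have h4 := mul_le_mul_of_nonneg_left hKMQ hA
    linarith
  have hinner0 : 0 ≤ (2 + Real.log (1 + 3 * ‖zs‖) / Real.log 2) *
      ((27 * s + 275) * (m ^ 2 * M) * ((A + 1) * (K * M))) + A * (K * M) + 4 := by
    have h1 := Real.log_nonneg (by linarith : 1 ≤ 1 + 3 * ‖zs‖)
    positivity
  refine (mul_le_mul houter hinner hinner0 (by positivity)).trans (le_of_eq ?_)
  rw [hQdef, hKdef, hWdef, CutPlaneALM.condFactor, CutPlaneALM.hiddenFactor]
  ring
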